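/- **Theorem 3.1.** *Design.* Subjects $i=1,2,\dots$ are i.i.d.; subject $i$ has a real covariate $Z_i$ and potential observation times and measurements $(T_{ij},Y_{ij})_{j\ge1}$ (for instance, $Y_{ij}$ is a noisy value at $T_{ij}$ of a random function of time). Within each subject the times $T_{ij}$ are i.i.d.; every $(T_{ij},Z_i,Y_{ij})$ has the law of $(T,Z,Y)$ with joint density $f_3(t,z,y)$, and for $j\neq k$ every $(T_{ij},T_{ik},Z_i,Y_{ij},Y_{ik})$ has joint density $f_5(t_1,t_2,z,y_1,y_2)$; measurements of the same subject may be dependent. Put $$f_2(t,z)=\int f_3(t,z,y)\,dy,\qquad \mu(t,z)=E(Y\mid T=t,Z=z)=\frac{\int y f_3(t,z,y)\,dy}{f_2(t,z)},\qquad \mathrm{Var}(Y\mid t,z)=\frac{\int (y-\mu(t,z))^2f_3(t,z,y)\,dy}{f_2(t,z)};$$ $\mu$ is the covariate-dependent mean function. With $n$ subjects, only the first $N_i=N_i(n)$ pairs of subject $i$ are observed, where $N_1(n),\dots,N_n(n)$ are i.i.d. copies of a positive integer-valued $N=N(n)$ with $E N(n)^4<\infty$, independent of all other random variables, and $$\limsup_{n\to\infty}\frac{E[N(n)^2]}{(E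 N(n))^2}<\infty,\qquad \limsup_{n\to\infty}\frac{E[N(n)^4]}{(E[N(n)^2])^2}<\infty .$$ *Kernel.* $K_2:\mathbb R^2\to\mathbb R$ is measurable, square-integrable, with compact support, $\iint K_2=1$ and $\iint uK_2(u,v)\,du\,dv=\iint vK_2(u,v)\,du\,dv=0$. *Bandwidths.* $h_{\mu,t},h_{\mu,z},h>0$ depend on $n$, $h_{\mu,t}\asymp h_{\mu,z}\asymp h$, $h\to0$, $nE(N)h^2\to\infty$, $E(N)h\to0$, $nE(N)h^6$ is bounded, and, for some $0<\rho_\mu,\tau_\mu<\infty$, $h_{\mu,z}/h_{\mu,t}\to\rho_\mu$ and $nE(N)h_{\mu,t}^6\to\tau_\mu^2$. *Regularity at a fixed point $(t,z)$.* (i) $f_2$ and $\mu$ are $C^2$ in a neighbourhood of $(t,z)$ and $f_2(t,z)>0$. (ii) $f_3(\cdot,\cdot,y)$ is $C^2$ near $(t,z)$ for each $y$, and $f_3$ and its second-order partial derivatives in the first two arguments are continuous at $(t,z)$ uniformly in $y\in\mathbb R$. (iii) $f_5$ is continuous at $(t_1,t_2,z)=(t,t,z)$ uniformly in $(y_1,y_2)\in\mathbb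 R^2$. (iv) $(t',z')\mapsto\int y^2f_3(t',z',y)\,dy$ is finite near $(t,z)$ and continuous at $(t,z)$. (Here $g(x,y)$ is continuous at $x$ uniformly in $y$ if for every $\varepsilon>0$ there is a neighbourhood of $x$, not depending on $y$, on which $|g(x',y)-g(x,y)|<\varepsilon$ for all $y$.) *Conclusion.* Let $\bar N=\frac1n\sum_{i=1}^nN_i$ and $$\hat\mu_{NW}(t,z)=\frac{\sum_{i=1}^n\sum_{j=1}^{N_i}K_2\big(\frac{t-T_{ij}}{h_{\mu,t}},\frac{z-Z_i}{h_{\mu,z}}\big)Y_{ij}}{\sum_{i=1}^n\sum_{j=1}^{N_i}K_2\big(\frac{t-T_{ij}}{h_{\mu,t}},\frac{z-Z_i}{h_{\mu,z}}\big)}.$$ (The value $0$ is assigned where the denominator vanishes.) Then, as $n\to\infty$, $$\sqrt{n\bar N h_{\mu,t}h_{\mu,z}}\,\big[\hat\mu_{NW}(t,z)-\mu(t,z)\big]\xrightarrow{\ \mathcal D\ }N(\beta_{NW},\Sigma_{NW}),$$ where, with $\alpha_1=\mu f_2$ and $\|K_2\|^2=\iint K_2^2$, $$\beta_{NW}=\sum_{k_1+k_2=2}\frac{1}{k_1!k_2!}\Big[\iint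 s_1^{k_1}s_2^{k_2}K_2(s_1,s_2)\,ds_1ds_2\Big]\Big\{\frac{1}{f_2(t,z)}\frac{\partial^2\alpha_1}{\partial t^{k_1}\partial z^{k_2}}(t,z)-\frac{\mu(t,z)}{f_2(t,z)}\frac{\partial^2f_2}{\partial t^{k_1}\partial z^{k_2}}(t,z)\Big\}\,\tau_\mu\sqrt{\rho_\mu^{2k_2+1}},$$ $$\Sigma_{NW}=\frac{\mathrm{Var}(Y\mid t,z)\,\|K_2\|^2}{f_2(t,z)}\ (\ge0).$$ -/

import Mathlib

open MeasureTheory ProbabilityTheory Filter Topology Asymptotics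

noncomputable section

/-! ### Densities and the functions derived from them -/

/-- `f₂(t, z) = ∫ f₃(t, z, y) dy`, the joint density of `(T, Z)`. -/
def marginalDensity (f₃ : ℝ → ℝ → ℝ → ℝ) (t z : ℝ) : ℝ :=
  ∫ y, f₃ t z y

/-- `μ(t, z) = E(Y | T = t, Z = z)`, computed from the joint density of `(T, Z, Y)`. -/
def condMean (f₃ : ℝ → ℝ → ℝ → ℝ) (t z : ℝ) : ℝ :=
  (∫ y, y * f₃ t z y) / marginalDensity f₃ t z

/-- `Var(Y | T = t, Z = z)`, computed from the joint density of `(T, Z, Y)`. -/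
def condVariance (f₃ : ℝ → ℝ → ℝ → ℝ) (t z : ℝ) : ℝ :=
  (∫ y, (y - condMean f₃ t z) ^ 2 * f₃ t z y) / marginalDensity f₃ t z

/-- The partial derivative `∂^(k₁+k₂) g / ∂t^k₁ ∂z^k₂` at `(t, z)`. -/
def mixedPartial (k₁ k₂ : ℕ) (g : ℝ → ℝ → ℝ) (t z : ℝ) : ℝ :=
  iteratedDeriv k₁ (fun t' => iteratedDeriv k₂ (fun z' => g t' z') z) t

/-- `g(x, y)` is continuous at the point `x`, uniformly in `y`: for every `ε > 0` there is a
neighbourhood of `x`, not depending on `y`, on which `|g(x', y) - g(x, y)| < ε` for all `y`. -/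
def ContinuousAtUniformly {A B : Type*} [TopologicalSpace A] (g : A → B → ℝ) (x : A) : Prop :=
  ∀ ε > 0, ∀ᶠ x' in 𝓝 x, ∀ y, |g x' y - g x y| < ε

/-! ### The sparse longitudinal sampling design -/

section Design

variable {Ω : Type*} [MeasurableSpace Ω]

/-- The data of subject `i`: the covariate `Zᵢ` with the sequence of all potential (observation
time, measurement) pairs `(Tᵢⱼ, Yᵢⱼ)`, of which the first `Nᵢ` are observed. -/
def subjectData (T Y : ℕ → ℕ → Ω → ℝ) (Z : ℕ → Ω → ℝ) (i : ℕ) (ω : Ω) : ℝ × (ℕ → ℝ × ℝ) :=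
  (Z i ω, fun j => (T i j ω, Y i j ω))

/-- Random design. The subjects are i.i.d.; within a subject the observation times are i.i.d.;
every triple `(Tᵢⱼ, Zᵢ, Yᵢⱼ)` has density `f₃` and, for `j ≠ k`, every
`(Tᵢⱼ, Tᵢₖ, Zᵢ, Yᵢⱼ, Yᵢₖ)` has density `f₅`. The measurements of one subject may be dependent. -/
structure RandomDesign (P : Measure Ω) (T Y : ℕ → ℕ → Ω → ℝ) (Z : ℕ → Ω → ℝ)
    (f₃ : ℝ → ℝ → ℝ → ℝ) (f₅ : ℝ → ℝ → ℝ → ℝ → ℝ → ℝ) : Prop where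
  measurable_T : ∀ i j, Measurable (T i j)
  measurable_Y : ∀ i j, Measurable (Y i j)
  measurable_Z : ∀ i, Measurable (Z i)
  indep_subjects : iIndepFun (subjectData T Y Z) P
  identDistrib_subjects : ∀ i, IdentDistrib (subjectData T Y Z i) (subjectData T Y Z 0) P P
  indep_times : ∀ i, iIndepFun (fun j => T i j) P
  measurable_f₃ : Measurable (fun q : ℝ × ℝ × ℝ => f₃ q.1 q.2.1 q.2.2)
  f₃_nonneg : ∀ t z y, 0 ≤ f₃ t z y
  law_single : ∀ i j, P.map (fun ω => (T i j ω, Z i ω, Y i j ω)) =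
    volume.withDensity (fun q : ℝ × ℝ × ℝ => ENNReal.ofReal (f₃ q.1 q.2.1 q.2.2))
  measurable_f₅ : Measurable (fun q : ℝ × ℝ × ℝ × ℝ × ℝ =>
    f₅ q.1 q.2.1 q.2.2.1 q.2.2.2.1 q.2.2.2.2)
  f₅_nonneg : ∀ t₁ t₂ z y₁ y₂, 0 ≤ f₅ t₁ t₂ z y₁ y₂
  law_pair : ∀ i j k, j ≠ k →
    P.map (fun ω => (T i j ω, T i k ω, Z i ω, Y i j ω, Y i k ω)) =
      volume.withDensity (fun q : ℝ × ℝ × ℝ × ℝ × ℝ =>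
        ENNReal.ofReal (f₅ q.1 q.2.1 q.2.2.1 q.2.2.2.1 q.2.2.2.2))

/-- The expectation of the `p`-th power of a count. -/
def countMoment (P : Measure Ω) (p : ℕ) (M : Ω → ℕ) : ℝ :=
  ∫ ω, (M ω : ℝ) ^ p ∂P

/-- For each sample size `n`, the numbers of observations `N₁(n), …, Nₙ(n)` are i.i.d. copies of a
positive integer-valued `N(n)`, are independent of all other random variables, and
`E N(n)² / (E N(n))²` and `E N(n)⁴ / (E N(n)²)²` are bounded as `n → ∞`. -/
structure RandomCounts (P : Measure Ω) (T Y : ℕ → ℕ → Ω → ℝ) (Z : ℕ → Ω → ℝ)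
    (N : (n : ℕ) → Fin n → Ω → ℕ) (N₀ : ℕ → Ω → ℕ) : Prop where
  measurable_N : ∀ n i, Measurable (N n i)
  measurable_N₀ : ∀ n, Measurable (N₀ n)
  N₀_pos : ∀ n ω, 0 < N₀ n ω
  identDistrib : ∀ n i, IdentDistrib (N n i) (N₀ n) P P
  indep : ∀ n, iIndepFun (N n) P
  indep_data : ∀ n, IndepFun (fun ω (i : Fin n) => N n i ω)
    (fun ω (i : ℕ) => subjectData T Y Z i ω) P
  integrable_fourth : ∀ n, Integrable (fun ω => (N₀ n ω : ℝ) ^ 4) P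
  bounded_second : IsBoundedUnder (· ≤ ·) atTop
    (fun n => countMoment P 2 (N₀ n) / countMoment P 1 (N₀ n) ^ 2)
  bounded_fourth : IsBoundedUnder (· ≤ ·) atTop
    (fun n => countMoment P 4 (N₀ n) / countMoment P 2 (N₀ n) ^ 2)

/-! ### The estimator -/

/-- The two-dimensional Nadaraya–Watson estimator at `(t, z)` with kernel `K` and bandwidths `ht`
and `hz`, from `n` subjects of which the `i`-th is observed `N i` times. -/
def nadarayaWatson (K : ℝ × ℝ → ℝ) (T Y : ℕ → ℕ → Ω → ℝ) (Z : ℕ → Ω → ℝ)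
    (n : ℕ) (N : Fin n → Ω → ℕ) (ht hz t z : ℝ) (ω : Ω) : ℝ :=
  (∑ i : Fin n, ∑ j ∈ Finset.range (N i ω),
      K ((t - T i j ω) / ht, (z - Z i ω) / hz) * Y i j ω) /
    (∑ i : Fin n, ∑ j ∈ Finset.range (N i ω), K ((t - T i j ω) / ht, (z - Z i ω) / hz))

/-- `N̄ = (N₁ + ⋯ + Nₙ) / n`. -/
def averageCount (n : ℕ) (N : Fin n → Ω → ℕ) (ω : Ω) : ℝ :=
  (∑ i : Fin n, (N i ω : ℝ)) / n

end Design

/-! ### Kernel and bandwidths -/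

/-- A square-integrable two-dimensional kernel with compact support, of order `((0, 0), 2)`: it
integrates to one and its first moments vanish. Neither positivity nor symmetry is imposed, and
the second moments are arbitrary. -/
structure IsSecondOrderKernel (K : ℝ × ℝ → ℝ) : Prop where
  measurable : Measurable K
  memLp_two : MemLp K 2 volume
  hasCompactSupport : HasCompactSupport K
  integral_eq_one : ∫ s, K s = 1
  first_moment_fst : ∫ s : ℝ × ℝ, s.1 * K s = 0
  first_moment_snd : ∫ s : ℝ × ℝ, s.2 * K s = 0

/-- `ht ≍ hz ≍ h`, `h → 0`, `n E(N) h² → ∞`, `E(N) h → 0` and `n E(N) h⁶` bounded. -/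
structure BandwidthConditions (EN ht hz h : ℕ → ℝ) : Prop where
  ht_pos : ∀ n, 0 < ht n
  hz_pos : ∀ n, 0 < hz n
  h_pos : ∀ n, 0 < h n
  ht_order : ht =Θ[atTop] h
  hz_order : hz =Θ[atTop] h
  h_tendsto : Tendsto h atTop (𝓝 0)
  lower : Tendsto (fun n : ℕ => n * EN n * h n ^ 2) atTop atTop
  sparse : Tendsto (fun n => EN n * h n) atTop (𝓝 0)
  upper : (fun n : ℕ => n * EN n * h n ^ 6) =O[atTop] (fun _ => (1 : ℝ))

/-! ### Local smoothness and the limit parameters -/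

/-- Smoothness at the point `(t, z)`: `f₂` and `μ` are twice continuously differentiable there and
`f₂(t, z) > 0`; `f₃` and its second-order partial derivatives in `(t, z)` are continuous there
uniformly in `y`; `f₅` is continuous at `(t, t, z)` uniformly in `(y₁, y₂)`; and the conditional
second moment of `Y` is finite near `(t, z)` and continuous at `(t, z)`. -/
structure LocalRegularity (f₃ : ℝ → ℝ → ℝ → ℝ) (f₅ : ℝ → ℝ → ℝ → ℝ → ℝ → ℝ) (t z : ℝ) :
    Prop where
  f₂_smooth : ContDiffAt ℝ 2 (fun x : ℝ × ℝ => marginalDensity f₃ x.1 x.2) (t, z)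
  f₂_pos : 0 < marginalDensity f₃ t z
  f₃_continuous : ContinuousAtUniformly (fun (x : ℝ × ℝ) y => f₃ x.1 x.2 y) (t, z)
  f₃_smooth : ∀ y, ContDiffAt ℝ 2 (fun x : ℝ × ℝ => f₃ x.1 x.2 y) (t, z)
  f₃_partials : ∀ k₁ k₂ : ℕ, k₁ + k₂ = 2 → ContinuousAtUniformly
    (fun (x : ℝ × ℝ) y => mixedPartial k₁ k₂ (fun t' z' => f₃ t' z' y) x.1 x.2) (t, z)
  f₅_continuous : ContinuousAtUniformly
    (fun (x : ℝ × ℝ × ℝ) (y : ℝ × ℝ) => f₅ x.1 x.2.1 x.2.2 y.1 y.2) (t, t, z)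
  mean_smooth : ContDiffAt ℝ 2 (fun x : ℝ × ℝ => condMean f₃ x.1 x.2) (t, z)
  secondMoment_finite : ∀ᶠ x : ℝ × ℝ in 𝓝 (t, z), Integrable (fun y => y ^ 2 * f₃ x.1 x.2 y)
  secondMoment_continuous :
    ContinuousAt (fun x : ℝ × ℝ => ∫ y, y ^ 2 * f₃ x.1 x.2 y) (t, z)

/-- The asymptotic bias `β_NW`. The function `α₁` is `μ f₂`. -/
def biasNW (K : ℝ × ℝ → ℝ) (f₃ : ℝ → ℝ → ℝ → ℝ) (ρ τ t z : ℝ) : ℝ :=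
  ∑ k ∈ Finset.HasAntidiagonal.antidiagonal (2 : ℕ),
    1 / ((k.1.factorial : ℝ) * (k.2.factorial : ℝ)) *
      (∫ s : ℝ × ℝ, s.1 ^ k.1 * s.2 ^ k.2 * K s) *
      (1 / marginalDensity f₃ t z *
          mixedPartial k.1 k.2 (fun t' z' => condMean f₃ t' z' * marginalDensity f₃ t' z') t z -
        condMean f₃ t z / marginalDensity f₃ t z *
          mixedPartial k.1 k.2 (marginalDensity f₃) t z) *
      (τ * Real.sqrt (ρ ^ (2 * k.2 + 1)))

/-- The asymptotic variance `Σ_NW = Var(Y | t, z) ‖K‖² / f₂(t, z)`. -/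
def varianceNW (K : ℝ × ℝ → ℝ) (f₃ : ℝ → ℝ → ℝ → ℝ) (t z : ℝ) : ℝ :=
  condVariance f₃ t z * (∫ s, K s ^ 2) / marginalDensity f₃ t z

end

/-! ### Independence of pairs -/

/-! Write a, b for the two bandwidths, μ, f₂ for the values at (t, z), and ξᵢⱼ = K((t - Tᵢⱼ)/a, (z -
Zᵢ)/b)(Yᵢⱼ - μ), Sᵢ = ∑_{j ≤ Nᵢ} ξᵢⱼ. The estimation error is ∑ Sᵢ divided by the denominator of the
estimator. Centring at the constant μ thus reduces a ratio of two sums to one scalar central limit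
theorem followed by Slutsky's lemma: with U = ∑ Sᵢ / (f₂ √(n E(N) a b)), Q the denominator divided
by n E(N) a b f₂, and A = N̄ / E(N), the normalized error is U √A / Q, where A and Q tend to one in
probability (`tendstoInMeasure_averageCount`, `tendstoInMeasure_sum_kernelSum`).

The bias is the limit of the mean of U. After rescaling, E ξ is a b times a smoothing by K of (μ(·)
- μ) f₂, a function vanishing at (t, z). Its linear term is killed by the first moments of K, so a
factor a² times a combination of second partial derivatives remains
(`IsSecondOrderKernel.tendsto_smoothing`), and √(n E(N) a b) a² converges to τ √ρ.

The variance comes from the diagonal terms of Sᵢ², since E ξ² ~ a b ‖K‖² Var(Y | t, z) f₂. An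
off-diagonal term needs two times of the same subject within O(a) of t. Each time is independent of
the covariate together with any other observation (`RandomDesign.indepFun_time`), so E|ξᵢⱼ ξᵢₖ| =
O(a E ξ²). All cross terms together are, relative to the diagonal, of order (E N² / (E N)²) · E(N)
a, which tends to zero in the sparse regime.

The Lindeberg condition has to be met with only two moments of Y. `indicator_sq_sum_le` separates
terms with ξ² ≤ M, large terms and cross products; `RandomDesign.exists_truncation_level` makes the
large terms negligible with M independent of n. `tendstoInDistribution_sum_of_lindeberg` then gives
the limit law of U. -/

/-- The law of the pair of vectors is a product of two product measures; exchanging the order of the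
factors turns it into the product of the laws of the pairs. It is applied with the counts as A and
the subjects' data as B. -/
theorem ProbabilityTheory.iIndepFun.prodMk_of_indepFun {Ω ι : Type*} [MeasurableSpace Ω]
    [Fintype ι] {α β : Type*} [MeasurableSpace α] [MeasurableSpace β] {P : Measure Ω}
    [IsProbabilityMeasure P] {A : ι → Ω → α} {B : ι → Ω → β}
    (mA : ∀ i, Measurable (A i)) (mB : ∀ i, Measurable (B i))
    (hA : iIndepFun A P) (hB : iIndepFun B P)
    (hAB : IndepFun (fun ω i => A i ω) (fun ω i => B i ω) P) :
    iIndepFun (fun i ω => (A i ω, B i ω)) P := by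
  have mA' : Measurable (fun ω i => A i ω) := measurable_pi_lambda _ mA
  have mB' : Measurable (fun ω i => B i ω) := measurable_pi_lambda _ mB
  have : ∀ i, IsProbabilityMeasure (P.map (A i)) :=
    fun i => Measure.isProbabilityMeasure_map (mA i).aemeasurable
  have : ∀ i, IsProbabilityMeasure (P.map (B i)) :=
    fun i => Measure.isProbabilityMeasure_map (mB i).aemeasurable
  rw [iIndepFun_iff_map_fun_eq_pi_map (fun i => ((mA i).prodMk (mB i)).aemeasurable)]
  have hi : ∀ i, P.map (fun ω => (A i ω, B i ω)) = (P.map (A i)).prod (P.map (B i)) := fun i =>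
    (indepFun_iff_map_prod_eq_prod_map_map (mA i).aemeasurable (mB i).aemeasurable).1
      (hAB.comp (measurable_pi_apply i) (measurable_pi_apply i))
  simp_rw [hi]
  have h1 := (indepFun_iff_map_prod_eq_prod_map_map mA'.aemeasurable mB'.aemeasurable).1 hAB
  rw [hA.map_fun_eq_pi_map (fun i => (mA i).aemeasurable),
    hB.map_fun_eq_pi_map (fun i => (mB i).aemeasurable)] at h1
  have h2 := (measurePreserving_arrowProdEquivProdArrow α β ι
    (fun i => P.map (A i)) (fun i => P.map (B i)))
  rw [← h2.map_eq] at h1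
  have h3 := congrArg (Measure.map (MeasurableEquiv.arrowProdEquivProdArrow α β ι).symm) h1
  rw [MeasurableEquiv.map_symm_map, Measure.map_map (MeasurableEquiv.measurable _)
    (mA'.prodMk mB')] at h3
  exact h3

/-! ### A weak law for triangular arrays -/

/-- Chebyshev's inequality: the variance of the row sum is at most n times the second moment bound,
and half of ε absorbs the distance from n m to c. -/
theorem tendstoInMeasure_sum_of_second_moment {Ω : Type*} [MeasurableSpace Ω] {P : Measure Ω}
    [IsProbabilityMeasure P] {X : ∀ n : ℕ, Fin n → Ω → ℝ}
    (hL2 : ∀ᶠ n in atTop, ∀ i, MemLp (X n i) 2 P) (hindep : ∀ n, iIndepFun (X n) P)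
    {m v : ℕ → ℝ} {c : ℝ} (hmean : ∀ᶠ n in atTop, ∀ i, ∫ ω, X n i ω ∂P = m n)
    (hsq : ∀ᶠ n in atTop, ∀ i, ∫ ω, X n i ω ^ 2 ∂P ≤ v n)
    (hm : Tendsto (fun n : ℕ => n * m n) atTop (𝓝 c))
    (hv : Tendsto (fun n : ℕ => n * v n) atTop (𝓝 0)) :
    TendstoInMeasure P (fun n ω => ∑ i, X n i ω) atTop (fun _ => c) := by
  rw [tendstoInMeasure_iff_measureReal_dist]
  intro ε hε
  refine squeeze_zero' (.of_forall fun n => measureReal_nonneg) ?_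
    (by simpa using hv.div_const ((ε / 2) ^ 2))
  filter_upwards [hL2, hmean, hsq, Metric.tendsto_nhds.1 hm (ε / 2) (by positivity)] with n hL2 hmean hsq hn
  have hS : MemLp (fun ω => ∑ i, X n i ω) 2 P := memLp_finsetSum _ fun i _ => hL2 i
  have hES : ∫ ω, ∑ i, X n i ω ∂P = n * m n := by
    rw [integral_finsetSum _ fun i _ => (hL2 i).integrable (by norm_num)]
    simp [hmean]
  have hVar : Var[fun ω => ∑ i, X n i ω; P] ≤ n * v n := by
    have h1 := IndepFun.variance_sum (X := X n) (s := Finset.univ) (fun i _ => hL2 i)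
      (fun i _ j _ hij => (hindep n).indepFun hij)
    rw [show (fun ω => ∑ i, X n i ω) = ∑ i, X n i by ext; simp, h1]
    calc ∑ i, Var[X n i; P] ≤ ∑ i : Fin n, v n := Finset.sum_le_sum fun i _ =>
          (variance_le_expectation_sq (hL2 i).1).trans (by simpa using hsq i)
      _ = n * v n := by simp
  have hcheb := meas_ge_le_variance_div_sq hS (c := ε / 2) (by positivity)
  rw [hES] at hcheb
  have hsub : {ω | ε ≤ dist (∑ i, X n i ω) c} ⊆ {ω | ε / 2 ≤ |∑ i, X n i ω - n * m n|} := by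
    intro ω hω
    simp only [Set.mem_ofPred_eq] at hω ⊢
    have := dist_triangle (∑ i, X n i ω) (n * m n) c
    rw [← Real.dist_eq]
    linarith
  have h2 : P.real {ω | ε ≤ dist (∑ i, X n i ω) c} ≤ Var[fun ω => ∑ i, X n i ω; P] / (ε / 2) ^ 2 :=
    ENNReal.toReal_le_of_le_ofReal (div_nonneg (variance_nonneg _ _) (by positivity))
      ((measure_mono hsub).trans hcheb)
  exact h2.trans (by gcongr)

/-! ### The Lindeberg central limit theorem for triangular arrays -/

/-- Mean value inequality on [-|x|, |x|]. Iterating it yields the Taylor remainders of exp(ix),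
without the factorials, which are not needed. -/
theorem norm_le_pow_succ_of_hasDerivAt {f f' : ℝ → ℂ} {k : ℕ} (h0 : f 0 = 0)
    (hf : ∀ x, HasDerivAt f (f' x) x) (hb : ∀ x, ‖f' x‖ ≤ |x| ^ k) (x : ℝ) :
    ‖f x‖ ≤ |x| ^ (k + 1) := by
  have h := (convex_Icc (-|x|) |x|).norm_image_sub_le_of_norm_hasDerivWithin_le
    (f := f) (f' := f') (C := |x| ^ k) (x := 0) (y := x)
    (fun y _ => (hf y).hasDerivWithinAt)
    (fun y hy => (hb y).trans (pow_le_pow_left₀ (abs_nonneg _) (abs_le.2 hy) k))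
    (Set.mem_Icc.2 ⟨neg_nonpos.2 (abs_nonneg x), abs_nonneg x⟩)
    ⟨neg_abs_le x, le_abs_self x⟩
  simpa [h0, pow_succ] using h

theorem norm_exp_I_sub_taylor_one_le (x : ℝ) :
    ‖Complex.exp (x * Complex.I) - 1 - x * Complex.I‖ ≤ |x| ^ 2 := by
  refine norm_le_pow_succ_of_hasDerivAt (k := 1)
    (f := fun x : ℝ => Complex.exp (x * Complex.I) - 1 - x * Complex.I)
    (f' := fun x : ℝ => Complex.exp (x * Complex.I) * (1 * Complex.I) - 1 * Complex.I)
    (by simp) (fun y => ?_) (fun y => ?_) x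
  · have h1 : HasDerivAt (fun x : ℝ => (x : ℂ) * Complex.I) (1 * Complex.I) y :=
      (HasDerivAt.ofReal_comp (hasDerivAt_id y)).mul_const _ |>.congr_deriv (by simp)
    exact (h1.cexp.sub_const 1).sub h1
  · have := Real.norm_exp_I_mul_ofReal_sub_one_le (x := y)
    rw [mul_comm] at this
    rw [one_mul, ← sub_one_mul, norm_mul]
    simpa using this

theorem norm_exp_I_sub_taylor_two_le (x : ℝ) :
    ‖Complex.exp (x * Complex.I) - 1 - x * Complex.I + (x : ℂ) ^ 2 / 2‖ ≤ |x| ^ 3 := by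
  refine norm_le_pow_succ_of_hasDerivAt (k := 2)
    (f := fun x : ℝ => Complex.exp (x * Complex.I) - 1 - x * Complex.I + (x : ℂ) ^ 2 / 2)
    (f' := fun x : ℝ => (Complex.exp (x * Complex.I) - 1 - x * Complex.I) * Complex.I)
    (by simp) (fun y => ?_) (fun y => ?_) x
  · have h0 : HasDerivAt (fun x : ℝ => (x : ℂ)) 1 y :=
      (HasDerivAt.ofReal_comp (hasDerivAt_id y)).congr_deriv (by simp)
    have h1 : HasDerivAt (fun x : ℝ => (x : ℂ) * Complex.I) (1 * Complex.I) y := h0.mul_const _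
    refine (((h1.cexp.sub_const 1).sub h1).add ((h0.pow 2).div_const 2)).congr_deriv ?_
    -- The derivative of x²/2 is x = -(x i) i, so the derivative of the remainder is i times the
    -- remainder of lower order.
    linear_combination (y : ℂ) * Complex.I_sq
  · rw [norm_mul]
    simpa using norm_exp_I_sub_taylor_one_le y

/-- The remainder of the second-order expansion of `exp (i s x)`, split at the level `δ`. -/
theorem norm_exp_I_mul_sub_taylor_two_le (s x : ℝ) {δ : ℝ} (hδ : 0 ≤ δ) :
    ‖Complex.exp ((s * x : ℝ) * Complex.I) - 1 - (s * x : ℝ) * Complex.I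
      + ((s * x : ℝ) : ℂ) ^ 2 / 2‖
      ≤ |s| ^ 3 * δ * x ^ 2 + 2 * s ^ 2 * {y : ℝ | δ < |y|}.indicator (fun y => y ^ 2) x := by
  by_cases hx : δ < |x|
  · rw [Set.indicator_of_mem (by simpa using hx)]
    have h1 := norm_exp_I_sub_taylor_one_le (s * x)
    have h2 : ‖((s * x : ℝ) : ℂ) ^ 2 / 2‖ = (s * x) ^ 2 / 2 := by
      rw [norm_div, norm_pow, Complex.norm_real, Real.norm_eq_abs, sq_abs]; simp
    have h3 := norm_add_le (Complex.exp ((s * x : ℝ) * Complex.I) - 1 - (s * x : ℝ) * Complex.I)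
      (((s * x : ℝ) : ℂ) ^ 2 / 2)
    rw [sq_abs] at h1
    have : 0 ≤ |s| ^ 3 * δ * x ^ 2 := by positivity
    nlinarith [sq_nonneg (s * x)]
  · rw [Set.indicator_of_notMem (by simpa using hx)]
    have h4 := norm_exp_I_sub_taylor_two_le (s * x)
    have : |s * x| ^ 3 ≤ |s| ^ 3 * δ * x ^ 2 := by
      rw [abs_mul, mul_pow, pow_succ |x| 2, sq_abs]
      have : |x| ≤ δ := not_lt.1 hx
      have h6 : 0 ≤ |s| ^ 3 * x ^ 2 := by positivity
      nlinarith
    simpa using h4.trans this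

/-- Telescoping: factors are exchanged one at a time, all the others having norm at most one. -/
theorem Finset.norm_prod_sub_prod_le_sum {ι : Type*} (s : Finset ι) {a b : ι → ℂ}
    (ha : ∀ i ∈ s, ‖a i‖ ≤ 1) (hb : ∀ i ∈ s, ‖b i‖ ≤ 1) :
    ‖∏ i ∈ s, a i - ∏ i ∈ s, b i‖ ≤ ∑ i ∈ s, ‖a i - b i‖ := by
  classical
  induction s using Finset.induction_on with
  | empty => simp
  | insert j s hj ih =>
    rw [Finset.prod_insert hj, Finset.prod_insert hj, Finset.sum_insert hj]
    have h1 := ih (fun i hi => ha i (Finset.mem_insert_of_mem hi))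
      (fun i hi => hb i (Finset.mem_insert_of_mem hi))
    have h2 : ‖∏ i ∈ s, a i‖ ≤ 1 := by
      rw [norm_prod]
      exact Finset.prod_le_one (fun _ _ => norm_nonneg _)
        (fun i hi => ha i (Finset.mem_insert_of_mem hi))
    have h3 := hb j (Finset.mem_insert_self _ _)
    calc _ = ‖(a j - b j) * ∏ i ∈ s, a i + b j * (∏ i ∈ s, a i - ∏ i ∈ s, b i)‖ := by ring_nf
      _ ≤ ‖a j - b j‖ * ‖∏ i ∈ s, a i‖ + ‖b j‖ * ‖∏ i ∈ s, a i - ∏ i ∈ s, b i‖ := by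
        refine (norm_add_le _ _).trans ?_
        rw [norm_mul, norm_mul]
      _ ≤ ‖a j - b j‖ * 1 + 1 * ∑ i ∈ s, ‖a i - b i‖ := by gcongr
      _ = _ := by ring

/-- The pointwise bound is integrated. The cubic remainder is used only below the level δ, since a
third moment need not exist; above δ the quadratic bound produces the Lindeberg integral. -/
theorem norm_charFun_sub_taylor_two_le {Ω : Type*} [MeasurableSpace Ω] {P : Measure Ω}
    [IsProbabilityMeasure P] {X : Ω → ℝ} (hX : MemLp X 2 P) (s : ℝ) {δ : ℝ} (hδ : 0 < δ) :
    ‖charFun (P.map X) s - (1 + (s * ∫ ω, X ω ∂P : ℝ) * Complex.I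
        - (s ^ 2 * ∫ ω, X ω ^ 2 ∂P : ℝ) / 2)‖
      ≤ |s| ^ 3 * δ * ∫ ω, X ω ^ 2 ∂P
        + 2 * s ^ 2 * ∫ ω, {y : ℝ | δ < |y|}.indicator (fun y => y ^ 2) (X ω) ∂P := by
  have hXm := hX.aestronglyMeasurable.aemeasurable
  have hi1 : Integrable X P := hX.integrable (by norm_num)
  have hi2 : Integrable (fun ω => X ω ^ 2) P := hX.integrable_sq
  have hind : Integrable (fun ω => {y : ℝ | δ < |y|}.indicator (fun y => y ^ 2) (X ω)) P := by
    have hms : MeasurableSet {y : ℝ | δ < |y|} := measurableSet_lt (by fun_prop) (by fun_prop)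
    refine hi2.mono' (((measurable_id.pow_const 2).indicator hms).comp_aemeasurable
      hXm).aestronglyMeasurable (.of_forall fun ω => ?_)
    rw [Real.norm_eq_abs, abs_of_nonneg (Set.indicator_nonneg (fun y _ => sq_nonneg y) _)]
    exact Set.indicator_le_self' (fun y _ => sq_nonneg y) _
  have hexp : Integrable (fun ω => Complex.exp ((s * X ω : ℝ) * Complex.I)) P := by
    refine Integrable.mono' (integrable_const (1 : ℝ))
      ((by fun_prop : Measurable fun x : ℝ => Complex.exp ((s * x : ℝ) * Complex.I)).comp_aemeasurable
        hXm).aestronglyMeasurable (.of_forall fun ω => ?_)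
    rw [Complex.norm_exp_ofReal_mul_I]
  have hl : Integrable (fun ω => ((s * X ω : ℝ) : ℂ) * Complex.I) P :=
    ((hi1.const_mul s).ofReal (𝕜 := ℂ)).mul_const _
  have hq : Integrable (fun ω => ((s * X ω : ℝ) : ℂ) ^ 2 / 2) P := by
    have := ((hi2.const_mul (s ^ 2)).ofReal (𝕜 := ℂ)).div_const 2
    refine this.congr (.of_forall fun ω => ?_)
    simp [mul_pow]
  have heq : charFun (P.map X) s - (1 + (s * ∫ ω, X ω ∂P : ℝ) * Complex.I
        - (s ^ 2 * ∫ ω, X ω ^ 2 ∂P : ℝ) / 2)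
      = ∫ ω, (Complex.exp ((s * X ω : ℝ) * Complex.I) - 1 - (s * X ω : ℝ) * Complex.I
      + ((s * X ω : ℝ) : ℂ) ^ 2 / 2) ∂P := by
    have h1 : Integrable (fun ω => Complex.exp ((s * X ω : ℝ) * Complex.I) - 1) P :=
      hexp.sub (integrable_const _)
    have h2 : Integrable (fun ω => Complex.exp ((s * X ω : ℝ) * Complex.I) - 1
      - (s * X ω : ℝ) * Complex.I) P := h1.sub hl
    rw [integral_add h2 hq, integral_sub h1 hl, integral_sub hexp (integrable_const _),
      charFun_apply_real, integral_map hXm (by fun_prop), integral_mul_const, integral_complex_ofReal,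
      integral_const_mul, integral_div]
    have : ∀ ω, ((s * X ω : ℝ) : ℂ) ^ 2 = ((s ^ 2 * X ω ^ 2 : ℝ) : ℂ) := fun ω => by
      push_cast; ring
    simp_rw [this]
    rw [integral_complex_ofReal, integral_const_mul]
    simp
    ring
  rw [heq]
  have hsum : Integrable (fun ω => |s| ^ 3 * δ * X ω ^ 2
      + 2 * s ^ 2 * {y : ℝ | δ < |y|}.indicator (fun y => y ^ 2) (X ω)) P :=
    (hi2.const_mul (|s| ^ 3 * δ)).add (hind.const_mul (2 * s ^ 2))
  refine (norm_integral_le_of_norm_le hsum (.of_forall fun ω =>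
      norm_exp_I_mul_sub_taylor_two_le s (X ω) hδ.le)).trans_eq ?_
  rw [integral_add (hi2.const_mul _) (hind.const_mul _), integral_const_mul, integral_const_mul]

/-- The terms are not centred: their means, of order 1/n, add up to m, and raw second moments may
replace variances because the squared means are of order 1/n² each. Every term is compared with the
same factor exp(z/n) of the Gaussian characteristic function, which is why the moment conditions are
uniform in i. -/
theorem tendstoInDistribution_sum_of_lindeberg {Ω : Type*} [MeasurableSpace Ω] {P : Measure Ω}
    [IsProbabilityMeasure P] {X : ∀ n : ℕ, Fin n → Ω → ℝ}
    (hm : ∀ n i, AEMeasurable (X n i) P)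
    (hL2 : ∀ᶠ n in atTop, ∀ i, MemLp (X n i) 2 P) (hindep : ∀ n, iIndepFun (X n) P)
    {m v : ℝ} (hv : 0 ≤ v)
    (hmean : ∀ ε > 0, ∀ᶠ n : ℕ in atTop, ∀ i : Fin n, |n * ∫ ω, X n i ω ∂P - m| ≤ ε)
    (hsq : ∀ ε > 0, ∀ᶠ n : ℕ in atTop, ∀ i : Fin n, |n * ∫ ω, X n i ω ^ 2 ∂P - v| ≤ ε)
    (hlind : ∀ δ > 0, ∀ ε > 0, ∀ᶠ n : ℕ in atTop, ∀ i : Fin n,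
      n * ∫ ω, {y : ℝ | δ < |y|}.indicator (fun y => y ^ 2) (X n i ω) ∂P ≤ ε) :
    TendstoInDistribution (fun (n : ℕ) ω => ∑ i, X n i ω) atTop (id : ℝ → ℝ) (fun _ => P)
      (gaussianReal m v.toNNReal) := by
  refine ⟨fun n => Finset.aemeasurable_fun_sum _ fun i _ => hm n i, aemeasurable_id, ?_⟩
  refine ProbabilityMeasure.tendsto_iff_tendsto_charFun.2 fun s => ?_
  simp only [ProbabilityMeasure.coe_mk, Measure.map_id, charFun_gaussianReal,
    Real.coe_toNNReal v hv]
  set z : ℂ := s * m * Complex.I - v * s ^ 2 / 2 with hz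
  have hzre : z.re ≤ 0 := by
    have : z = ((-(v * s ^ 2 / 2) : ℝ) : ℂ) + ((s * m : ℝ) : ℂ) * Complex.I := by
      rw [hz]; push_cast; ring
    rw [this, Complex.add_re, Complex.ofReal_re, Complex.re_ofReal_mul, Complex.I_re]
    have : 0 ≤ v * s ^ 2 / 2 := by positivity
    linarith
  rw [Metric.tendsto_atTop']
  -- It is enough to compare single factors up to o(1/n), since exp z is the product of n factors
  -- exp(z/n) of norm at most one.
  suffices h : ∀ ε > 0, ∀ᶠ n : ℕ in atTop, ∀ i : Fin n,
      n * ‖charFun (P.map (X n i)) s - Complex.exp (z / n)‖ ≤ ε by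
    intro ε hε
    obtain ⟨n₀, hn₀⟩ := eventually_atTop.1 ((h (ε / 2) (by positivity)).and (eventually_gt_atTop 0))
    refine ⟨n₀, fun n hn => ?_⟩
    obtain ⟨h1, hn0⟩ := hn₀ n hn.le
    have hn0' : (0 : ℝ) < n := by exact_mod_cast hn0
    have hzn : Complex.exp z = ∏ _i : Fin n, Complex.exp (z / n) := by
      rw [Finset.prod_const, Finset.card_univ, Fintype.card_fin, ← Complex.exp_nat_mul]
      have hnC : (n : ℂ) ≠ 0 := by exact_mod_cast hn0.ne'
      congr 1
      field_simp
    rw [(hindep n).charFun_map_fun_sum_eq_prod (hm n), Finset.prod_apply, dist_eq_norm, hzn]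
    have : ∀ i : Fin n, IsProbabilityMeasure (P.map (X n i)) := fun i =>
      Measure.isProbabilityMeasure_map (hm n i)
    refine (Finset.norm_prod_sub_prod_le_sum _ (fun i _ => norm_charFun_le_one _)
      (fun i _ => ?_)).trans_lt ?_
    · rw [Complex.norm_exp, Complex.div_natCast_re]
      exact Real.exp_le_one_iff.2 (div_nonpos_of_nonpos_of_nonneg hzre hn0'.le)
    · calc _ ≤ ∑ _i : Fin n, ε / 2 / n := Finset.sum_le_sum fun i _ => by
            rw [le_div_iff₀ hn0', mul_comm]; exact h1 i
        _ = ε / 2 := by simp; field_simp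
        _ < ε := by linarith
  intro ε hε
  -- the size of the truncation level and of the moment errors
  set δ : ℝ := ε / 8 / ((|s| ^ 3 + 1) * (v + 1)) with hδ
  have hδ0 : 0 < δ := by positivity
  have hA : 0 < ε / 8 / (|s| + 1) := by positivity
  have hB : 0 < min 1 (ε / 8 / (s ^ 2 + 1)) := by positivity
  have hC : 0 < ε / 8 / (2 * s ^ 2 + 1) := by positivity
  have hexp : Tendsto (fun n : ℕ => ‖z‖ ^ 2 / (n : ℝ)) atTop (𝓝 0) :=
    tendsto_const_div_atTop_nhds_zero_nat _
  filter_upwards [hL2, hmean _ hA, hsq _ hB, hlind δ hδ0 _ hC, eventually_gt_atTop 0,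
    hexp.eventually_le_const (by positivity : (0 : ℝ) < ε / 8),
    (tendsto_const_div_atTop_nhds_zero_nat ‖z‖).eventually_le_const one_pos]
    with n hL2 h1 h2 h3 hn h4 h5 i
  have hn' : (0 : ℝ) < n := by exact_mod_cast hn
  have hnC : (n : ℂ) ≠ 0 := by exact_mod_cast hn.ne'
  have ht := norm_charFun_sub_taylor_two_le (hL2 i) s hδ0
  have he : ‖Complex.exp (z / n) - 1 - z / n‖ ≤ ‖z / n‖ ^ 2 :=
    Complex.norm_exp_sub_one_sub_id_le (by simpa using h5)
  replace h1 := h1 i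
  replace h2 := h2 i
  replace h3 := h3 i
  set e1 := ∫ ω, X n i ω ∂P
  set e2 := ∫ ω, X n i ω ^ 2 ∂P
  set e3 := ∫ ω, {y : ℝ | δ < |y|}.indicator (fun y => y ^ 2) (X n i ω) ∂P
  have hmid : ‖((s * (n * e1 - m) : ℝ) : ℂ) * Complex.I - ((s ^ 2 * (n * e2 - v) / 2 : ℝ) : ℂ)‖
      ≤ ε / 8 + ε / 8 := by
    refine (norm_sub_le _ _).trans (add_le_add ?_ ?_)
    · rw [norm_mul, Complex.norm_I, mul_one, Complex.norm_real, Real.norm_eq_abs, abs_mul]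
      calc |s| * |n * e1 - m| ≤ (|s| + 1) * (ε / 8 / (|s| + 1)) := by gcongr; linarith
        _ = ε / 8 := by field_simp
    · rw [Complex.norm_real, Real.norm_eq_abs, abs_div, abs_mul, abs_of_nonneg (sq_nonneg s), abs_two]
      calc s ^ 2 * |n * e2 - v| / 2 ≤ (s ^ 2 + 1) * (ε / 8 / (s ^ 2 + 1)) / 1 := by
            gcongr
            · linarith
            · exact h2.trans (min_le_right _ _)
            · norm_num
        _ = ε / 8 := by field_simp
  -- Three errors: the Taylor remainder of the characteristic function, the deviation of n times the
  -- moments from m and v, and the remainder of exp(z/n).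
  have hsplit : (n : ℂ) * (charFun (P.map (X n i)) s - Complex.exp (z / n))
      = n * (charFun (P.map (X n i)) s - (1 + (s * e1 : ℝ) * Complex.I - (s ^ 2 * e2 : ℝ) / 2))
        + (((s * (n * e1 - m) : ℝ) : ℂ) * Complex.I - ((s ^ 2 * (n * e2 - v) / 2 : ℝ) : ℂ))
        - n * (Complex.exp (z / n) - 1 - z / n) := by
    have : (n : ℂ) * (z / n) = z := by field_simp
    push_cast
    linear_combination -this - hz
  have he3 : 0 ≤ e3 := integral_nonneg fun ω => Set.indicator_nonneg (fun y _ => sq_nonneg y) _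
  have hle2 : n * e2 ≤ v + 1 := by
    have := (abs_le.1 (h2.trans (min_le_left _ _))).2
    linarith
  calc n * ‖charFun (P.map (X n i)) s - Complex.exp (z / n)‖
      = ‖(n : ℂ) * (charFun (P.map (X n i)) s - Complex.exp (z / n))‖ := by simp
    _ ≤ n * (|s| ^ 3 * δ * e2 + 2 * s ^ 2 * e3) + (ε / 8 + ε / 8) + n * ‖z / n‖ ^ 2 := by
        rw [hsplit]
        refine (norm_sub_le _ _).trans (add_le_add ((norm_add_le _ _).trans (add_le_add ?_ hmid)) ?_)
        · rw [norm_mul, Complex.norm_natCast]; gcongr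
        · rw [norm_mul, Complex.norm_natCast]; gcongr
    _ ≤ ε / 8 + ε / 8 + (ε / 8 + ε / 8) + ε / 8 := by
        have t1 : n * (|s| ^ 3 * δ * e2) ≤ ε / 8 := by
          calc n * (|s| ^ 3 * δ * e2) = |s| ^ 3 * δ * (n * e2) := by ring
            _ ≤ (|s| ^ 3 + 1) * δ * (v + 1) := by gcongr; linarith
            _ = ε / 8 := by rw [hδ]; field_simp
        have t2 : n * (2 * s ^ 2 * e3) ≤ ε / 8 := by
          calc n * (2 * s ^ 2 * e3) = 2 * s ^ 2 * (n * e3) := by ring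
            _ ≤ (2 * s ^ 2 + 1) * (ε / 8 / (2 * s ^ 2 + 1)) := by
              gcongr
              linarith
            _ = ε / 8 := by field_simp
        have t3 : n * ‖z / n‖ ^ 2 ≤ ε / 8 := by
          refine le_trans (le_of_eq ?_) h4
          rw [norm_div, Complex.norm_natCast]
          field_simp
        linarith
    _ ≤ ε := by linarith

/-! ### Sums with a random number of terms -/

theorem measurable_uncurry_of_nat {D : Type*} [MeasurableSpace D] {F : ℕ → D → ℝ}
    (hF : ∀ k, Measurable (F k)) : Measurable (fun p : ℕ × D => F p.1 p.2) :=
  measurable_from_prod_countable_right hF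

/-- Integration of a function of an independent pair whose first component is a natural number. -/
theorem integrable_and_integral_of_indepFun_nat {Ω D : Type*} [MeasurableSpace Ω]
    [MeasurableSpace D] {P : Measure Ω} [IsProbabilityMeasure P] {N : Ω → ℕ} {ζ : Ω → D}
    (hN : Measurable N) (hζ : Measurable ζ) (hind : IndepFun N ζ P) {F : ℕ → D → ℝ}
    (hF : ∀ k, Measurable (F k)) (hint : ∀ k, Integrable (fun ω => F k (ζ ω)) P) {w : ℕ → ℝ}
    (hw : ∀ k, ∫ ω, |F k (ζ ω)| ∂P ≤ w k) (hwi : Integrable (fun ω => w (N ω)) P) :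
    Integrable (fun ω => F (N ω) (ζ ω)) P ∧
      ∫ ω, F (N ω) (ζ ω) ∂P = ∫ ω, ∫ ω', F (N ω) (ζ ω') ∂P ∂P := by
  have hFm := measurable_uncurry_of_nat hF
  have hmap := (indepFun_iff_map_prod_eq_prod_map_map hN.aemeasurable hζ.aemeasurable).1 hind
  have hp1 : IsProbabilityMeasure (P.map N) := Measure.isProbabilityMeasure_map hN.aemeasurable
  have hp2 : IsProbabilityMeasure (P.map ζ) := Measure.isProbabilityMeasure_map hζ.aemeasurable
  have hwm : Integrable w (P.map N) :=
    (integrable_map_measure (measurable_of_countable w).aestronglyMeasurable hN.aemeasurable).2 hwi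
  have hprod : Integrable (fun p : ℕ × D => F p.1 p.2) ((P.map N).prod (P.map ζ)) := by
    rw [integrable_prod_iff hFm.aestronglyMeasurable]
    refine ⟨.of_forall fun k => (integrable_map_measure (hF k).aestronglyMeasurable
      hζ.aemeasurable).2 (hint k), ?_⟩
    refine hwm.mono' (measurable_of_countable _).aestronglyMeasurable (.of_forall fun k => ?_)
    rw [Real.norm_of_nonneg (integral_nonneg fun _ => norm_nonneg _),
      integral_map hζ.aemeasurable (hF k).norm.aestronglyMeasurable]
    exact hw k
  constructor
  · rw [← hmap] at hprod
    exact (integrable_map_measure hFm.aestronglyMeasurable (hN.prodMk hζ).aemeasurable).1 hprod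
  · calc ∫ ω, F (N ω) (ζ ω) ∂P = ∫ p, F p.1 p.2 ∂(P.map fun ω => (N ω, ζ ω)) :=
          (integral_map (hN.prodMk hζ).aemeasurable hFm.aestronglyMeasurable).symm
      _ = ∫ k, ∫ d, F k d ∂(P.map ζ) ∂(P.map N) := by rw [hmap, integral_prod _ hprod]
      _ = ∫ ω, ∫ d, F (N ω) d ∂(P.map ζ) ∂P :=
          integral_map hN.aemeasurable (measurable_of_countable _).aestronglyMeasurable
      _ = _ := by
          congr 1 with ω
          exact integral_map hζ.aemeasurable (hF _).aestronglyMeasurable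

/-- Truncation inequality behind the Lindeberg condition for sums. -/
theorem indicator_sq_sum_le (k : ℕ) (x : ℕ → ℝ) {δ M : ℝ} (hδ : 0 < δ) (hM : 0 ≤ M) :
    {y : ℝ | δ < |y|}.indicator (fun y => y ^ 2) (∑ j ∈ Finset.range k, x j) ≤
      4 * k * M / δ ^ 2 * ∑ j ∈ Finset.range k, x j ^ 2
        + 2 * ∑ j ∈ Finset.range k, {y : ℝ | M < y ^ 2}.indicator (fun y => y ^ 2) (x j)
        + 2 * ∑ j ∈ Finset.range k, ∑ l ∈ Finset.range k, if j = l then 0 else |x j * x l| := by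
  set S := ∑ j ∈ Finset.range k, x j
  set u : ℕ → ℝ := fun j => {y : ℝ | M < y ^ 2}.indicator (fun y => y ^ 2) (x j) with hu
  set a := ∑ j ∈ Finset.range k, (x j ^ 2 - u j) with ha
  set b := ∑ j ∈ Finset.range k, u j +
    ∑ j ∈ Finset.range k, ∑ l ∈ Finset.range k, if j = l then 0 else |x j * x l| with hb
  have hu0 : ∀ j, 0 ≤ u j := fun j => Set.indicator_nonneg (fun y _ => sq_nonneg y) _
  have hux : ∀ j, u j ≤ x j ^ 2 := fun j => Set.indicator_le_self' (fun y _ => sq_nonneg y) _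
  have hb0 : 0 ≤ b := add_nonneg (Finset.sum_nonneg fun j _ => hu0 j)
    (Finset.sum_nonneg fun j _ => Finset.sum_nonneg fun l _ => by split_ifs <;> positivity)
  have ha0 : 0 ≤ a := Finset.sum_nonneg fun j _ => sub_nonneg.2 (hux j)
  -- Here a collects the squares not exceeding M, while b collects the larger squares and the cross
  -- products.
  have hSab : S ^ 2 ≤ a + b := by
    have h1 : S ^ 2 ≤ ∑ j ∈ Finset.range k, ∑ l ∈ Finset.range k,
        ((if j = l then x j ^ 2 else 0) + if j = l then 0 else |x j * x l|) := by
      rw [sq, Finset.sum_mul_sum]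
      refine Finset.sum_le_sum fun j _ => Finset.sum_le_sum fun l _ => ?_
      split_ifs with h
      · subst h; simp [sq]
      · simpa using le_abs_self (x j * x l)
    have h2 : a + ∑ j ∈ Finset.range k, u j = ∑ j ∈ Finset.range k, x j ^ 2 := by
      rw [ha, ← Finset.sum_add_distrib]; simp
    refine h1.trans_eq ?_
    simp_rw [Finset.sum_add_distrib]
    rw [hb, ← add_assoc, h2]
    congr 1
    refine Finset.sum_congr rfl fun j hj => ?_
    simp [Finset.sum_ite_eq, Finset.mem_range.1 hj]
  -- Cauchy–Schwarz, with one factor of each truncated fourth power bounded by M. Only k times a sum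
  -- of squares appears, so later the second moment of the count suffices.
  have ha2 : a ^ 2 ≤ k * (M * ∑ j ∈ Finset.range k, x j ^ 2) := by
    refine sq_sum_le_card_mul_sum_sq.trans ?_
    rw [Finset.card_range, Finset.mul_sum (s := Finset.range k) (a := M)]
    refine mul_le_mul_of_nonneg_left (Finset.sum_le_sum fun j _ => ?_) (Nat.cast_nonneg k)
    by_cases h : M < x j ^ 2
    · have : u j = x j ^ 2 := Set.indicator_of_mem (by simpa using h) _
      rw [this]
      have := mul_nonneg hM (sq_nonneg (x j))
      simpa using this
    · have : u j = 0 := Set.indicator_of_notMem (by simpa using h) _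
      rw [this, sub_zero, sq (x j ^ 2)]
      exact mul_le_mul_of_nonneg_right (not_lt.1 h) (sq_nonneg _)
  have hmain : {y : ℝ | δ < |y|}.indicator (fun y => y ^ 2) S ≤ 4 * a ^ 2 / δ ^ 2 + 2 * b := by
    by_cases h : δ < |S|
    · rw [Set.indicator_of_mem (by simpa using h)]
      -- If b ≤ a then δ² < S² ≤ 2a, hence 1 ≤ 2a/δ² and 2a ≤ 4a²/δ². Otherwise S² ≤ 2b.
      rcases le_total b a with hab | hab
      · have h2 : δ ^ 2 < S ^ 2 := by
          rw [← sq_abs S]; exact pow_lt_pow_left₀ h hδ.le two_ne_zero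
        have h3 : 2 * a ≤ 4 * a ^ 2 / δ ^ 2 := by
          rw [le_div_iff₀ (by positivity)]
          nlinarith
        linarith
      · have : 0 ≤ 4 * a ^ 2 / δ ^ 2 := by positivity
        linarith
    · rw [Set.indicator_of_notMem (by simpa using h)]
      positivity
  refine hmain.trans ?_
  have : 4 * a ^ 2 / δ ^ 2 ≤ 4 * k * M / δ ^ 2 * ∑ j ∈ Finset.range k, x j ^ 2 := by
    rw [div_mul_eq_mul_div]
    refine div_le_div_of_nonneg_right ?_ (by positivity)
    linarith
  rw [hb]
  linarith

section RandomSum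

variable {Ω : Type*} [MeasurableSpace Ω] {P : Measure Ω} {ξ : ℕ → Ω → ℝ}
  {v c : ℝ}

theorem MeasureTheory.integral_sq_sum_range_le (hL2 : ∀ j, MemLp (ξ j) 2 P)
    (hv : ∀ j, ∫ ω, ξ j ω ^ 2 ∂P = v) (k : ℕ) :
    ∫ ω, (∑ j ∈ Finset.range k, ξ j ω) ^ 2 ∂P ≤ k ^ 2 * v := by
  have hS : MemLp (fun ω => ∑ j ∈ Finset.range k, ξ j ω) 2 P := memLp_finsetSum _ fun j _ => hL2 j
  calc ∫ ω, (∑ j ∈ Finset.range k, ξ j ω) ^ 2 ∂P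
      ≤ ∫ ω, k * ∑ j ∈ Finset.range k, ξ j ω ^ 2 ∂P := by
        refine integral_mono hS.integrable_sq
          ((integrable_finsetSum _ fun j _ => (hL2 j).integrable_sq).const_mul _) fun ω => ?_
        simpa using sq_sum_le_card_mul_sum_sq (s := Finset.range k) (f := fun j => ξ j ω)
    _ = k ^ 2 * v := by
        rw [integral_const_mul, integral_finsetSum _ fun j _ => (hL2 j).integrable_sq]
        simp [hv]; ring

/-- The diagonal contributes exactly k v; the off-diagonal terms number at most k² and each is
bounded by c. -/
theorem MeasureTheory.abs_integral_sq_sum_range_sub_le (hL2 : ∀ j, MemLp (ξ j) 2 P)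
    (hv : ∀ j, ∫ ω, ξ j ω ^ 2 ∂P = v) (hc0 : 0 ≤ c)
    (hc : ∀ j l, j ≠ l → ∫ ω, |ξ j ω * ξ l ω| ∂P ≤ c) (k : ℕ) :
    |∫ ω, (∑ j ∈ Finset.range k, ξ j ω) ^ 2 ∂P - k * v| ≤ k ^ 2 * c := by
  have hi : ∀ j l, Integrable (fun ω => ξ j ω * ξ l ω) P := fun j l => (hL2 j).integrable_mul (hL2 l)
  have h1 : ∫ ω, (∑ j ∈ Finset.range k, ξ j ω) ^ 2 ∂P - k * v =
      ∑ j ∈ Finset.range k, ∑ l ∈ Finset.range k,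
        (∫ ω, ξ j ω * ξ l ω ∂P - if j = l then v else 0) := by
    simp_rw [sq, Finset.sum_mul_sum]
    rw [integral_finsetSum _ fun j _ => integrable_finsetSum _ fun l _ => hi j l]
    simp_rw [integral_finsetSum _ fun l _ => hi _ l, Finset.sum_sub_distrib]
    congr 1
    rw [Finset.sum_congr rfl (g := fun _ => v) fun j hj => by
      simp [Finset.sum_ite_eq, Finset.mem_range.1 hj]]
    simp
  rw [h1]
  calc _ ≤ ∑ j ∈ Finset.range k, ∑ l ∈ Finset.range k, c := by
        refine (Finset.abs_sum_le_sum_abs _ _).trans (Finset.sum_le_sum fun j _ =>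
          (Finset.abs_sum_le_sum_abs _ _).trans (Finset.sum_le_sum fun l _ => ?_))
        split_ifs with h
        · subst h
          have := hv j
          simp_rw [sq] at this
          rw [this]; simpa using hc0
        · rw [sub_zero]
          exact abs_integral_le_integral_abs.trans (hc j l h)
    _ = k ^ 2 * c := by simp; ring

theorem measurable_indicator_sq_comp {s : Set ℝ} (hs : MeasurableSet s) :
    Measurable (s.indicator fun y : ℝ => y ^ 2) := (measurable_id.pow_const 2).indicator hs

theorem measurableSet_lt_abs (δ : ℝ) : MeasurableSet {y : ℝ | δ < |y|} :=
  measurableSet_lt (by fun_prop) (by fun_prop)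

theorem measurableSet_lt_sq (M : ℝ) : MeasurableSet {y : ℝ | M < y ^ 2} :=
  measurableSet_lt (by fun_prop) (by fun_prop)

theorem MeasureTheory.MemLp.integrable_indicator_sq {X : Ω → ℝ} (hX : MemLp X 2 P) {s : Set ℝ}
    (hs : MeasurableSet s) : Integrable (fun ω => s.indicator (fun y => y ^ 2) (X ω)) P := by
  refine hX.integrable_sq.mono' ((measurable_indicator_sq_comp hs).comp_aemeasurable
    hX.aestronglyMeasurable.aemeasurable).aestronglyMeasurable (.of_forall fun ω => ?_)
  rw [Real.norm_of_nonneg (Set.indicator_nonneg (fun y _ => sq_nonneg y) _)]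
  exact Set.indicator_le_self' (fun y _ => sq_nonneg y) _

theorem MeasureTheory.integral_indicator_sq_sum_range_le (hL2 : ∀ j, MemLp (ξ j) 2 P)
    (hv : ∀ j, ∫ ω, ξ j ω ^ 2 ∂P = v) (hc0 : 0 ≤ c)
    (hc : ∀ j l, j ≠ l → ∫ ω, |ξ j ω * ξ l ω| ∂P ≤ c) {δ M q : ℝ} (hδ : 0 < δ) (hM : 0 ≤ M)
    (hq : ∀ j, ∫ ω, {y : ℝ | M < y ^ 2}.indicator (fun y => y ^ 2) (ξ j ω) ∂P ≤ q) (k : ℕ) :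
    ∫ ω, {y : ℝ | δ < |y|}.indicator (fun y => y ^ 2) (∑ j ∈ Finset.range k, ξ j ω) ∂P ≤
      k ^ 2 * (4 * M * v / δ ^ 2) + k * (2 * q) + k ^ 2 * (2 * c) := by
  have hS : MemLp (fun ω => ∑ j ∈ Finset.range k, ξ j ω) 2 P := memLp_finsetSum _ fun j _ => hL2 j
  have i1 : Integrable (fun ω => 4 * k * M / δ ^ 2 * ∑ j ∈ Finset.range k, ξ j ω ^ 2) P :=
    (integrable_finsetSum _ fun j _ => (hL2 j).integrable_sq).const_mul _
  have i2' := fun j => (hL2 j).integrable_indicator_sq (measurableSet_lt_sq M)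
  have i2 : Integrable (fun ω => 2 * ∑ j ∈ Finset.range k,
      {y : ℝ | M < y ^ 2}.indicator (fun y => y ^ 2) (ξ j ω)) P :=
    (integrable_finsetSum _ fun j _ => i2' j).const_mul _
  have i3' : ∀ j l, Integrable (fun ω => if j = l then (0 : ℝ) else |ξ j ω * ξ l ω|) P :=
    fun j l => by
      split_ifs
      · exact integrable_zero _ _ _
      · exact ((hL2 j).integrable_mul (hL2 l)).abs
  have i3'' : ∀ j, Integrable (fun ω => ∑ l ∈ Finset.range k,
      if j = l then (0 : ℝ) else |ξ j ω * ξ l ω|) P :=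
    fun j => integrable_finsetSum _ fun l _ => i3' j l
  have i3 : Integrable (fun ω => 2 * ∑ j ∈ Finset.range k, ∑ l ∈ Finset.range k,
      if j = l then (0 : ℝ) else |ξ j ω * ξ l ω|) P :=
    (integrable_finsetSum _ fun j _ => i3'' j).const_mul _
  refine (integral_mono (hS.integrable_indicator_sq (measurableSet_lt_abs δ)) ((i1.add i2).add i3)
    fun ω => indicator_sq_sum_le k (fun j => ξ j ω) hδ hM).trans ?_
  rw [integral_add' (i1.add i2) i3, integral_add' i1 i2, integral_const_mul,
    integral_const_mul, integral_const_mul, integral_finsetSum _ fun j _ => (hL2 j).integrable_sq,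
    integral_finsetSum _ fun j _ => i2' j, integral_finsetSum _ fun j _ => i3'' j]
  refine add_le_add (add_le_add ?_ ?_) ?_
  · simp only [hv, Finset.sum_const, Finset.card_range, nsmul_eq_mul]
    apply le_of_eq; ring
  · calc _ ≤ 2 * ∑ _j ∈ Finset.range k, q := by gcongr with j _; exact hq j
      _ = _ := by simp; ring
  · calc _ ≤ 2 * ∑ _j ∈ Finset.range k, ∑ _l ∈ Finset.range k, c := by
          gcongr with j _
          rw [integral_finsetSum _ fun l _ => i3' j l]
          gcongr with l _
          split_ifs with h
          · simpa using hc0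
          · exact hc j l h
      _ = _ := by simp; ring

variable [IsProbabilityMeasure P]

/-- Conditionally on N = k this is the bound k² v for a fixed number of terms, so integrating over
the independent count leaves E N². The next three lemmas follow the same pattern. -/
theorem integral_randomSum_le {D : Type*} [MeasurableSpace D] {N : Ω → ℕ} {ζ : Ω → D}
    (hN : Measurable N) (hζ : Measurable ζ) (hind : IndepFun N ζ P) {x : ℕ → D → ℝ}
    (hx : ∀ j, Measurable (x j)) (hL2 : ∀ j, MemLp (fun ω => x j (ζ ω)) 2 P)
    (hv : ∀ j, ∫ ω, x j (ζ ω) ^ 2 ∂P = v) (hN2 : Integrable (fun ω => (N ω : ℝ) ^ 2) P) :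
    MemLp (fun ω => ∑ j ∈ Finset.range (N ω), x j (ζ ω)) 2 P ∧
      ∫ ω, (∑ j ∈ Finset.range (N ω), x j (ζ ω)) ^ 2 ∂P ≤ (∫ ω, (N ω : ℝ) ^ 2 ∂P) * v := by
  have hSm : ∀ k, Measurable fun d => ∑ j ∈ Finset.range k, x j d := fun k =>
    Finset.measurable_fun_sum _ fun j _ => hx j
  have hSL : ∀ k, MemLp (fun ω => ∑ j ∈ Finset.range k, x j (ζ ω)) 2 P := fun k =>
    memLp_finsetSum _ fun j _ => hL2 j
  have key := integrable_and_integral_of_indepFun_nat hN hζ hind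
    (F := fun k d => (∑ j ∈ Finset.range k, x j d) ^ 2) (fun k => (hSm k).pow_const 2)
    (fun k => (hSL k).integrable_sq) (w := fun k => k ^ 2 * v)
    (fun k => by simpa using integral_sq_sum_range_le hL2 hv k) (hN2.mul_const v)
  have hmeas : Measurable fun ω => ∑ j ∈ Finset.range (N ω), x j (ζ ω) :=
    (measurable_uncurry_of_nat hSm).comp (hN.prodMk hζ)
  refine ⟨(memLp_two_iff_integrable_sq hmeas.aestronglyMeasurable).2 key.1, ?_⟩
  rw [key.2, ← integral_mul_const]
  refine integral_mono_of_nonneg (.of_forall fun ω => integral_nonneg fun _ => sq_nonneg _)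
    (hN2.mul_const v) (.of_forall fun ω => integral_sq_sum_range_le hL2 hv _)

theorem integral_randomSum_eq {D : Type*} [MeasurableSpace D] {N : Ω → ℕ} {ζ : Ω → D}
    (hN : Measurable N) (hζ : Measurable ζ) (hind : IndepFun N ζ P) {x : ℕ → D → ℝ}
    (hx : ∀ j, Measurable (x j)) (hL2 : ∀ j, MemLp (fun ω => x j (ζ ω)) 2 P)
    (hv : ∀ j, ∫ ω, x j (ζ ω) ^ 2 ∂P = v) (hN1 : Integrable (fun ω => (N ω : ℝ)) P)
    {m : ℝ} (hm : ∀ j, ∫ ω, x j (ζ ω) ∂P = m) :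
    ∫ ω, ∑ j ∈ Finset.range (N ω), x j (ζ ω) ∂P = (∫ ω, (N ω : ℝ) ∂P) * m := by
  have hi : ∀ j, Integrable (fun ω => x j (ζ ω)) P := fun j => (hL2 j).integrable (by norm_num)
  -- A bound on first moments uniform in j, from |x| ≤ 1 + x². It supplies the dominating function k
  -- (1 + v) for Fubini.
  have habs : ∀ j, ∫ ω, |x j (ζ ω)| ∂P ≤ 1 + v := fun j => by
    have : ∫ ω, |x j (ζ ω)| ∂P ≤ ∫ ω, (1 + x j (ζ ω) ^ 2) ∂P := by
      refine integral_mono (hi j).abs ((integrable_const 1).add (hL2 j).integrable_sq) fun ω => ?_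
      change |x j (ζ ω)| ≤ 1 + x j (ζ ω) ^ 2
      rw [← sq_abs]
      nlinarith [sq_nonneg (|x j (ζ ω)| - 1), abs_nonneg (x j (ζ ω))]
    rw [integral_add (integrable_const 1) (hL2 j).integrable_sq, hv] at this
    simpa using this
  have key := integrable_and_integral_of_indepFun_nat hN hζ hind
    (F := fun k d => ∑ j ∈ Finset.range k, x j d)
    (fun k => Finset.measurable_fun_sum _ fun j _ => hx j)
    (fun k => integrable_finsetSum _ fun j _ => hi j) (w := fun k => k * (1 + v))
    (fun k => by
      calc ∫ ω, |∑ j ∈ Finset.range k, x j (ζ ω)| ∂P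
          ≤ ∫ ω, ∑ j ∈ Finset.range k, |x j (ζ ω)| ∂P :=
            integral_mono (integrable_finsetSum _ fun j _ => hi j).abs
              (integrable_finsetSum _ fun j _ => (hi j).abs)
              fun ω => Finset.abs_sum_le_sum_abs _ _
        _ ≤ ∑ j ∈ Finset.range k, (1 + v) := by
            rw [integral_finsetSum _ fun j _ => (hi j).abs]
            exact Finset.sum_le_sum fun j _ => habs j
        _ = k * (1 + v) := by simp; ring) (hN1.mul_const _)
  rw [key.2, ← integral_mul_const]
  congr 1 with ω
  rw [integral_finsetSum _ fun j _ => hi j]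
  simp [hm]

theorem abs_integral_sq_randomSum_sub_le {D : Type*} [MeasurableSpace D] {N : Ω → ℕ} {ζ : Ω → D}
    (hN : Measurable N) (hζ : Measurable ζ) (hind : IndepFun N ζ P) {x : ℕ → D → ℝ}
    (hx : ∀ j, Measurable (x j)) (hL2 : ∀ j, MemLp (fun ω => x j (ζ ω)) 2 P)
    (hv : ∀ j, ∫ ω, x j (ζ ω) ^ 2 ∂P = v) (hN1 : Integrable (fun ω => (N ω : ℝ)) P)
    (hN2 : Integrable (fun ω => (N ω : ℝ) ^ 2) P) (hc0 : 0 ≤ c)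
    (hc : ∀ j l, j ≠ l → ∫ ω, |x j (ζ ω) * x l (ζ ω)| ∂P ≤ c) :
    |∫ ω, (∑ j ∈ Finset.range (N ω), x j (ζ ω)) ^ 2 ∂P - (∫ ω, (N ω : ℝ) ∂P) * v| ≤
      (∫ ω, (N ω : ℝ) ^ 2 ∂P) * c := by
  have hSL : ∀ k, MemLp (fun ω => ∑ j ∈ Finset.range k, x j (ζ ω)) 2 P := fun k =>
    memLp_finsetSum _ fun j _ => hL2 j
  have key := integrable_and_integral_of_indepFun_nat hN hζ hind
    -- The diagonal is subtracted before integrating over the count, so that the bound for fixed k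
    -- applies under the integral.
    (F := fun k d => (∑ j ∈ Finset.range k, x j d) ^ 2 - k * v)
    (fun k => ((Finset.measurable_fun_sum _ fun j _ => hx j).pow_const 2).sub_const _)
    (fun k => (hSL k).integrable_sq.sub (integrable_const _)) (w := fun k => k ^ 2 * v + k * v)
    (fun k => by
      have hv0 : 0 ≤ v := by rw [← hv 0]; positivity
      calc ∫ ω, |(∑ j ∈ Finset.range k, x j (ζ ω)) ^ 2 - k * v| ∂P
          ≤ ∫ ω, ((∑ j ∈ Finset.range k, x j (ζ ω)) ^ 2 + k * v) ∂P := by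
            refine integral_mono ((hSL k).integrable_sq.sub (integrable_const _)).abs
              ((hSL k).integrable_sq.add (integrable_const _)) fun ω => ?_
            have := abs_sub (∑ j ∈ Finset.range k, x j (ζ ω) ^ 2) (k * v)
            refine (abs_sub _ _).trans_eq ?_
            rw [abs_of_nonneg (sq_nonneg _), abs_of_nonneg (by positivity)]
        _ ≤ k ^ 2 * v + k * v := by
            rw [integral_add (hSL k).integrable_sq (integrable_const _)]
            have := integral_sq_sum_range_le hL2 hv k
            simpa using this)
    ((hN2.mul_const v).add (hN1.mul_const v))
  have hsq := (integral_randomSum_le hN hζ hind hx hL2 hv hN2).1.integrable_sq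
  have h1 := key.2
  rw [integral_sub hsq (hN1.mul_const v), integral_mul_const] at h1
  rw [h1, ← integral_mul_const]
  refine abs_integral_le_integral_abs.trans
    (integral_mono_of_nonneg (.of_forall fun ω => abs_nonneg _) (hN2.mul_const c)
      (.of_forall fun ω => ?_))
  dsimp only
  rw [integral_sub (hSL _).integrable_sq (integrable_const _)]
  simpa using abs_integral_sq_sum_range_sub_le hL2 hv hc0 hc (N ω)

theorem integral_indicator_sq_randomSum_le {D : Type*} [MeasurableSpace D] {N : Ω → ℕ} {ζ : Ω → D}
    (hN : Measurable N) (hζ : Measurable ζ) (hind : IndepFun N ζ P) {x : ℕ → D → ℝ}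
    (hx : ∀ j, Measurable (x j)) (hL2 : ∀ j, MemLp (fun ω => x j (ζ ω)) 2 P)
    (hv : ∀ j, ∫ ω, x j (ζ ω) ^ 2 ∂P = v) (hN1 : Integrable (fun ω => (N ω : ℝ)) P)
    (hN2 : Integrable (fun ω => (N ω : ℝ) ^ 2) P) (hc0 : 0 ≤ c)
    (hc : ∀ j l, j ≠ l → ∫ ω, |x j (ζ ω) * x l (ζ ω)| ∂P ≤ c) {δ M q : ℝ} (hδ : 0 < δ)
    (hM : 0 ≤ M)
    (hq : ∀ j, ∫ ω, {y : ℝ | M < y ^ 2}.indicator (fun y => y ^ 2) (x j (ζ ω)) ∂P ≤ q) :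
    ∫ ω, {y : ℝ | δ < |y|}.indicator (fun y => y ^ 2) (∑ j ∈ Finset.range (N ω), x j (ζ ω)) ∂P ≤
      (∫ ω, (N ω : ℝ) ^ 2 ∂P) * (4 * M * v / δ ^ 2) + (∫ ω, (N ω : ℝ) ∂P) * (2 * q) +
        (∫ ω, (N ω : ℝ) ^ 2 ∂P) * (2 * c) := by
  have hSL : ∀ k, MemLp (fun ω => ∑ j ∈ Finset.range k, x j (ζ ω)) 2 P := fun k =>
    memLp_finsetSum _ fun j _ => hL2 j
  have hind0 : ∀ y : ℝ, 0 ≤ {y : ℝ | δ < |y|}.indicator (fun y => y ^ 2) y := fun y =>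
    Set.indicator_nonneg (fun y _ => sq_nonneg y) _
  have hb := integral_indicator_sq_sum_range_le hL2 hv hc0 hc hδ hM hq
  have hwi : Integrable (fun ω => (N ω : ℝ) ^ 2 * (4 * M * v / δ ^ 2) + (N ω : ℝ) * (2 * q)
      + (N ω : ℝ) ^ 2 * (2 * c)) P :=
    ((hN2.mul_const _).add (hN1.mul_const _)).add (hN2.mul_const _)
  have key := integrable_and_integral_of_indepFun_nat hN hζ hind
    (F := fun k d => {y : ℝ | δ < |y|}.indicator (fun y => y ^ 2) (∑ j ∈ Finset.range k, x j d))
    (fun k => (measurable_indicator_sq_comp (measurableSet_lt_abs δ)).comp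
      (Finset.measurable_fun_sum _ fun j _ => hx j))
    (fun k => (hSL k).integrable_indicator_sq (measurableSet_lt_abs δ))
    (w := fun k => k ^ 2 * (4 * M * v / δ ^ 2) + k * (2 * q) + k ^ 2 * (2 * c))
    (fun k => by simpa only [abs_of_nonneg (hind0 _)] using hb k) hwi
  rw [key.2]
  refine (integral_mono_of_nonneg (.of_forall fun ω => integral_nonneg fun _ => hind0 _) hwi
    (.of_forall fun ω => hb (N ω))).trans_eq ?_
  have h12 : Integrable (fun ω => (N ω : ℝ) ^ 2 * (4 * M * v / δ ^ 2) + (N ω : ℝ) * (2 * q)) P :=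
    (hN2.mul_const _).add (hN1.mul_const _)
  rw [integral_add h12 (hN2.mul_const _), integral_add (hN2.mul_const _) (hN1.mul_const _),
    integral_mul_const, integral_mul_const, integral_mul_const]

end RandomSum

/-! ### Independence of the observation times from the rest of a subject -/

/-- A bounded variable that has the same covariance with every term of a sequence of independent
centred bounded variables is uncorrelated with them. -/
theorem eq_zero_of_forall_integral_mul_eq {Ω : Type*} [MeasurableSpace Ω] {P : Measure Ω}
    [IsProbabilityMeasure P] {U : ℕ → Ω → ℝ} {A : Ω → ℝ} (hU : iIndepFun U P)
    (mU : ∀ k, Measurable (U k)) (bU : ∀ k ω, |U k ω| ≤ 1) (eU : ∀ k, ∫ ω, U k ω ∂P = 0)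
    (mA : Measurable A) (bA : ∀ ω, |A ω| ≤ 1) {d : ℝ} (hd : ∀ k, ∫ ω, A ω * U k ω ∂P = d) :
    d = 0 := by
  have hUL : ∀ k, MemLp (U k) 2 P := fun k =>
    MemLp.of_bound (mU k).aestronglyMeasurable 1 (.of_forall (bU k))
  have hAL : MemLp A 2 P := MemLp.of_bound mA.aestronglyMeasurable 1 (.of_forall bA)
  -- The sum W of m terms has covariance m d with A but second moment at most m. Cauchy–Schwarz
  -- gives (m d)² ≤ m for every m, which forces d = 0.
  have key : ∀ m : ℕ, (m : ℝ) ^ 2 * d ^ 2 ≤ m := by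
    intro m
    have hWL : MemLp (fun ω => ∑ k ∈ Finset.range m, U k ω) 2 P := memLp_finsetSum _ fun k _ => hUL k
    have hmean : ∫ ω, ∑ k ∈ Finset.range m, U k ω ∂P = 0 := by
      rw [integral_finsetSum _ fun k _ => (hUL k).integrable (by norm_num)]
      simp [eU]
    have hvar : ∫ ω, (∑ k ∈ Finset.range m, U k ω) ^ 2 ∂P ≤ m := by
      have h1 := IndepFun.variance_sum (X := U) (s := Finset.range m) (fun i _ => hUL i)
        (fun i _ j _ hij => hU.indepFun hij)
      have h2 : Var[∑ k ∈ Finset.range m, U k; P]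
          = ∫ ω, (∑ k ∈ Finset.range m, U k ω) ^ 2 ∂P := by
        rw [show (∑ k ∈ Finset.range m, U k) = fun ω => ∑ k ∈ Finset.range m, U k ω by ext; simp,
          variance_of_integral_eq_zero hWL.aestronglyMeasurable.aemeasurable hmean]
      rw [← h2, h1]
      calc ∑ k ∈ Finset.range m, Var[U k; P] ≤ ∑ k ∈ Finset.range m, (1 : ℝ) := by
            refine Finset.sum_le_sum fun k _ =>
              (variance_le_expectation_sq (hUL k).1).trans ?_
            calc ∫ ω, (U k ^ 2) ω ∂P ≤ ∫ ω, (1 : ℝ) ∂P := by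
                  refine integral_mono (hUL k).integrable_sq (integrable_const 1) fun ω => ?_
                  simpa using bU k ω
              _ = 1 := by simp
        _ = m := by simp
    have hAW : ∫ ω, A ω * ∑ k ∈ Finset.range m, U k ω ∂P = m * d := by
      simp_rw [Finset.mul_sum]
      have hi : ∀ k, Integrable (fun ω => A ω * U k ω) P := fun k => hAL.integrable_mul (hUL k)
      rw [integral_finsetSum _ fun k _ => hi k]
      simp [hd]
    have hA2 : ∫ ω, A ω ^ 2 ∂P ≤ 1 := by
      calc ∫ ω, A ω ^ 2 ∂P ≤ ∫ ω, (1 : ℝ) ∂P := by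
            refine integral_mono hAL.integrable_sq (integrable_const 1) fun ω => ?_
            simpa using bA ω
        _ = 1 := by simp
    -- This is the expectation of (m d A - W)² ≥ 0; the weight m d turns it into 2(m d)² ≤ (m d)² +
    -- m.
    have hcs : ∫ ω, 2 * (m * d) * (A ω * ∑ k ∈ Finset.range m, U k ω) ∂P ≤
        ∫ ω, ((m * d) ^ 2 * A ω ^ 2 + (∑ k ∈ Finset.range m, U k ω) ^ 2) ∂P := by
      refine integral_mono ((hAL.integrable_mul hWL).const_mul _)
        ((hAL.integrable_sq.const_mul _).add hWL.integrable_sq) fun ω => ?_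
      change _ ≤ (m * d) ^ 2 * A ω ^ 2 + (∑ k ∈ Finset.range m, U k ω) ^ 2
      nlinarith [sq_nonneg (m * d * A ω - ∑ k ∈ Finset.range m, U k ω)]
    rw [integral_const_mul, hAW, integral_add (hAL.integrable_sq.const_mul _) hWL.integrable_sq,
      integral_const_mul] at hcs
    nlinarith [sq_nonneg (m * d)]
  by_contra hne
  have hpos : 0 < d ^ 2 := by positivity
  obtain ⟨m, hm⟩ := exists_nat_gt (1 / d ^ 2)
  have hm0 : (0 : ℝ) < m := (by positivity : 0 < 1 / d ^ 2).trans hm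
  have h1 := key m
  rw [div_lt_iff₀ hpos] at hm
  nlinarith

section

variable {Ω : Type*} [MeasurableSpace Ω] {P : Measure Ω}
  {T Y : ℕ → ℕ → Ω → ℝ} {Z : ℕ → Ω → ℝ} {f₃ : ℝ → ℝ → ℝ → ℝ} {f₅ : ℝ → ℝ → ℝ → ℝ → ℝ → ℝ}

theorem RandomDesign.measure_time_eq (hD : RandomDesign P T Y Z f₃ f₅) (i j k : ℕ) {s : Set ℝ}
    (hs : MeasurableSet s) : P (T i j ⁻¹' s) = P (T i k ⁻¹' s) := by
  have h := (hD.law_single i j).trans (hD.law_single i k).symm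
  have h' := congrArg (fun ν => ν ((fun q : ℝ × ℝ × ℝ => q.1) ⁻¹' s)) h
  have hm : ∀ j, Measurable fun ω => (T i j ω, Z i ω, Y i j ω) := fun j =>
    (hD.measurable_T i j).prodMk ((hD.measurable_Z i).prodMk (hD.measurable_Y i j))
  have hs' : MeasurableSet ((fun q : ℝ × ℝ × ℝ => q.1) ⁻¹' s) := measurable_fst hs
  simp only [Measure.map_apply (hm _) hs'] at h'
  exact h'

theorem RandomDesign.measure_inter_time_eq (hD : RandomDesign P T Y Z f₃ f₅) {i j k l : ℕ}
    (hk : j ≠ k) (hl : j ≠ l) {s : Set (ℝ × ℝ × ℝ)} {u : Set ℝ} (hs : MeasurableSet s)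
    (hu : MeasurableSet u) :
    P ((fun ω => (T i j ω, Z i ω, Y i j ω)) ⁻¹' s ∩ T i k ⁻¹' u) =
      P ((fun ω => (T i j ω, Z i ω, Y i j ω)) ⁻¹' s ∩ T i l ⁻¹' u) := by
  have h := (hD.law_pair i j k hk).trans (hD.law_pair i j l hl).symm
  have hs' : MeasurableSet ((fun q : ℝ × ℝ × ℝ × ℝ × ℝ => (q.1, q.2.2.1, q.2.2.2.1)) ⁻¹' s ∩
      (fun q : ℝ × ℝ × ℝ × ℝ × ℝ => q.2.1) ⁻¹' u) :=
    ((by fun_prop : Measurable fun q : ℝ × ℝ × ℝ × ℝ × ℝ => (q.1, q.2.2.1, q.2.2.2.1)) hs).inter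
      ((by fun_prop : Measurable fun q : ℝ × ℝ × ℝ × ℝ × ℝ => q.2.1) hu)
  have hm : ∀ k, Measurable fun ω => (T i j ω, T i k ω, Z i ω, Y i j ω, Y i k ω) := fun k =>
    (hD.measurable_T i j).prodMk ((hD.measurable_T i k).prodMk ((hD.measurable_Z i).prodMk
      ((hD.measurable_Y i j).prodMk (hD.measurable_Y i k))))
  have h' := congrArg (fun ν => ν ((fun q : ℝ × ℝ × ℝ × ℝ × ℝ => (q.1, q.2.2.1, q.2.2.2.1)) ⁻¹' s ∩
      (fun q : ℝ × ℝ × ℝ × ℝ × ℝ => q.2.1) ⁻¹' u)) h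
  simp only [Measure.map_apply (hm _) hs'] at h'
  exact h'

variable [IsProbabilityMeasure P]

/-- Since a subject carries infinitely many exchangeable-in-law i.i.d. times, each time is
independent of the covariate together with any other observation of the subject. -/
theorem RandomDesign.indepFun_time (hD : RandomDesign P T Y Z f₃ f₅) (i : ℕ) {j k : ℕ}
    (hjk : j ≠ k) : IndepFun (fun ω => (T i j ω, Z i ω, Y i j ω)) (T i k) P := by
  have hmj : Measurable fun ω => (T i j ω, Z i ω, Y i j ω) :=
    (hD.measurable_T i j).prodMk ((hD.measurable_Z i).prodMk (hD.measurable_Y i j))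
  rw [indepFun_iff_measure_inter_preimage_eq_mul]
  intro s u hs hu
  set E := (fun ω => (T i j ω, Z i ω, Y i j ω)) ⁻¹' s with hE
  have mE : MeasurableSet E := hmj hs
  set p := P.real (T i k ⁻¹' u) with hp
  have hp0 : 0 ≤ p := measureReal_nonneg
  have hp1 : p ≤ 1 := measureReal_le_one
  have mu : ∀ l, MeasurableSet (T i l ⁻¹' u) := fun l => hD.measurable_T i l hu
  have hpl : ∀ l, P.real (T i l ⁻¹' u) = p := fun l => by
    rw [hp, measureReal_def, measureReal_def, hD.measure_time_eq i l k hu]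
  set g : ℝ → ℝ := fun x => u.indicator (fun _ => 1) x - p with hg
  have mg : Measurable g := (measurable_const.indicator hu).sub_const p
  have hgT : ∀ l ω, g (T i l ω) = (T i l ⁻¹' u).indicator (fun _ => (1 : ℝ)) ω - p := fun l ω => rfl
  have hone : ∀ {S : Set Ω}, MeasurableSet S → ∫ ω, S.indicator (fun _ => (1 : ℝ)) ω ∂P = P.real S :=
    fun hS => integral_indicator_one hS
  have hzero : P.real (E ∩ T i k ⁻¹' u) - P.real E * p = 0 := by
    -- The centred indicators of the times with index beyond j are independent of each other, and by
    -- the common law of pairs they all have the same covariance with the event E as the time k has.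
    refine eq_zero_of_forall_integral_mul_eq (P := P) (U := fun l ω => g (T i (j + 1 + l) ω))
      (A := E.indicator fun _ => 1) ?_ (fun l => mg.comp (hD.measurable_T i _)) (fun l ω => ?_)
      (fun l => ?_) (measurable_const.indicator mE) (fun ω => ?_) (fun l => ?_)
    · exact ((hD.indep_times i).precomp (g := fun l => j + 1 + l)
        (fun a b h => by simpa using h)).comp (fun _ => g) fun _ => mg
    · rw [hgT, abs_le]
      by_cases h : ω ∈ T i (j + 1 + l) ⁻¹' u
      · rw [Set.indicator_of_mem h]; constructor <;> linarith
      · rw [Set.indicator_of_notMem h]; constructor <;> linarith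
    · simp_rw [hgT]
      rw [integral_sub ((integrable_const 1).indicator (mu _)) (integrable_const _),
        hone (mu _), hpl]
      simp
    · by_cases h : ω ∈ E <;> simp [h]
    · have h1 : ∀ ω, E.indicator (fun _ => (1 : ℝ)) ω * g (T i (j + 1 + l) ω) =
          (E ∩ T i (j + 1 + l) ⁻¹' u).indicator (fun _ => 1) ω
            - p * E.indicator (fun _ => 1) ω := fun ω => by
        rw [hgT]
        by_cases h : ω ∈ E <;> by_cases h' : ω ∈ T i (j + 1 + l) ⁻¹' u <;>
          simp_all [Set.indicator]
      simp_rw [h1]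
      rw [integral_sub ((integrable_const 1).indicator (mE.inter (mu _)))
        (((integrable_const 1).indicator mE).const_mul p), integral_const_mul,
        hone (mE.inter (mu _)), hone mE, measureReal_def,
        hD.measure_inter_time_eq (l := k) (by omega) hjk hs hu, mul_comm]
      rfl
  rw [← ENNReal.toReal_eq_toReal_iff' (measure_ne_top _ _)
    (ENNReal.mul_ne_top (measure_ne_top _ _) (measure_ne_top _ _)), ENNReal.toReal_mul]
  simp only [measureReal_def, hp] at hzero
  linarith

end

/-! ### Second-order expansions -/

/-- The derivative of the remainder at w is the first-order remainder of the derivative of G, hence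
o(‖w‖). The mean value inequality on the ball of radius ‖v‖ gains the second factor. -/
theorem ContDiffAt.exists_forall_abs_sub_taylor_two_le {E : Type*} [NormedAddCommGroup E]
    [NormedSpace ℝ E] {G : E → ℝ} {x₀ : E} (hG : ContDiffAt ℝ 2 G x₀) {ε : ℝ} (hε : 0 < ε) :
    ∃ δ > 0, ∀ v : E, ‖v‖ < δ →
      |G (x₀ + v) - G x₀ - fderiv ℝ G x₀ v - 1 / 2 * fderiv ℝ (fderiv ℝ G) x₀ v v|
        ≤ ε * ‖v‖ ^ 2 := by
  have hsymm : IsSymmSndFDerivAt ℝ G x₀ := hG.isSymmSndFDerivAt (by simp)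
  have hF : DifferentiableAt ℝ (fderiv ℝ G) x₀ :=
    (hG.fderiv_right (m := 1) (by norm_num)).differentiableAt (by norm_num)
  have hev : ∀ᶠ x in 𝓝 x₀, DifferentiableAt ℝ G x :=
    (hG.eventually (by simp)).mono fun x hx => hx.differentiableAt (by norm_num)
  set F := fderiv ℝ G with hFdef
  set F' := fderiv ℝ F x₀ with hF'
  have hlit := (hasFDerivAt_iff_isLittleO_nhds_zero.1 hF.hasFDerivAt).def hε
  have hev0 : ∀ᶠ v in 𝓝 (0 : E), DifferentiableAt ℝ G (x₀ + v) := by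
    have : Tendsto (fun v : E => x₀ + v) (𝓝 0) (𝓝 x₀) := by
      simpa using (tendsto_const_nhds (x := x₀)).add (tendsto_id (α := E) (x := 𝓝 0))
    exact this.eventually hev
  obtain ⟨δ, hδ, hball⟩ := Metric.eventually_nhds_iff_ball.1 (hlit.and hev0)
  refine ⟨δ, hδ, fun v hv => ?_⟩
  set r : E → ℝ := fun w => G (x₀ + w) - G x₀ - F x₀ w - 1 / 2 * F' w w with hr
  have hder : ∀ w ∈ Metric.closedBall (0 : E) ‖v‖,
      HasFDerivWithinAt r (F (x₀ + w) - F x₀ - F' w) (Metric.closedBall (0 : E) ‖v‖) w := by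
    intro w hw
    have hw' : w ∈ Metric.ball (0 : E) δ := Metric.closedBall_subset_ball hv hw
    have h1 : HasFDerivAt (fun w => G (x₀ + w)) (F (x₀ + w)) w :=
      (hasFDerivAt_comp_add_left x₀).2 (hball w hw').2.hasFDerivAt
    have h2 : HasFDerivAt (fun w => F' w w) ((F'.bilinearComp (.id ℝ E) (.id ℝ E)).deriv₂ (w, w)
        |>.comp ((ContinuousLinearMap.id ℝ E).prod (.id ℝ E))) w := by
      have := (F'.hasFDerivAt_of_bilinear (hasFDerivAt_id w) (hasFDerivAt_id w))
      refine this.congr_fderiv ?_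
      ext x; simp
    refine (((h1.sub_const _).sub (F x₀).hasFDerivAt).sub (h2.const_mul (1 / 2))).congr_fderiv ?_
      |>.hasFDerivWithinAt
    ext x
    -- Differentiating the quadratic form gives F' x w + F' w x; symmetry of the second derivative
    -- merges the two and cancels the factor 1/2.
    have := hsymm.eq x w
    simp only [sub_apply, smul_apply,
      ContinuousLinearMap.comp_apply, ContinuousLinearMap.prod_apply, smul_eq_mul,
      ContinuousLinearMap.coe_deriv₂, ContinuousLinearMap.bilinearComp_apply,
      ContinuousLinearMap.id_apply]
    change F' x w = F' w x at this
    linarith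
  have hbound : ∀ w ∈ Metric.closedBall (0 : E) ‖v‖, ‖F (x₀ + w) - F x₀ - F' w‖ ≤ ε * ‖v‖ := by
    intro w hw
    refine ((hball w (Metric.closedBall_subset_ball hv hw)).1).trans ?_
    gcongr
    simpa using hw
  have := (convex_closedBall (0 : E) ‖v‖).norm_image_sub_le_of_norm_hasFDerivWithin_le hder hbound
    (x := 0) (y := v) (by simp) (by simp)
  rw [hr] at this
  simp only [add_zero, sub_self, map_zero, mul_zero, sub_zero, Real.norm_eq_abs] at this
  calc _ ≤ _ := this
    _ = ε * ‖v‖ ^ 2 := by ring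

section Plane

variable {g : ℝ → ℝ → ℝ} {t z : ℝ}

theorem hasDerivAt_fst_of_differentiableAt {G : ℝ × ℝ → ℝ} {x : ℝ × ℝ}
    (h : DifferentiableAt ℝ G x) : HasDerivAt (fun a => G (a, x.2)) (fderiv ℝ G x (1, 0)) x.1 := by
  have h1 : HasDerivAt (fun a : ℝ => (a, x.2)) ((1 : ℝ), (0 : ℝ)) x.1 :=
    (hasDerivAt_id x.1).prodMk (hasDerivAt_const _ _)
  exact HasFDerivAt.comp_hasDerivAt (f := fun a : ℝ => (a, x.2)) x.1 h.hasFDerivAt h1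

theorem hasDerivAt_snd_of_differentiableAt {G : ℝ × ℝ → ℝ} {x : ℝ × ℝ}
    (h : DifferentiableAt ℝ G x) : HasDerivAt (fun b => G (x.1, b)) (fderiv ℝ G x (0, 1)) x.2 := by
  have h1 : HasDerivAt (fun b : ℝ => (x.1, b)) ((0 : ℝ), (1 : ℝ)) x.2 :=
    (hasDerivAt_const _ _).prodMk (hasDerivAt_id x.2)
  exact HasFDerivAt.comp_hasDerivAt (f := fun b : ℝ => (x.1, b)) x.2 h.hasFDerivAt h1

theorem eventually_nhds_fst {p : ℝ × ℝ → Prop} (h : ∀ᶠ x in 𝓝 (t, z), p x) :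
    ∀ᶠ a in 𝓝 t, p (a, z) :=
  ((by fun_prop : Continuous fun a : ℝ => (a, z)).tendsto t).eventually h

theorem eventually_nhds_snd {p : ℝ × ℝ → Prop} (h : ∀ᶠ x in 𝓝 (t, z), p x) :
    ∀ᶠ b in 𝓝 z, p (t, b) :=
  ((by fun_prop : Continuous fun b : ℝ => (t, b)).tendsto z).eventually h

/-- Links the iterated one-variable derivatives in the bias formula to the second Fréchet
derivative, for which the Taylor expansion and linearity are available. -/
theorem mixedPartial_eq_fderiv_fderiv
    (hg : ContDiffAt ℝ 2 (fun x : ℝ × ℝ => g x.1 x.2) (t, z)) :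
    mixedPartial 2 0 g t z =
        fderiv ℝ (fderiv ℝ fun x : ℝ × ℝ => g x.1 x.2) (t, z) (1, 0) (1, 0) ∧
      mixedPartial 1 1 g t z =
        fderiv ℝ (fderiv ℝ fun x : ℝ × ℝ => g x.1 x.2) (t, z) (1, 0) (0, 1) ∧
      mixedPartial 0 2 g t z =
        fderiv ℝ (fderiv ℝ fun x : ℝ × ℝ => g x.1 x.2) (t, z) (0, 1) (0, 1) := by
  set G := fun x : ℝ × ℝ => g x.1 x.2 with hG
  have hF : DifferentiableAt ℝ (fderiv ℝ G) (t, z) :=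
    (hg.fderiv_right (m := 1) (by norm_num)).differentiableAt (by norm_num)
  have hev : ∀ᶠ x in 𝓝 (t, z), DifferentiableAt ℝ G x :=
    (hg.eventually (by simp)).mono fun x hx => hx.differentiableAt (by norm_num)
  have hdir : ∀ e : ℝ × ℝ, DifferentiableAt ℝ (fun x => fderiv ℝ G x e) (t, z) := fun e =>
    hF.clm_apply (differentiableAt_const e)
  have hdir' : ∀ e v : ℝ × ℝ, fderiv ℝ (fun x => fderiv ℝ G x e) (t, z) v =
      fderiv ℝ (fderiv ℝ G) (t, z) v e := fun e v => by
    rw [fderiv_clm_apply hF (differentiableAt_const e)]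
    simp
  have e1 := eventually_nhds_fst hev
  have e2 := eventually_nhds_snd hev
  refine ⟨?_, ?_, ?_⟩
  · simp only [mixedPartial, iteratedDeriv_zero]
    rw [iteratedDeriv_succ, iteratedDeriv_one]
    have : deriv (fun t' => g t' z) =ᶠ[𝓝 t] fun a => fderiv ℝ G (a, z) (1, 0) := by
      filter_upwards [e1] with a ha
      exact (hasDerivAt_fst_of_differentiableAt ha).deriv
    rw [this.deriv_eq, (hasDerivAt_fst_of_differentiableAt (hdir (1, 0))).deriv, hdir']
  · simp only [mixedPartial, iteratedDeriv_one]
    have : (fun t' => deriv (fun z' => g t' z') z) =ᶠ[𝓝 t] fun a => fderiv ℝ G (a, z) (0, 1) := by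
      filter_upwards [e1] with a ha
      exact (hasDerivAt_snd_of_differentiableAt ha).deriv
    rw [this.deriv_eq, (hasDerivAt_fst_of_differentiableAt (hdir (0, 1))).deriv, hdir']
  · simp only [mixedPartial, iteratedDeriv_zero]
    rw [iteratedDeriv_succ, iteratedDeriv_one]
    have : deriv (fun z' => g t z') =ᶠ[𝓝 z] fun b => fderiv ℝ G (t, b) (0, 1) := by
      filter_upwards [e2] with b hb
      exact (hasDerivAt_snd_of_differentiableAt hb).deriv
    rw [this.deriv_eq, (hasDerivAt_snd_of_differentiableAt (hdir (0, 1))).deriv, hdir']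

/-- The first derivatives stay anonymous because the vanishing first moments of the kernel remove
them. -/
theorem exists_forall_abs_sub_mixedPartial_le
    (hg : ContDiffAt ℝ 2 (fun x : ℝ × ℝ => g x.1 x.2) (t, z)) :
    ∃ d₁ d₂ : ℝ, ∀ ε > 0, ∃ δ > 0, ∀ v : ℝ × ℝ, ‖v‖ < δ →
      |g (t + v.1) (z + v.2) - g t z - (d₁ * v.1 + d₂ * v.2)
        - (1 / 2 * mixedPartial 2 0 g t z * v.1 ^ 2 + mixedPartial 1 1 g t z * (v.1 * v.2)
          + 1 / 2 * mixedPartial 0 2 g t z * v.2 ^ 2)| ≤ ε * ‖v‖ ^ 2 := by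
  obtain ⟨h20, h11, h02⟩ := mixedPartial_eq_fderiv_fderiv hg
  set G := fun x : ℝ × ℝ => g x.1 x.2 with hG
  refine ⟨fderiv ℝ G (t, z) (1, 0), fderiv ℝ G (t, z) (0, 1), fun ε hε => ?_⟩
  obtain ⟨δ, hδ, h⟩ := hg.exists_forall_abs_sub_taylor_two_le hε
  refine ⟨δ, hδ, fun v hv => ?_⟩
  refine le_trans (le_of_eq ?_) (h v hv)
  have hv' : v = v.1 • ((1 : ℝ), (0 : ℝ)) + v.2 • ((0 : ℝ), (1 : ℝ)) := by ext <;> simp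
  have hlin : ∀ L : ℝ × ℝ →L[ℝ] ℝ, L v = v.1 * L (1, 0) + v.2 * L (0, 1) := fun L => by
    refine (congrArg L hv').trans ?_
    rw [map_add, map_smul, map_smul, smul_eq_mul, smul_eq_mul]
  have hsymm : fderiv ℝ (fderiv ℝ G) (t, z) (0, 1) (1, 0) =
      fderiv ℝ (fderiv ℝ G) (t, z) (1, 0) (0, 1) :=
    (hg.isSymmSndFDerivAt (by simp)).eq _ _
  have hquad : fderiv ℝ (fderiv ℝ G) (t, z) v v =
      v.1 ^ 2 * mixedPartial 2 0 g t z + 2 * v.1 * v.2 * mixedPartial 1 1 g t z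
        + v.2 ^ 2 * mixedPartial 0 2 g t z := by
    rw [h20, h11, h02, hlin]
    have : ∀ e : ℝ × ℝ, fderiv ℝ (fderiv ℝ G) (t, z) v e =
        v.1 * fderiv ℝ (fderiv ℝ G) (t, z) (1, 0) e
          + v.2 * fderiv ℝ (fderiv ℝ G) (t, z) (0, 1) e := fun e => by
      have h1 : fderiv ℝ (fderiv ℝ G) (t, z) v = v.1 • fderiv ℝ (fderiv ℝ G) (t, z) (1, 0)
          + v.2 • fderiv ℝ (fderiv ℝ G) (t, z) (0, 1) := by
        refine (congrArg (fderiv ℝ (fderiv ℝ G) (t, z)) hv').trans ?_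
        rw [map_add, map_smul, map_smul]
      rw [h1]; simp
    rw [this, this, hsymm]
    ring
  rw [hquad, hlin (fderiv ℝ G (t, z))]
  simp only [hG, Prod.fst_add, Prod.snd_add]
  congr 1
  ring

end Plane

/-! ### Smoothing by a second-order kernel -/

section Kernel

variable {K : ℝ × ℝ → ℝ}

theorem MeasureTheory.Integrable.continuous_mul_of_hasCompactSupport (hK : Integrable K)
    (hKc : HasCompactSupport K) {φ : ℝ × ℝ → ℝ} (hφ : Continuous φ) :
    Integrable fun s => φ s * K s := by
  obtain ⟨C, hC⟩ := hKc.isCompact.exists_bound_of_continuousOn hφ.continuousOn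
  refine (hK.norm.const_mul C).mono' (hφ.aestronglyMeasurable.mul hK.1) (.of_forall fun s => ?_)
  rw [norm_mul]
  by_cases hs : s ∈ tsupport K
  · gcongr; exact hC s hs
  · simp [image_eq_zero_of_notMem_tsupport hs]

theorem HasCompactSupport.exists_pos_forall_norm_le (hKc : HasCompactSupport K) :
    ∃ R > 0, ∀ s, K s ≠ 0 → ‖s‖ ≤ R := by
  obtain ⟨R, hR, h⟩ := hKc.isCompact.isBounded.exists_pos_norm_le
  exact ⟨R, hR, fun s hs => h s (subset_tsupport _ hs)⟩

theorem IsSecondOrderKernel.integrable (hK : IsSecondOrderKernel K) : Integrable K := by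
  have h : IntegrableOn K (tsupport K) := by
    have : IsFiniteMeasure ((volume : Measure (ℝ × ℝ)).restrict (tsupport K)) :=
      ⟨by simpa using hK.hasCompactSupport.isCompact.measure_lt_top⟩
    exact (hK.memLp_two.restrict _).integrable (by norm_num)
  exact (integrableOn_iff_integrable_of_support_subset (subset_tsupport K)).1 h

/-- Expand g to second order under the integral: the constant is reproduced since K has mass one,
the linear terms vanish, and the quadratic terms divided by a² depend only on b/a. Compact support
makes the remainder uniformly o(a²) on the support of K. -/
theorem IsSecondOrderKernel.tendsto_smoothing (hK : IsSecondOrderKernel K) {g : ℝ → ℝ → ℝ}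
    {t z : ℝ} (hg : ContDiffAt ℝ 2 (fun x : ℝ × ℝ => g x.1 x.2) (t, z))
    (hgm : Measurable fun x : ℝ × ℝ => g x.1 x.2) {a b : ℕ → ℝ} {ρ : ℝ} (ha : ∀ n, 0 < a n)
    (hb : ∀ n, 0 < b n) (ha0 : Tendsto a atTop (𝓝 0))
    (hρ : Tendsto (fun n => b n / a n) atTop (𝓝 ρ)) :
    Tendsto (fun n => ((∫ s : ℝ × ℝ, K s * g (t - a n * s.1) (z - b n * s.2)) - g t z) / a n ^ 2)
      atTop (𝓝 (∑ k ∈ Finset.HasAntidiagonal.antidiagonal (2 : ℕ),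
        1 / ((k.1.factorial : ℝ) * (k.2.factorial : ℝ)) *
        (∫ s : ℝ × ℝ, s.1 ^ k.1 * s.2 ^ k.2 * K s) * mixedPartial k.1 k.2 g t z * ρ ^ k.2)) := by
  obtain ⟨d₁, d₂, hT⟩ := exists_forall_abs_sub_mixedPartial_le hg
  obtain ⟨R, hR, hKR⟩ := hK.hasCompactSupport.exists_pos_forall_norm_le
  have hKi := hK.integrable
  have hi : ∀ {φ : ℝ × ℝ → ℝ}, Continuous φ → Integrable fun s => φ s * K s := fun hφ =>
    hKi.continuous_mul_of_hasCompactSupport hK.hasCompactSupport hφ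
  set p := mixedPartial 2 0 g t z
  set q := mixedPartial 1 1 g t z
  set r := mixedPartial 0 2 g t z
  -- the expansion of the integrand without its remainder
  set A : ℝ → ℝ → ℝ × ℝ → ℝ := fun x y s => g t z * K s + (-(d₁ * x)) * (s.1 * K s)
    + (-(d₂ * y)) * (s.2 * K s) + (1 / 2 * p * x ^ 2) * (s.1 ^ 2 * K s)
    + (q * (x * y)) * (s.1 * s.2 * K s) + (1 / 2 * r * y ^ 2) * (s.2 ^ 2 * K s) with hA
  set m20 := ∫ s : ℝ × ℝ, s.1 ^ 2 * K s
  set m11 := ∫ s : ℝ × ℝ, s.1 * s.2 * K s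
  set m02 := ∫ s : ℝ × ℝ, s.2 ^ 2 * K s
  have i0 : ∀ c : ℝ, Integrable fun s => c * K s := fun c => hKi.const_mul c
  have i1 : ∀ c : ℝ, Integrable fun s : ℝ × ℝ => c * (s.1 * K s) := fun c =>
    (hi continuous_fst).const_mul c
  have i2 : ∀ c : ℝ, Integrable fun s : ℝ × ℝ => c * (s.2 * K s) := fun c =>
    (hi continuous_snd).const_mul c
  have i20 : ∀ c : ℝ, Integrable fun s : ℝ × ℝ => c * (s.1 ^ 2 * K s) := fun c =>
    (hi (φ := fun s : ℝ × ℝ => s.1 ^ 2) (by fun_prop)).const_mul c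
  have i11 : ∀ c : ℝ, Integrable fun s : ℝ × ℝ => c * (s.1 * s.2 * K s) := fun c =>
    (hi (φ := fun s : ℝ × ℝ => s.1 * s.2) (by fun_prop)).const_mul c
  have i02 : ∀ c : ℝ, Integrable fun s : ℝ × ℝ => c * (s.2 ^ 2 * K s) := fun c =>
    (hi (φ := fun s : ℝ × ℝ => s.2 ^ 2) (by fun_prop)).const_mul c
  have hAi : ∀ x y, Integrable (A x y) := fun x y =>
    (((((i0 _).add (i1 _)).add (i2 _)).add (i20 _)).add (i11 _)).add (i02 _)
  have hAint : ∀ x y, ∫ s, A x y s = g t z + 1 / 2 * p * x ^ 2 * m20 + q * (x * y) * m11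
      + 1 / 2 * r * y ^ 2 * m02 := fun x y => by
    have j1 : Integrable fun s => g t z * K s + (-(d₁ * x)) * (s.1 * K s) := (i0 _).add (i1 _)
    have j2 : Integrable fun s => g t z * K s + (-(d₁ * x)) * (s.1 * K s)
      + (-(d₂ * y)) * (s.2 * K s) := j1.add (i2 _)
    have j3 : Integrable fun s => g t z * K s + (-(d₁ * x)) * (s.1 * K s)
      + (-(d₂ * y)) * (s.2 * K s) + (1 / 2 * p * x ^ 2) * (s.1 ^ 2 * K s) := j2.add (i20 _)
    have j4 : Integrable fun s => g t z * K s + (-(d₁ * x)) * (s.1 * K s)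
      + (-(d₂ * y)) * (s.2 * K s) + (1 / 2 * p * x ^ 2) * (s.1 ^ 2 * K s)
      + (q * (x * y)) * (s.1 * s.2 * K s) := j3.add (i11 _)
    rw [hA]
    dsimp only
    rw [integral_add j4 (i02 _), integral_add j3 (i11 _), integral_add j2 (i20 _),
      integral_add j1 (i2 _), integral_add (i0 _) (i1 _)]
    simp only [integral_const_mul, hK.integral_eq_one, hK.first_moment_fst, hK.first_moment_snd]
    ring
  have hmeas : ∀ x y, AEStronglyMeasurable
      (fun s : ℝ × ℝ => K s * g (t - x * s.1) (z - y * s.2)) volume := fun x y =>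
    (hK.measurable.mul (hgm.comp (g := fun x : ℝ × ℝ => g x.1 x.2)
      (f := fun s : ℝ × ℝ => (t - x * s.1, z - y * s.2)) (by fun_prop))).aestronglyMeasurable
  have hrem : Tendsto (fun n => (∫ s : ℝ × ℝ, (K s * g (t - a n * s.1) (z - b n * s.2)
      - A (a n) (b n) s)) / a n ^ 2) atTop (𝓝 0) ∧ ∀ᶠ n in atTop, Integrable
      fun s : ℝ × ℝ => K s * g (t - a n * s.1) (z - b n * s.2) - A (a n) (b n) s := by
    have hρ0 : 0 ≤ ρ := ge_of_tendsto' hρ fun n => (div_pos (hb n) (ha n)).le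
    have hbound : ∀ ε > 0, ∀ᶠ n in atTop, ∀ s : ℝ × ℝ,
        ‖K s * g (t - a n * s.1) (z - b n * s.2) - A (a n) (b n) s‖
          ≤ ε * ((ρ + 1) * R) ^ 2 * a n ^ 2 * ‖K s‖ := by
      intro ε hε
      obtain ⟨δ, hδ, h⟩ := hT ε hε
      have hsmall : Tendsto (fun n => (ρ + 1) * R * a n) atTop (𝓝 0) := by
        simpa using ha0.const_mul ((ρ + 1) * R)
      filter_upwards [hsmall.eventually_lt_const hδ, hρ.eventually_le_const (lt_add_one ρ)]
        with n hn hbn s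
      rw [div_le_iff₀ (ha n)] at hbn
      by_cases hs : K s = 0
      · simp [hA, hs]
      have hsR := hKR s hs
      -- Eventually b ≤ (ρ + 1) a, so a single multiple of a bounds the increment in both
      -- coordinates.
      have hnorm : ‖(-(a n * s.1), -(b n * s.2))‖ ≤ (ρ + 1) * R * a n := by
        rw [Prod.norm_def, max_le_iff]
        have h1 : |s.1| ≤ R := (norm_fst_le s).trans hsR
        have h2 : |s.2| ≤ R := (norm_snd_le s).trans hsR
        simp only [norm_neg, norm_mul, Real.norm_eq_abs, abs_of_pos (ha n), abs_of_pos (hb n)]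
        constructor
        · calc a n * |s.1| ≤ ((ρ + 1) * a n) * R := by
                gcongr
                · exact mul_nonneg (by linarith) (ha n).le
                · nlinarith [ha n]
            _ = _ := by ring
        · calc b n * |s.2| ≤ ((ρ + 1) * a n) * R := by
                gcongr
                exact mul_nonneg (by linarith) (ha n).le
            _ = _ := by ring
      have h1 := h _ (hnorm.trans_lt hn)
      simp only [← sub_eq_add_neg] at h1
      have h2 : K s * g (t - a n * s.1) (z - b n * s.2) - A (a n) (b n) s =
          K s * (g (t - a n * s.1) (z - b n * s.2) - g t z
            - (d₁ * -(a n * s.1) + d₂ * -(b n * s.2))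
            - (1 / 2 * p * (-(a n * s.1)) ^ 2 + q * (-(a n * s.1) * -(b n * s.2))
              + 1 / 2 * r * (-(b n * s.2)) ^ 2)) := by
        rw [hA]; ring
      rw [h2, norm_mul, Real.norm_eq_abs (g _ _ - _ - _ - _), mul_comm]
      gcongr
      refine h1.trans ?_
      rw [mul_assoc, ← mul_pow]
      gcongr
    constructor
    · rw [Metric.tendsto_atTop']
      intro ε hε
      set C := ((ρ + 1) * R) ^ 2 * ∫ s, ‖K s‖ with hC
      have hC0 : 0 ≤ C := by positivity
      obtain ⟨n₀, hn₀⟩ := eventually_atTop.1 (hbound (ε / (C + 1)) (by positivity))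
      refine ⟨n₀, fun n hn => ?_⟩
      have h1 := norm_integral_le_of_norm_le (hKi.norm.const_mul _) (.of_forall (hn₀ n hn.le))
      rw [integral_const_mul] at h1
      have ha2 : 0 < a n ^ 2 := pow_pos (ha n) 2
      rw [dist_zero_right, norm_div, Real.norm_of_nonneg ha2.le, div_lt_iff₀ ha2]
      refine h1.trans_lt ?_
      calc _ = ε / (C + 1) * C * a n ^ 2 := by rw [hC]; ring
        _ < ε * a n ^ 2 := by
          gcongr
          rw [div_mul_eq_mul_div, div_lt_iff₀ (by positivity)]
          nlinarith
    · filter_upwards [hbound 1 one_pos] with n hn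
      exact (hKi.norm.const_mul _).mono' ((hmeas _ _).sub (hAi _ _).1) (.of_forall hn)
  have hlim : Tendsto (fun n => (1 / 2 * p * m20 + q * m11 * (b n / a n)
      + 1 / 2 * r * m02 * (b n / a n) ^ 2) + (∫ s : ℝ × ℝ, (K s * g (t - a n * s.1) (z - b n * s.2)
      - A (a n) (b n) s)) / a n ^ 2) atTop
      (𝓝 ((1 / 2 * p * m20 + q * m11 * ρ + 1 / 2 * r * m02 * ρ ^ 2) + 0)) :=
    (((hρ.const_mul _).const_add _).add ((hρ.pow 2).const_mul _)).add hrem.1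
  have hsum : ∑ k ∈ Finset.HasAntidiagonal.antidiagonal (2 : ℕ),
        1 / ((k.1.factorial : ℝ) * (k.2.factorial : ℝ)) *
        (∫ s : ℝ × ℝ, s.1 ^ k.1 * s.2 ^ k.2 * K s) * mixedPartial k.1 k.2 g t z * ρ ^ k.2 =
      (1 / 2 * p * m20 + q * m11 * ρ + 1 / 2 * r * m02 * ρ ^ 2) + 0 := by
    simp [Finset.Nat.antidiagonal_succ, p, q, r, m20, m11, m02]
    ring
  rw [hsum]
  refine hlim.congr' ?_
  filter_upwards [hrem.2] with n hn
  have hsplit : ∫ s : ℝ × ℝ, K s * g (t - a n * s.1) (z - b n * s.2) =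
      (∫ s, A (a n) (b n) s) + ∫ s : ℝ × ℝ, (K s * g (t - a n * s.1) (z - b n * s.2)
      - A (a n) (b n) s) := by
    rw [← integral_add (hAi _ _) hn]
    congr 1 with s
    ring
  rw [hsplit, hAint]
  have := (ha n).ne'
  field_simp
  ring

end Kernel

/-! ### Localized moments of one observation -/

theorem map_volume_sub_div {a t : ℝ} (ha : 0 < a) :
    Measure.map (fun x : ℝ => (t - x) / a) volume = ENNReal.ofReal a • (volume : Measure ℝ) := by
  have h1 : (fun x : ℝ => (t - x) / a) = (fun y => a⁻¹ * y) ∘ fun x => t - x := by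
    ext x; simp [div_eq_inv_mul]
  rw [h1, ← Measure.map_map (by fun_prop) (by fun_prop),
    (Measure.measurePreserving_sub_left volume t).map_eq,
    Real.map_volume_mul_left (inv_ne_zero ha.ne'), inv_inv, abs_of_pos ha]

theorem map_volume_rescale {a b t z : ℝ} (ha : 0 < a) (hb : 0 < b) :
    Measure.map (fun x : ℝ × ℝ => ((t - x.1) / a, (z - x.2) / b)) volume =
      ENNReal.ofReal (a * b) • (volume : Measure (ℝ × ℝ)) := by
  have h : (fun x : ℝ × ℝ => ((t - x.1) / a, (z - x.2) / b)) =
      Prod.map (fun x => (t - x) / a) (fun x => (z - x) / b) := rfl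
  have e1 := map_volume_sub_div (t := t) ha
  have e2 := map_volume_sub_div (t := z) hb
  have s1 : SFinite (Measure.map (fun x : ℝ => (t - x) / a) volume) := inferInstance
  rw [h, Measure.volume_eq_prod, ← Measure.map_prod_map _ _ (by fun_prop) (by fun_prop), e1, e2,
    Measure.prod_smul_left, Measure.prod_smul_right, smul_smul, ENNReal.ofReal_mul ha.le]

theorem integral_comp_rescale {a b t z : ℝ} (ha : 0 < a) (hb : 0 < b) {F : ℝ × ℝ → ℝ}
    (hF : Measurable F) :
    ∫ x : ℝ × ℝ, F ((t - x.1) / a, (z - x.2) / b) = a * b * ∫ s, F s := by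
  rw [← integral_map (φ := fun x : ℝ × ℝ => ((t - x.1) / a, (z - x.2) / b)) (by fun_prop)
    hF.aestronglyMeasurable, map_volume_rescale ha hb, integral_smul_measure,
    ENNReal.toReal_ofReal (by positivity), smul_eq_mul]

theorem integrable_comp_rescale {a b t z : ℝ} (ha : 0 < a) (hb : 0 < b) {F : ℝ × ℝ → ℝ}
    (hF : Measurable F) (hFi : Integrable F) :
    Integrable fun x : ℝ × ℝ => F ((t - x.1) / a, (z - x.2) / b) := by
  refine (integrable_map_measure (f := fun x : ℝ × ℝ => ((t - x.1) / a, (z - x.2) / b))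
    hF.aestronglyMeasurable (by fun_prop)).1 ?_
  rw [map_volume_rescale ha hb]
  exact hFi.smul_measure ENNReal.ofReal_ne_top

section

variable {Ω : Type*} [MeasurableSpace Ω] {P : Measure Ω}
  {T Y : ℕ → ℕ → Ω → ℝ} {Z : ℕ → Ω → ℝ} {f₃ : ℝ → ℝ → ℝ → ℝ} {f₅ : ℝ → ℝ → ℝ → ℝ → ℝ → ℝ}

theorem RandomDesign.measurable_density (hD : RandomDesign P T Y Z f₃ f₅) :
    Measurable fun q : (ℝ × ℝ) × ℝ => f₃ q.1.1 q.1.2 q.2 :=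
  hD.measurable_f₃.comp (g := fun q : ℝ × ℝ × ℝ => f₃ q.1 q.2.1 q.2.2)
    (f := fun q : (ℝ × ℝ) × ℝ => (q.1.1, q.1.2, q.2)) (by fun_prop)

theorem RandomDesign.measurable_density_section (hD : RandomDesign P T Y Z f₃ f₅) (x : ℝ × ℝ) :
    Measurable (f₃ x.1 x.2) :=
  hD.measurable_density.comp (f := fun y : ℝ => (x, y)) (by fun_prop)

theorem RandomDesign.measurable_integral_density (hD : RandomDesign P T Y Z f₃ f₅) {γ : ℝ → ℝ}
    (hγ : Measurable γ) : Measurable fun x : ℝ × ℝ => ∫ y, γ y * f₃ x.1 x.2 y :=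
  (StronglyMeasurable.integral_prod_right (ν := volume)
    (f := fun (x : ℝ × ℝ) (y : ℝ) => γ y * f₃ x.1 x.2 y)
    ((hγ.comp measurable_snd).mul hD.measurable_density).stronglyMeasurable).measurable

theorem RandomDesign.measurable_observation (hD : RandomDesign P T Y Z f₃ f₅) (i j : ℕ) :
    Measurable fun ω => (T i j ω, Z i ω, Y i j ω) :=
  (hD.measurable_T i j).prodMk ((hD.measurable_Z i).prodMk (hD.measurable_Y i j))

theorem RandomDesign.integrable_observation_iff (hD : RandomDesign P T Y Z f₃ f₅) (i j : ℕ)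
    {F : (ℝ × ℝ) × ℝ → ℝ} (hF : Measurable F) :
    Integrable (fun ω => F ((T i j ω, Z i ω), Y i j ω)) P ↔
      Integrable fun q : (ℝ × ℝ) × ℝ => F q * f₃ q.1.1 q.1.2 q.2 := by
  have hF' : Measurable fun q : ℝ × ℝ × ℝ => F ((q.1, q.2.1), q.2.2) :=
    hF.comp (f := fun q : ℝ × ℝ × ℝ => ((q.1, q.2.1), q.2.2)) (by fun_prop)
  have h1 := integrable_map_measure (f := fun ω => (T i j ω, Z i ω, Y i j ω)) (μ := P)
    hF'.aestronglyMeasurable (hD.measurable_observation i j).aemeasurable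
  rw [hD.law_single, integrable_withDensity_iff_integrable_smul'
    hD.measurable_f₃.ennreal_ofReal (.of_forall fun _ => ENNReal.ofReal_lt_top)] at h1
  simp only [ENNReal.toReal_ofReal (hD.f₃_nonneg _ _ _), smul_eq_mul] at h1
  -- Regrouping as ((t, z), y) lets Fubini integrate out the measurement first and leaves a planar
  -- integral to rescale.
  rw [← (volume_preserving_prodAssoc (α₁ := ℝ) (β₁ := ℝ) (γ₁ := ℝ)).integrable_comp_emb
    MeasurableEquiv.prodAssoc.measurableEmbedding] at h1
  refine h1.symm.trans (integrable_congr (.of_forall fun q => ?_))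
  exact mul_comm _ _

theorem RandomDesign.integral_observation (hD : RandomDesign P T Y Z f₃ f₅) (i j : ℕ)
    {F : (ℝ × ℝ) × ℝ → ℝ} (hF : Measurable F) :
    ∫ ω, F ((T i j ω, Z i ω), Y i j ω) ∂P =
      ∫ q : (ℝ × ℝ) × ℝ, F q * f₃ q.1.1 q.1.2 q.2 := by
  have hF' : Measurable fun q : ℝ × ℝ × ℝ => F ((q.1, q.2.1), q.2.2) :=
    hF.comp (f := fun q : ℝ × ℝ × ℝ => ((q.1, q.2.1), q.2.2)) (by fun_prop)
  have h1 := integral_map (φ := fun ω => (T i j ω, Z i ω, Y i j ω)) (μ := P)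
    (hD.measurable_observation i j).aemeasurable hF'.aestronglyMeasurable
  rw [hD.law_single, integral_withDensity_eq_integral_toReal_smul
    hD.measurable_f₃.ennreal_ofReal (.of_forall fun _ => ENNReal.ofReal_lt_top)] at h1
  simp only [ENNReal.toReal_ofReal (hD.f₃_nonneg _ _ _), smul_eq_mul] at h1
  rw [← (volume_preserving_prodAssoc (α₁ := ℝ) (β₁ := ℝ) (γ₁ := ℝ)).integral_comp'] at h1
  rw [← h1]
  exact integral_congr_ae (.of_forall fun q => mul_comm _ _)

/-- Moments of `φ ((t - T) / a, (z - Z) / b) γ(Y)` for a compactly supported `φ` and small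
bandwidths, when `∫ |γ| f₃` is bounded near `(t, z)`. -/
theorem RandomDesign.integral_localized (hD : RandomDesign P T Y Z f₃ f₅) {φ : ℝ × ℝ → ℝ}
    (hφm : Measurable φ) (hφ : Integrable φ) {R : ℝ} (hR : ∀ s, φ s ≠ 0 → ‖s‖ ≤ R)
    {γ : ℝ → ℝ} (hγ : Measurable γ) {t z δ C : ℝ}
    (hδ : ∀ x : ℝ × ℝ, dist x (t, z) < δ → Integrable (fun y => γ y * f₃ x.1 x.2 y) ∧
      ∫ y, |γ y * f₃ x.1 x.2 y| ≤ C) {a b : ℝ} (ha : 0 < a) (hb : 0 < b) (haR : a * R < δ)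
    (hbR : b * R < δ) (i j : ℕ) :
    Integrable (fun ω => φ ((t - T i j ω) / a, (z - Z i ω) / b) * γ (Y i j ω)) P ∧
      ∫ ω, φ ((t - T i j ω) / a, (z - Z i ω) / b) * γ (Y i j ω) ∂P =
        a * b * ∫ s : ℝ × ℝ, φ s * ∫ y, γ y * f₃ (t - a * s.1) (z - b * s.2) y := by
  set ψ : ℝ × ℝ → ℝ := fun x => φ ((t - x.1) / a, (z - x.2) / b) with hψ
  have hψm : Measurable ψ := hφm.comp (by fun_prop)
  -- The local hypotheses on f₃ suffice: outside the δ-ball the localized kernel is zero.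
  have hnear : ∀ x, ψ x ≠ 0 → dist x (t, z) < δ := by
    intro x hx
    have h := hR _ hx
    rw [Prod.norm_def, max_le_iff] at h
    simp only [Real.norm_eq_abs, abs_div, abs_of_pos ha, abs_of_pos hb] at h
    rw [div_le_iff₀ ha, div_le_iff₀ hb] at h
    rw [dist_comm, Prod.dist_eq, max_lt_iff, Real.dist_eq, Real.dist_eq]
    exact ⟨by linarith, by linarith⟩
  set F : (ℝ × ℝ) × ℝ → ℝ := fun q => ψ q.1 * γ q.2 with hFdef
  have hF : Measurable F := (hψm.comp measurable_fst).mul (hγ.comp measurable_snd)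
  have hH : Measurable fun q : (ℝ × ℝ) × ℝ => F q * f₃ q.1.1 q.1.2 q.2 :=
    hF.mul hD.measurable_density
  have hint : Integrable fun q : (ℝ × ℝ) × ℝ => F q * f₃ q.1.1 q.1.2 q.2 := by
    rw [Measure.volume_eq_prod, integrable_prod_iff hH.aestronglyMeasurable]
    constructor
    · refine .of_forall fun x => ?_
      simp only [hFdef, mul_assoc]
      by_cases hx : ψ x = 0
      · simp [hx]
      · exact (hδ x (hnear x hx)).1.const_mul _
    · refine ((integrable_comp_rescale ha hb hφm hφ (t := t) (z := z)).norm.mul_const C).mono'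
        hH.aestronglyMeasurable.norm.integral_prod_right' (.of_forall fun x => ?_)
      rw [Real.norm_of_nonneg (integral_nonneg fun _ => norm_nonneg _)]
      simp only [hFdef, mul_assoc, norm_mul (ψ x), integral_const_mul]
      by_cases hx : ψ x = 0
      · have hx' : φ ((t - x.1) / a, (z - x.2) / b) = 0 := hx
        simp [hx, hx']
      · exact mul_le_mul_of_nonneg_left (hδ x (hnear x hx)).2 (norm_nonneg _)
  refine ⟨(hD.integrable_observation_iff i j hF).2 hint, ?_⟩
  refine (hD.integral_observation i j hF).trans ?_
  rw [Measure.volume_eq_prod, integral_prod _ (by rwa [← Measure.volume_eq_prod])]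
  have hG : Measurable fun s : ℝ × ℝ => φ s * ∫ y, γ y * f₃ (t - a * s.1) (z - b * s.2) y :=
    hφm.mul ((hD.measurable_integral_density hγ).comp
      (f := fun s : ℝ × ℝ => (t - a * s.1, z - b * s.2)) (by fun_prop))
  rw [← integral_comp_rescale ha hb hG (t := t) (z := z)]
  congr 1 with x
  have e1 : t - a * ((t - x.1) / a) = x.1 := by field_simp; ring
  have e2 : z - b * ((z - x.2) / b) = x.2 := by field_simp; ring
  simp only [hFdef, mul_assoc, integral_const_mul, e1, e2, hψ]

/-- The first-order behaviour of `E[φ ((t - T) / a, (z - Z) / b) γ(Y)]` as `a, b → 0`. -/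
theorem RandomDesign.tendsto_integral_localized (hD : RandomDesign P T Y Z f₃ f₅) {φ : ℝ × ℝ → ℝ}
    (hφm : Measurable φ) (hφ : Integrable φ) {R : ℝ} (hR : ∀ s, φ s ≠ 0 → ‖s‖ ≤ R)
    {γ : ℝ → ℝ} (hγ : Measurable γ) {t z δ C : ℝ} (hδ0 : 0 < δ)
    (hδ : ∀ x : ℝ × ℝ, dist x (t, z) < δ → Integrable (fun y => γ y * f₃ x.1 x.2 y) ∧
      ∫ y, |γ y * f₃ x.1 x.2 y| ≤ C)
    (hc : ContinuousAt (fun x : ℝ × ℝ => ∫ y, γ y * f₃ x.1 x.2 y) (t, z)) {a b : ℕ → ℝ}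
    (ha : ∀ n, 0 < a n) (hb : ∀ n, 0 < b n) (ha0 : Tendsto a atTop (𝓝 0))
    (hb0 : Tendsto b atTop (𝓝 0)) (i j : ℕ) :
    Tendsto (fun n => (∫ ω, φ ((t - T i j ω) / a n, (z - Z i ω) / b n) * γ (Y i j ω) ∂P) /
      (a n * b n)) atTop (𝓝 ((∫ s, φ s) * ∫ y, γ y * f₃ t z y)) := by
  have h1 : ∀ᶠ n in atTop, a n * R < δ :=
    (by simpa using ha0.mul_const R : Tendsto (fun n => a n * R) atTop (𝓝 0)).eventually_lt_const hδ0
  have h2 : ∀ᶠ n in atTop, b n * R < δ :=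
    (by simpa using hb0.mul_const R : Tendsto (fun n => b n * R) atTop (𝓝 0)).eventually_lt_const hδ0
  have hGm := hD.measurable_integral_density hγ
  have hlim : Tendsto (fun n => ∫ s : ℝ × ℝ, φ s *
      ∫ y, γ y * f₃ (t - a n * s.1) (z - b n * s.2) y) atTop
      (𝓝 (∫ s, φ s * ∫ y, γ y * f₃ t z y)) := by
    refine tendsto_integral_filter_of_dominated_convergence (fun s => ‖φ s‖ * C)
      (.of_forall fun n => (hφm.mul (hGm.comp
        (f := fun s : ℝ × ℝ => (t - a n * s.1, z - b n * s.2)) (by fun_prop))).aestronglyMeasurable)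
      ?_ (hφ.norm.mul_const C) (.of_forall fun s => ?_)
    · filter_upwards [h1, h2] with n hn1 hn2
      refine .of_forall fun s => ?_
      rw [norm_mul]
      by_cases hs : φ s = 0
      · simp [hs]
      refine mul_le_mul_of_nonneg_left ((norm_integral_le_integral_norm _).trans
        (hδ (t - a n * s.1, z - b n * s.2) ?_).2) (norm_nonneg _)
      have h := hR s hs
      rw [Prod.norm_def, max_le_iff] at h
      rw [Prod.dist_eq, max_lt_iff, Real.dist_eq, Real.dist_eq]
      simp only [sub_sub_cancel_left, abs_neg, abs_mul, abs_of_pos (ha n), abs_of_pos (hb n)]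
      exact ⟨(mul_le_mul_of_nonneg_left h.1 (ha n).le).trans_lt hn1,
        (mul_le_mul_of_nonneg_left h.2 (hb n).le).trans_lt hn2⟩
    · refine Tendsto.const_mul _ ?_
      have h3 : Tendsto (fun n => (t - a n * s.1, z - b n * s.2)) atTop (𝓝 (t, z)) := by
        have e1 := (ha0.mul_const s.1).const_sub t
        have e2 := (hb0.mul_const s.2).const_sub z
        simp only [zero_mul, sub_zero] at e1 e2
        exact e1.prodMk_nhds e2
      exact hc.tendsto.comp h3
  rw [integral_mul_const] at hlim
  refine hlim.congr' ?_
  filter_upwards [h1, h2] with n hn1 hn2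
  rw [(hD.integral_localized hφm hφ hR hγ hδ (ha n) (hb n) hn1 hn2 i j).2]
  have := (ha n).ne'
  have := (hb n).ne'
  field_simp

end

/-! ### Consequences of local regularity -/

section

variable {Ω : Type*} [MeasurableSpace Ω] {P : Measure Ω}
  {T Y : ℕ → ℕ → Ω → ℝ} {Z : ℕ → Ω → ℝ} {f₃ : ℝ → ℝ → ℝ → ℝ} {f₅ : ℝ → ℝ → ℝ → ℝ → ℝ → ℝ}
  {t z : ℝ}

theorem LocalRegularity.eventually_marginalDensity_pos (hreg : LocalRegularity f₃ f₅ t z) :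
    ∀ᶠ x : ℝ × ℝ in 𝓝 (t, z), 0 < marginalDensity f₃ x.1 x.2 :=
  hreg.f₂_smooth.continuousAt.eventually_const_lt hreg.f₂_pos

theorem LocalRegularity.eventually_integrable (hreg : LocalRegularity f₃ f₅ t z) :
    ∀ᶠ x : ℝ × ℝ in 𝓝 (t, z), Integrable (f₃ x.1 x.2) :=
  hreg.eventually_marginalDensity_pos.mono fun _ hx => by
    -- A section that is not integrable would have integral zero by convention, against positivity
    -- of f₂ near (t, z).
    by_contra h
    exact hx.ne' (integral_undef h)

theorem RandomDesign.eventually_integrable_mul (hD : RandomDesign P T Y Z f₃ f₅)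
    (hreg : LocalRegularity f₃ f₅ t z) {γ : ℝ → ℝ} (hγ : Measurable γ) {c : ℝ}
    (hc : ∀ y, |γ y| ≤ c * (1 + y ^ 2)) :
    ∀ᶠ x : ℝ × ℝ in 𝓝 (t, z), Integrable (fun y => γ y * f₃ x.1 x.2 y) ∧
      ∫ y, |γ y * f₃ x.1 x.2 y| ≤
        c * (marginalDensity f₃ x.1 x.2 + ∫ y, y ^ 2 * f₃ x.1 x.2 y) := by
  filter_upwards [hreg.eventually_integrable, hreg.secondMoment_finite] with x h0 h2
  have hdom : Integrable fun y => c * (f₃ x.1 x.2 y + y ^ 2 * f₃ x.1 x.2 y) :=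
    (h0.add h2).const_mul c
  have hle : ∀ y, |γ y * f₃ x.1 x.2 y| ≤ c * (f₃ x.1 x.2 y + y ^ 2 * f₃ x.1 x.2 y) := fun y => by
    rw [abs_mul, abs_of_nonneg (hD.f₃_nonneg _ _ _)]
    calc _ ≤ c * (1 + y ^ 2) * f₃ x.1 x.2 y :=
          mul_le_mul_of_nonneg_right (hc y) (hD.f₃_nonneg _ _ _)
      _ = _ := by ring
  have hint : Integrable fun y => γ y * f₃ x.1 x.2 y :=
    hdom.mono' (hγ.mul (hD.measurable_density_section x)).aestronglyMeasurable (.of_forall hle)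
  refine ⟨hint, (integral_mono hint.abs hdom hle).trans_eq ?_⟩
  rw [integral_const_mul, integral_add h0 h2]
  rfl

/-- At most quadratic growth bounds the integral by f₂ plus the second moment, both continuous at
(t, z) and therefore bounded nearby. -/
theorem RandomDesign.exists_ball_integrable_mul (hD : RandomDesign P T Y Z f₃ f₅)
    (hreg : LocalRegularity f₃ f₅ t z) {γ : ℝ → ℝ} (hγ : Measurable γ) {c : ℝ} (hc0 : 0 ≤ c)
    (hc : ∀ y, |γ y| ≤ c * (1 + y ^ 2)) :
    ∃ δ > 0, ∃ C, ∀ x : ℝ × ℝ, dist x (t, z) < δ → Integrable (fun y => γ y * f₃ x.1 x.2 y) ∧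
      ∫ y, |γ y * f₃ x.1 x.2 y| ≤ C := by
  have hcont : ContinuousAt (fun x : ℝ × ℝ =>
      marginalDensity f₃ x.1 x.2 + ∫ y, y ^ 2 * f₃ x.1 x.2 y) (t, z) :=
    hreg.f₂_smooth.continuousAt.add hreg.secondMoment_continuous
  obtain ⟨δ, hδ, h⟩ := Metric.eventually_nhds_iff.1
    ((hD.eventually_integrable_mul hreg hγ hc).and (hcont.eventually_le_const (lt_add_one _)))
  exact ⟨δ, hδ, _, fun x hx => ⟨(h hx).1.1, (h hx).1.2.trans (mul_le_mul_of_nonneg_left (h hx).2 hc0)⟩⟩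

theorem LocalRegularity.integral_mul_eventuallyEq (hreg : LocalRegularity f₃ f₅ t z) :
    (fun x : ℝ × ℝ => ∫ y, y * f₃ x.1 x.2 y) =ᶠ[𝓝 (t, z)]
      fun x => condMean f₃ x.1 x.2 * marginalDensity f₃ x.1 x.2 := by
  filter_upwards [hreg.eventually_marginalDensity_pos] with x hx
  rw [condMean, div_mul_cancel₀ _ hx.ne']

theorem abs_le_one_add_sq (y : ℝ) : |y| ≤ 1 * (1 + y ^ 2) := by
  rw [← sq_abs]; nlinarith [sq_nonneg (|y| - 1), abs_nonneg y]

theorem sub_sq_le_mul_one_add_sq (y m : ℝ) : (y - m) ^ 2 ≤ 2 * (1 + m ^ 2) * (1 + y ^ 2) := by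
  nlinarith [sq_nonneg (y + m), sq_nonneg (y * m), sq_nonneg m, sq_nonneg y]

theorem abs_sub_sq_le_mul_one_add_sq (y m : ℝ) :
    |(y - m) ^ 2| ≤ 2 * (1 + m ^ 2) * (1 + y ^ 2) := by
  rw [abs_of_nonneg (sq_nonneg _)]; exact sub_sq_le_mul_one_add_sq y m

theorem abs_sub_le_mul_one_add_sq (y m : ℝ) : |y - m| ≤ (1 + |m|) * (1 + y ^ 2) := by
  have h1 := abs_le_one_add_sq y
  have h2 := abs_sub y m
  nlinarith [abs_nonneg m, sq_nonneg y, mul_nonneg (abs_nonneg m) (sq_nonneg y)]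

/-- Expanding the square reduces continuity of this moment to that of the raw second moment, of μ
and of f₂. -/
theorem RandomDesign.eventually_integral_sub_sq_eq (hD : RandomDesign P T Y Z f₃ f₅)
    (hreg : LocalRegularity f₃ f₅ t z) (m : ℝ) :
    (fun x : ℝ × ℝ => ∫ y, (y - m) ^ 2 * f₃ x.1 x.2 y) =ᶠ[𝓝 (t, z)] fun x =>
      (∫ y, y ^ 2 * f₃ x.1 x.2 y) - 2 * m * (condMean f₃ x.1 x.2 * marginalDensity f₃ x.1 x.2)
        + m ^ 2 * marginalDensity f₃ x.1 x.2 := by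
  filter_upwards [hreg.eventually_integrable, hreg.secondMoment_finite,
    hreg.integral_mul_eventuallyEq,
    hD.eventually_integrable_mul hreg measurable_id abs_le_one_add_sq] with x h0 h2 he h1
  have h1' : Integrable fun y => 2 * m * (y * f₃ x.1 x.2 y) := h1.1.const_mul _
  have h21 : Integrable fun y => y ^ 2 * f₃ x.1 x.2 y - 2 * m * (y * f₃ x.1 x.2 y) := h2.sub h1'
  rw [← he]
  simp only [marginalDensity]
  rw [← integral_const_mul, ← integral_const_mul, ← integral_sub h2 h1',
    ← integral_add h21 (h0.const_mul _)]
  congr 1 with y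
  ring

theorem LocalRegularity.integral_sub_condMean_sq (hreg : LocalRegularity f₃ f₅ t z) :
    ∫ y, (y - condMean f₃ t z) ^ 2 * f₃ t z y = condVariance f₃ t z * marginalDensity f₃ t z := by
  rw [condVariance, div_mul_cancel₀ _ hreg.f₂_pos.ne']

theorem RandomDesign.continuousAt_integral_sub_sq (hD : RandomDesign P T Y Z f₃ f₅)
    (hreg : LocalRegularity f₃ f₅ t z) (m : ℝ) :
    ContinuousAt (fun x : ℝ × ℝ => ∫ y, (y - m) ^ 2 * f₃ x.1 x.2 y) (t, z) := by
  refine ContinuousAt.congr ?_ (hD.eventually_integral_sub_sq_eq hreg m).symm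
  have h2 := hreg.f₂_smooth.continuousAt
  exact ((hreg.secondMoment_continuous.sub
    ((hreg.mean_smooth.continuousAt.mul h2).const_mul (2 * m)))).add (h2.const_mul (m ^ 2))

/-- The second moment of `Y - m` beyond a truncation level, `f₃`-weighted, is continuous. -/
theorem RandomDesign.continuousAt_integral_tail (hD : RandomDesign P T Y Z f₃ f₅)
    (hreg : LocalRegularity f₃ f₅ t z) (m M : ℝ) :
    ContinuousAt (fun x : ℝ × ℝ => ∫ y, {y : ℝ | M < (y - m) ^ 2}.indicator
      (fun y => (y - m) ^ 2) y * f₃ x.1 x.2 y) (t, z) := by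
  have mS : MeasurableSet {y : ℝ | M < (y - m) ^ 2} := measurableSet_lt (by fun_prop) (by fun_prop)
  set S := {y : ℝ | M < (y - m) ^ 2} with hS
  -- The complementary weight lives on a bounded interval, hence is integrable, and continuity of f₃
  -- uniform in y makes its integral continuous. The tail is the full second moment minus this part.
  set β : ℝ → ℝ := Sᶜ.indicator fun y => (y - m) ^ 2 with hβ
  have hβm : Measurable β := (by fun_prop : Measurable fun y : ℝ => (y - m) ^ 2).indicator mS.compl
  have hβ0 : ∀ y, 0 ≤ β y := fun y => Set.indicator_nonneg (fun y _ => sq_nonneg _) y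
  have hβsq : ∀ y, β y ≤ (y - m) ^ 2 := fun y => Set.indicator_le_self' (fun y _ => sq_nonneg _) y
  have hβi : Integrable β := by
    have hsub : Sᶜ ⊆ Metric.closedBall m (√|M|) := fun y hy => by
      rw [Metric.mem_closedBall, Real.dist_eq]
      have : (y - m) ^ 2 ≤ M := not_lt.1 hy
      exact Real.abs_le_sqrt (this.trans (le_abs_self M))
    rw [hβ, integrable_indicator_iff mS.compl]
    exact ((by fun_prop : Continuous fun y : ℝ => (y - m) ^ 2).continuousOn.integrableOn_compact
      (isCompact_closedBall _ _)).mono_set hsub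
  have hbulk : ContinuousAt (fun x : ℝ × ℝ => ∫ y, β y * f₃ x.1 x.2 y) (t, z) := by
    have hev := hD.eventually_integrable_mul hreg hβm (c := 2 * (1 + m ^ 2)) fun y => by
      rw [abs_of_nonneg (hβ0 y)]
      exact (hβsq y).trans (sub_sq_le_mul_one_add_sq y m)
    refine Metric.tendsto_nhds.2 fun ε hε => ?_
    set B := ∫ y, β y with hB
    have hB0 : 0 ≤ B := integral_nonneg hβ0
    filter_upwards [hev, hreg.f₃_continuous (ε / (B + 1)) (by positivity)] with x hx hcx
    rw [Real.dist_eq, ← integral_sub hx.1 hev.self_of_nhds.1]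
    have h1 : ∀ y, ‖β y * f₃ x.1 x.2 y - β y * f₃ t z y‖ ≤ ε / (B + 1) * β y := fun y => by
      rw [← mul_sub, norm_mul, Real.norm_of_nonneg (hβ0 y), mul_comm]
      exact mul_le_mul_of_nonneg_right (hcx y).le (hβ0 y)
    have h2 := norm_integral_le_of_norm_le (hβi.const_mul _) (.of_forall h1)
    rw [integral_const_mul] at h2
    refine lt_of_le_of_lt h2 ?_
    rw [div_mul_eq_mul_div, div_lt_iff₀ (by positivity)]
    nlinarith
  refine ((hD.continuousAt_integral_sub_sq hreg m).sub hbulk).congr ?_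
  filter_upwards [hD.eventually_integrable_mul hreg (γ := fun y => (y - m) ^ 2) (by fun_prop)
    (fun y => abs_sub_sq_le_mul_one_add_sq y m),
    hD.eventually_integrable_mul hreg hβm (c := 2 * (1 + m ^ 2)) fun y => by
      rw [abs_of_nonneg (hβ0 y)]
      exact (hβsq y).trans (sub_sq_le_mul_one_add_sq y m)] with x h1 h2
  dsimp only [Pi.sub_apply]
  rw [← integral_sub h1.1 h2.1]
  congr 1 with y
  by_cases hy : y ∈ S <;> simp [hβ, hy]

theorem tendsto_integral_indicator_lt_atTop {α : Type*} [MeasurableSpace α] {ν : Measure α}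
    {u F : α → ℝ} (hu : Measurable u) (hF : Integrable F ν) :
    Tendsto (fun M : ℕ => ∫ x, {x | (M : ℝ) < u x}.indicator F x ∂ν) atTop (𝓝 0) := by
  have h0 : (0 : ℝ) = ∫ _x : α, (0 : ℝ) ∂ν := by simp
  rw [h0]
  refine tendsto_integral_filter_of_dominated_convergence (fun x => ‖F x‖)
    (.of_forall fun M => hF.1.indicator (measurableSet_lt measurable_const hu))
    (.of_forall fun M => .of_forall fun x => norm_indicator_le_norm_self F x) hF.norm
    (.of_forall fun x => ?_)
  obtain ⟨M₀, hM₀⟩ := exists_nat_ge (u x)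
  refine tendsto_const_nhds.congr' ?_
  filter_upwards [eventually_ge_atTop M₀] with M hM
  rw [Set.indicator_of_notMem]
  simp only [Set.mem_ofPred_eq, not_lt]
  exact hM₀.trans (by exact_mod_cast hM)

theorem RandomDesign.integral_observation_eq (hD : RandomDesign P T Y Z f₃ f₅) (i j i' j' : ℕ)
    {F : (ℝ × ℝ) × ℝ → ℝ} (hF : Measurable F) :
    ∫ ω, F ((T i j ω, Z i ω), Y i j ω) ∂P = ∫ ω, F ((T i' j' ω, Z i' ω), Y i' j' ω) ∂P := by
  rw [hD.integral_observation i j hF, hD.integral_observation i' j' hF]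

variable {K : ℝ × ℝ → ℝ}

/-- The second moment of `K ((t - T) / a, (z - Z) / b) (Y - m)` beyond a high truncation level is a
small fraction of `a b`. -/
theorem RandomDesign.exists_truncation_level (hD : RandomDesign P T Y Z f₃ f₅)
    (hreg : LocalRegularity f₃ f₅ t z) (hK : IsSecondOrderKernel K) (m : ℝ) {a b : ℕ → ℝ}
    (ha : ∀ n, 0 < a n) (hb : ∀ n, 0 < b n) (ha0 : Tendsto a atTop (𝓝 0))
    (hb0 : Tendsto b atTop (𝓝 0)) {ε : ℝ} (hε : 0 < ε) :
    ∃ M : ℝ, 0 ≤ M ∧ ∀ᶠ n in atTop, ∀ i j,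
      ∫ ω, {y : ℝ | M < y ^ 2}.indicator (fun y => y ^ 2)
        (K ((t - T i j ω) / a n, (z - Z i ω) / b n) * (Y i j ω - m)) ∂P ≤ ε * (a n * b n) := by
  have hKm := hK.measurable
  have hK2 : Integrable fun s => K s ^ 2 := hK.memLp_two.integrable_sq
  obtain ⟨R, hR, hKR⟩ := hK.hasCompactSupport.exists_pos_forall_norm_le
  have hγm : Measurable fun y : ℝ => (y - m) ^ 2 := by fun_prop
  set V := ∫ y, (y - m) ^ 2 * f₃ t z y with hV
  set k2 := ∫ s, K s ^ 2 with hk2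
  set φ : ℕ → ℝ × ℝ → ℝ := fun M => {s | (M : ℝ) < K s ^ 2}.indicator fun s => K s ^ 2 with hφ
  set γ : ℕ → ℝ → ℝ := fun M => {y : ℝ | (M : ℝ) < (y - m) ^ 2}.indicator fun y => (y - m) ^ 2
    with hγ
  have hVi := (hD.eventually_integrable_mul hreg hγm
    (fun y => abs_sub_sq_le_mul_one_add_sq y m)).self_of_nhds.1
  have l1 : Tendsto (fun M => (∫ s, φ M s) * V) atTop (𝓝 0) := by
    simpa using (tendsto_integral_indicator_lt_atTop (hKm.pow_const 2) hK2).mul_const V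
  have l2 : Tendsto (fun M => k2 * ∫ y, γ M y * f₃ t z y) atTop (𝓝 0) := by
    have := (tendsto_integral_indicator_lt_atTop hγm hVi).const_mul k2
    rw [mul_zero] at this
    refine this.congr fun M => ?_
    congr 2 with y
    by_cases hy : (M : ℝ) < (y - m) ^ 2 <;> simp [hγ, hy]
  have l12 := l1.add l2
  rw [add_zero] at l12
  -- The level is fixed from the limits at (t, z) alone, before n enters. Convergence of the
  -- localized moments then transfers the bound to all large n.
  obtain ⟨M, hM⟩ := (l12.eventually_lt_const hε).exists
  have hφm : Measurable (φ M) := (hKm.pow_const 2).indicator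
    (measurableSet_lt measurable_const (hKm.pow_const 2))
  have hφ0 : ∀ s, 0 ≤ φ M s := fun s => Set.indicator_nonneg (fun s _ => sq_nonneg _) s
  have hφi : Integrable (φ M) := hK2.indicator (measurableSet_lt measurable_const (hKm.pow_const 2))
  have hφR : ∀ s, φ M s ≠ 0 → ‖s‖ ≤ R := fun s hs => hKR s fun h => hs (by simp [hφ, h])
  have hKR2 : ∀ s, K s ^ 2 ≠ 0 → ‖s‖ ≤ R := fun s hs => hKR s (pow_ne_zero_iff two_ne_zero |>.1 hs)
  have hγMm : Measurable (γ M) := hγm.indicator (measurableSet_lt measurable_const hγm)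
  have hγ0 : ∀ y, 0 ≤ γ M y := fun s => Set.indicator_nonneg (fun s _ => sq_nonneg _) s
  have hγle : ∀ y, γ M y ≤ (y - m) ^ 2 := fun y => Set.indicator_le_self' (fun _ _ => sq_nonneg _) y
  obtain ⟨δ₁, hδ₁, C₁, h₁⟩ := hD.exists_ball_integrable_mul hreg hγm (by positivity)
    (fun y => abs_sub_sq_le_mul_one_add_sq y m)
  obtain ⟨δ₂, hδ₂, C₂, h₂⟩ := hD.exists_ball_integrable_mul hreg hγMm
    (c := 2 * (1 + m ^ 2)) (by positivity) (fun y => by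
      rw [abs_of_nonneg (hγ0 y)]; exact (hγle y).trans (sub_sq_le_mul_one_add_sq y m))
  have t1 := hD.tendsto_integral_localized hφm hφi hφR hγm hδ₁ h₁
    (hD.continuousAt_integral_sub_sq hreg m) ha hb ha0 hb0 0 0
  have t2 := hD.tendsto_integral_localized (hKm.pow_const 2) hK2 hKR2 hγMm hδ₂ h₂
    (hD.continuousAt_integral_tail hreg m M) ha hb ha0 hb0 0 0
  have haR : ∀ δ > 0, ∀ᶠ n in atTop, a n * R < δ := fun δ hδ =>
    (by simpa using ha0.mul_const R : Tendsto (fun n => a n * R) atTop (𝓝 0)).eventually_lt_const hδ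
  have hbR : ∀ δ > 0, ∀ᶠ n in atTop, b n * R < δ := fun δ hδ =>
    (by simpa using hb0.mul_const R : Tendsto (fun n => b n * R) atTop (𝓝 0)).eventually_lt_const hδ
  -- The level is squared because K² (y - m)² > M² forces K² > M or (y - m)² > M, which separates
  -- the tail into two localized moments of product form.
  refine ⟨(M : ℝ) ^ 2, by positivity, ?_⟩
  filter_upwards [(t1.add t2).eventually_lt_const hM, haR _ hδ₁, haR _ hδ₂, hbR _ hδ₁, hbR _ hδ₂]
    with n hn a1 a2 b1 b2 i j
  have hFm : Measurable fun q : (ℝ × ℝ) × ℝ => {y : ℝ | (M : ℝ) ^ 2 < y ^ 2}.indicator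
      (fun y => y ^ 2) (K ((t - q.1.1) / a n, (z - q.1.2) / b n) * (q.2 - m)) :=
    (measurable_indicator_sq_comp (measurableSet_lt_sq _)).comp
      ((hKm.comp (by fun_prop)).mul (by fun_prop))
  rw [hD.integral_observation_eq i j 0 0 hFm]
  have i1 := (hD.integral_localized hφm hφi hφR hγm h₁ (ha n) (hb n) a1 b1 0 0).1
  have i2 := (hD.integral_localized (hKm.pow_const 2) hK2 hKR2 hγMm h₂ (ha n) (hb n) a2 b2 0 0).1
  rw [← add_div, div_lt_iff₀ (mul_pos (ha n) (hb n)), ← integral_add i1 i2] at hn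
  refine le_trans (integral_mono_of_nonneg (.of_forall fun ω =>
    Set.indicator_nonneg (fun y _ => sq_nonneg y) _) (i1.add i2) (.of_forall fun ω => ?_)) hn.le
  dsimp only [Pi.add_apply]
  set s := ((t - T 0 0 ω) / a n, (z - Z 0 ω) / b n)
  set y := Y 0 0 ω
  by_cases hlarge : (M : ℝ) ^ 2 < (K s * (y - m)) ^ 2
  · rw [Set.indicator_of_mem (by simpa using hlarge)]
    have hor : (M : ℝ) < K s ^ 2 ∨ (M : ℝ) < (y - m) ^ 2 := by
      by_contra! hcon
      rw [mul_pow] at hlarge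
      have : K s ^ 2 * (y - m) ^ 2 ≤ M * M :=
        mul_le_mul hcon.1 hcon.2 (sq_nonneg _) (Nat.cast_nonneg _)
      nlinarith
    rw [mul_pow]
    rcases hor with h | h
    · have e : φ M s = K s ^ 2 := Set.indicator_of_mem (by simpa using h) _
      rw [e]
      exact le_add_of_nonneg_right (mul_nonneg (sq_nonneg _) (hγ0 y))
    · have e : γ M y = (y - m) ^ 2 := Set.indicator_of_mem (by simpa using h) _
      rw [e]
      exact le_add_of_nonneg_left (mul_nonneg (hφ0 s) (sq_nonneg _))
  · rw [Set.indicator_of_notMem (by simpa using hlarge)]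
    exact add_nonneg (mul_nonneg (hφ0 s) (sq_nonneg _)) (mul_nonneg (sq_nonneg _) (hγ0 y))

variable [IsProbabilityMeasure P]

/-- Each observation time has a bounded density near `t`. -/
theorem RandomDesign.exists_measureReal_time_le (hD : RandomDesign P T Y Z f₃ f₅)
    (hreg : LocalRegularity f₃ f₅ t z) :
    ∃ δ > 0, ∃ C, 0 ≤ C ∧ ∀ i k, ∀ r, 0 < r → r < δ →
      P.real (T i k ⁻¹' Metric.closedBall t r) ≤ C * r := by
  -- The plane carries the sup norm, so this ball is a square and φ localizes T and Z to intervals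
  -- separately.
  set φ : ℝ × ℝ → ℝ := (Metric.closedBall 0 1).indicator fun _ => 1 with hφ
  have hφm : Measurable φ := measurable_const.indicator Metric.isClosed_closedBall.measurableSet
  have hφi : Integrable φ := by
    rw [hφ, integrable_indicator_iff Metric.isClosed_closedBall.measurableSet]
    exact integrableOn_const (by exact (isCompact_closedBall _ _).measure_lt_top.ne) (by simp)
  have hφR : ∀ s, φ s ≠ 0 → ‖s‖ ≤ 1 := fun s hs => by
    by_contra h
    exact hs (Set.indicator_of_notMem (by simpa using h) _)
  have hφ0 : ∀ s, 0 ≤ φ s := fun s => Set.indicator_nonneg (fun _ _ => zero_le_one) s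
  have hφpos : 0 < ∫ s, φ s := by
    have hval : ∫ s, φ s = volume.real (Metric.closedBall (0 : ℝ × ℝ) 1) :=
      integral_indicator_one Metric.isClosed_closedBall.measurableSet
    rw [hval]
    exact ENNReal.toReal_pos (Metric.measure_closedBall_pos _ _ one_pos).ne'
      (isCompact_closedBall _ _).measure_lt_top.ne
  obtain ⟨δ, hδ, C, h⟩ := hD.exists_ball_integrable_mul hreg (γ := fun _ => 1) measurable_const
    (c := 1) zero_le_one (fun y => by simp; positivity)
  have hcont : ContinuousAt (fun x : ℝ × ℝ => ∫ y, 1 * f₃ x.1 x.2 y) (t, z) := by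
    simpa [marginalDensity] using hreg.f₂_smooth.continuousAt
  have hseq : Tendsto (fun n : ℕ => 1 / ((n : ℝ) + 1)) atTop (𝓝 0) :=
    tendsto_one_div_add_atTop_nhds_zero_nat
  have hseq0 : ∀ n : ℕ, 0 < 1 / ((n : ℝ) + 1) := fun n => by positivity
  have hlim := hD.tendsto_integral_localized hφm hφi hφR measurable_const hδ h hcont hseq0 hseq0
    hseq hseq 0 0
  have hlimpos : 0 < (∫ s, φ s) * ∫ y, 1 * f₃ t z y :=
    mul_pos hφpos (by simpa [marginalDensity] using hreg.f₂_pos)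
  -- A fixed width b is chosen at which the interval J around z has positive probability. The
  -- density is controlled only near (t, z), so the bound for T alone comes from P(T ∈ B) = P(T ∈ B,
  -- Z ∈ J) / P(Z ∈ J), by independence of T and Z.
  obtain ⟨n, hn1, hn2⟩ := ((hlim.eventually_const_lt hlimpos).and
    (hseq.eventually_lt_const hδ)).exists
  set b := 1 / ((n : ℝ) + 1) with hb
  have hb0 : 0 < b := hseq0 n
  set J := Metric.closedBall z b with hJ
  have mJ : MeasurableSet J := Metric.isClosed_closedBall.measurableSet
  have hbox : ∀ (r : ℝ), 0 < r → ∀ k ω, φ ((t - T 0 k ω) / r, (z - Z 0 ω) / b) * 1 =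
      (T 0 k ⁻¹' Metric.closedBall t r ∩ Z 0 ⁻¹' J).indicator (fun _ => 1) ω := by
    intro r hr k ω
    have hiff : ((t - T 0 k ω) / r, (z - Z 0 ω) / b) ∈ Metric.closedBall (0 : ℝ × ℝ) 1 ↔
        ω ∈ T 0 k ⁻¹' Metric.closedBall t r ∩ Z 0 ⁻¹' J := by
      rw [mem_closedBall_zero_iff, Prod.norm_def, max_le_iff, Real.norm_eq_abs, Real.norm_eq_abs,
        abs_div, abs_div, abs_of_pos hr, abs_of_pos hb0, div_le_one hr, div_le_one hb0,
        Set.mem_inter_iff, Set.mem_preimage, Set.mem_preimage, hJ, Metric.mem_closedBall',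
        Metric.mem_closedBall', Real.dist_eq, Real.dist_eq]
    rw [mul_one, hφ]
    by_cases h : ω ∈ T 0 k ⁻¹' Metric.closedBall t r ∩ Z 0 ⁻¹' J
    · rw [Set.indicator_of_mem (hiff.2 h), Set.indicator_of_mem h]
    · rw [Set.indicator_of_notMem (fun h' => h (hiff.1 h')), Set.indicator_of_notMem h]
  have mT : ∀ k r, MeasurableSet (T 0 k ⁻¹' Metric.closedBall t r) := fun k r =>
    hD.measurable_T 0 k Metric.isClosed_closedBall.measurableSet
  have mZ : MeasurableSet (Z 0 ⁻¹' J) := hD.measurable_Z 0 mJ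
  have hZpos : 0 < P.real (Z 0 ⁻¹' J) := by
    have h1 : 0 < ∫ ω, φ ((t - T 0 0 ω) / b, (z - Z 0 ω) / b) * 1 ∂P := by
      by_contra hneg
      exact absurd hn1 (not_lt.2 (div_nonpos_of_nonpos_of_nonneg (not_lt.1 hneg) (by positivity)))
    simp_rw [hbox b hb0] at h1
    have h2 : ∫ ω, (T 0 0 ⁻¹' Metric.closedBall t b ∩ Z 0 ⁻¹' J).indicator (fun _ => (1 : ℝ)) ω ∂P
        = P.real (T 0 0 ⁻¹' Metric.closedBall t b ∩ Z 0 ⁻¹' J) :=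
      integral_indicator_one ((mT 0 b).inter mZ)
    rw [h2] at h1
    exact h1.trans_le (measureReal_mono Set.inter_subset_right)
  have hC0 : 0 ≤ C := (integral_nonneg fun _ => abs_nonneg _).trans
    (h (t, z) (by simpa using hδ)).2
  refine ⟨δ, hδ, b * ((∫ s, φ s) * C) / P.real (Z 0 ⁻¹' J), by positivity, fun i k r hr hrδ => ?_⟩
  -- All times have the same law. Index 1 is used because `RandomDesign.indepFun_time` separates it
  -- from the observation with index 0, which contains Z.
  have hlaw : P.real (T i k ⁻¹' Metric.closedBall t r) =
      P.real (T 0 1 ⁻¹' Metric.closedBall t r) := by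
    have mB : MeasurableSet (Metric.closedBall t r) := Metric.isClosed_closedBall.measurableSet
    have e := hD.integral_observation_eq i k 0 1
      (F := fun q => (Metric.closedBall t r).indicator (fun _ => 1) q.1.1)
      ((measurable_const.indicator mB).comp (by fun_prop))
    have e1 : ∀ i k, ∫ ω, (Metric.closedBall t r).indicator (fun _ => (1 : ℝ)) (T i k ω) ∂P =
        P.real (T i k ⁻¹' Metric.closedBall t r) := fun i k =>
      integral_indicator_one (hD.measurable_T i k mB)
    rw [← e1, ← e1]
    exact e
  rw [hlaw, div_mul_eq_mul_div, le_div_iff₀ hZpos]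
  have hind : P.real (T 0 1 ⁻¹' Metric.closedBall t r ∩ Z 0 ⁻¹' J) =
      P.real (T 0 1 ⁻¹' Metric.closedBall t r) * P.real (Z 0 ⁻¹' J) := by
    have h1 : IndepFun (T 0 1) (Z 0) P :=
      ((hD.indepFun_time 0 (j := 0) (k := 1) (by norm_num)).comp
        (φ := fun q : ℝ × ℝ × ℝ => q.2.1) (ψ := id) (by fun_prop) measurable_id).symm
    rw [measureReal_def, indepFun_iff_measure_inter_preimage_eq_mul.1 h1 _ _
      Metric.isClosed_closedBall.measurableSet mJ, ENNReal.toReal_mul]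
    rfl
  rw [← hind]
  have hval := (hD.integral_localized hφm hφi hφR measurable_const h hr hb0 (by simpa using hrδ)
    (by simpa using hn2) 0 1).2
  simp_rw [hbox r hr] at hval
  have h2 : ∫ ω, (T 0 1 ⁻¹' Metric.closedBall t r ∩ Z 0 ⁻¹' J).indicator (fun _ => (1 : ℝ)) ω ∂P
      = P.real (T 0 1 ⁻¹' Metric.closedBall t r ∩ Z 0 ⁻¹' J) :=
    integral_indicator_one ((mT 1 r).inter mZ)
  rw [h2] at hval
  rw [hval]
  have h3 : ∫ s : ℝ × ℝ, φ s * ∫ y, 1 * f₃ (t - r * s.1) (z - b * s.2) y ≤ ∫ s, φ s * C := by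
    refine integral_mono_of_nonneg (.of_forall fun s => mul_nonneg (hφ0 s)
      (integral_nonneg fun y => by simpa using hD.f₃_nonneg _ _ y)) (hφi.mul_const C)
      (.of_forall fun s => ?_)
    by_cases hs : φ s = 0
    · simp [hs]
    refine mul_le_mul_of_nonneg_left ((le_abs_self _).trans (abs_integral_le_integral_abs.trans
      (h (t - r * s.1, z - b * s.2) ?_).2)) (hφ0 s)
    have h := hφR s hs
    rw [Prod.norm_def, max_le_iff] at h
    rw [Prod.dist_eq, max_lt_iff, Real.dist_eq, Real.dist_eq]
    simp only [sub_sub_cancel_left, abs_neg, abs_mul, abs_of_pos hr, abs_of_pos hb0]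
    exact ⟨(mul_le_of_le_one_right hr.le h.1).trans_lt hrδ,
      (mul_le_of_le_one_right hb0.le h.2).trans_lt hn2⟩
  rw [integral_mul_const] at h3
  calc r * b * ∫ s : ℝ × ℝ, φ s * ∫ y, 1 * f₃ (t - r * s.1) (z - b * s.2) y
      ≤ r * b * ((∫ s, φ s) * C) := by gcongr
    _ = _ := by ring

/-- Cross moments of two observations of a subject: both times have to be close to `t`. -/
theorem RandomDesign.integral_abs_mul_le (hD : RandomDesign P T Y Z f₃ f₅) {R a b m v : ℝ}
    (hKm : Measurable K) (hKR : ∀ s, K s ≠ 0 → ‖s‖ ≤ R) (ha : 0 < a) (i : ℕ)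
    (hL2 : ∀ j, MemLp (fun ω => K ((t - T i j ω) / a, (z - Z i ω) / b) * (Y i j ω - m)) 2 P)
    (hv : ∀ j, ∫ ω, (K ((t - T i j ω) / a, (z - Z i ω) / b) * (Y i j ω - m)) ^ 2 ∂P = v) {p : ℝ}
    (hp : ∀ j, P.real (T i j ⁻¹' Metric.closedBall t (R * a)) ≤ p) {j k : ℕ} (hjk : j ≠ k) :
    ∫ ω, |(K ((t - T i j ω) / a, (z - Z i ω) / b) * (Y i j ω - m)) *
      (K ((t - T i k ω) / a, (z - Z i ω) / b) * (Y i k ω - m))| ∂P ≤ v * p := by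
  set ξ : ℕ → Ω → ℝ := fun j ω => K ((t - T i j ω) / a, (z - Z i ω) / b) * (Y i j ω - m) with hξ
  set B := Metric.closedBall t (R * a) with hB
  have mB : MeasurableSet B := Metric.isClosed_closedBall.measurableSet
  set e : ℕ → Ω → ℝ := fun j ω => B.indicator (fun _ => 1) (T i j ω) with he
  have hv0 : 0 ≤ v := by rw [← hv 0]; exact integral_nonneg fun _ => sq_nonneg _
  have hsupp : ∀ j ω, ξ j ω ≠ 0 → e j ω = 1 := by
    intro j ω h
    have h1 := (norm_fst_le _).trans (hKR _ (left_ne_zero_of_mul h))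
    refine Set.indicator_of_mem ?_ _
    rw [hB, Metric.mem_closedBall, dist_comm, Real.dist_eq]
    rwa [Real.norm_eq_abs, abs_div, abs_of_pos ha, div_le_iff₀ ha] at h1
  have heL : ∀ j, Measurable (e j) := fun j =>
    (measurable_const.indicator mB).comp (hD.measurable_T i j)
  have hmul : ∀ j k, j ≠ k → Integrable (fun ω => ξ j ω ^ 2 * e k ω) P ∧
      ∫ ω, ξ j ω ^ 2 * e k ω ∂P ≤ v * p := by
    intro j k hjk
    have hind : IndepFun (fun ω => ξ j ω ^ 2) (e k) P :=
      (hD.indepFun_time i hjk).comp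
        (φ := fun q : ℝ × ℝ × ℝ => (K ((t - q.1) / a, (z - q.2.1) / b) * (q.2.2 - m)) ^ 2)
        (ψ := B.indicator fun _ => 1)
        (((hKm.comp (by fun_prop)).mul (by fun_prop)).pow_const 2) (measurable_const.indicator mB)
    have hei : ∫ ω, e k ω ∂P = P.real (T i k ⁻¹' B) :=
      integral_indicator_one (hD.measurable_T i k mB)
    constructor
    · refine (hL2 j).integrable_sq.mono' ((hL2 j).integrable_sq.1.mul
        (heL k).aestronglyMeasurable) (.of_forall fun ω => ?_)
      rw [norm_mul, norm_pow, Real.norm_eq_abs, sq_abs]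
      refine mul_le_of_le_one_right (sq_nonneg _) ?_
      by_cases h : T i k ω ∈ B <;> simp [he, h]
    · rw [hind.integral_fun_mul_eq_mul_integral (hL2 j).integrable_sq.1
        (heL k).aestronglyMeasurable, hei]
      exact mul_le_mul (hv j).le (hp k) measureReal_nonneg hv0
  obtain ⟨i1, l1⟩ := hmul j k hjk
  obtain ⟨i2, l2⟩ := hmul k j hjk.symm
  calc ∫ ω, |ξ j ω * ξ k ω| ∂P
      -- Where the product is nonzero both times lie in B, so both indicators equal one and 2|xy| ≤
      -- x² + y² applies. Each resulting product has independent factors.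
      ≤ ∫ ω, 1 / 2 * (ξ j ω ^ 2 * e k ω + ξ k ω ^ 2 * e j ω) ∂P := by
        refine integral_mono ((hL2 j).integrable_mul (hL2 k)).abs ((i1.add i2).const_mul _)
          fun ω => ?_
        change |ξ j ω * ξ k ω| ≤ 1 / 2 * (ξ j ω ^ 2 * e k ω + ξ k ω ^ 2 * e j ω)
        have he0 : ∀ j, 0 ≤ e j ω := fun j => Set.indicator_nonneg (fun _ _ => zero_le_one) _
        by_cases hj : ξ j ω = 0
        · rw [hj]; simp; exact mul_nonneg (sq_nonneg _) (he0 j)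
        by_cases hk : ξ k ω = 0
        · rw [hk]; simp; exact mul_nonneg (sq_nonneg _) (he0 k)
        rw [hsupp j ω hj, hsupp k ω hk, abs_mul, ← sq_abs (ξ j ω), ← sq_abs (ξ k ω)]
        nlinarith [sq_nonneg (|ξ j ω| - |ξ k ω|)]
    _ ≤ v * p := by
        rw [integral_const_mul, integral_add i1 i2]
        linarith

end

/-! ### Bandwidths -/

section Bandwidth

variable {EN ht hz h : ℕ → ℝ} {ρ τ : ℝ}

theorem BandwidthConditions.tendsto_ht (hb : BandwidthConditions EN ht hz h) :
    Tendsto ht atTop (𝓝 0) := hb.ht_order.1.trans_tendsto hb.h_tendsto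

theorem BandwidthConditions.tendsto_hz (hb : BandwidthConditions EN ht hz h) :
    Tendsto hz atTop (𝓝 0) := hb.hz_order.1.trans_tendsto hb.h_tendsto

theorem BandwidthConditions.tendsto_mul_ht (hb : BandwidthConditions EN ht hz h) :
    Tendsto (fun n => EN n * ht n) atTop (𝓝 0) :=
  ((isBigO_refl EN atTop).mul hb.ht_order.1).trans_tendsto hb.sparse

/-- The quantity is the product of E(N) a, a³, the inverse of n E(N) a⁶ and the inverse of b/a; the
first two factors vanish and the others stay bounded. -/
theorem BandwidthConditions.tendsto_one_div (hb : BandwidthConditions EN ht hz h)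
    (hEN : ∀ n, 0 < EN n) (hρ : 0 < ρ) (hτ : 0 < τ)
    (hratio : Tendsto (fun n => hz n / ht n) atTop (𝓝 ρ))
    (hrate : Tendsto (fun n : ℕ => n * EN n * ht n ^ 6) atTop (𝓝 (τ ^ 2))) :
    Tendsto (fun n : ℕ => 1 / (n * (ht n * hz n))) atTop (𝓝 0) := by
  have h1 := ((hb.tendsto_mul_ht.mul (hb.tendsto_ht.pow 3)).mul
    (hrate.inv₀ (by positivity))).mul (hratio.inv₀ hρ.ne')
  simp only [zero_mul] at h1
  refine h1.congr' ?_
  filter_upwards [eventually_gt_atTop 0] with n hn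
  have e1 := (hEN n).ne'
  have e2 := (hb.ht_pos n).ne'
  have e3 := (hb.hz_pos n).ne'
  have e4 : (n : ℝ) ≠ 0 := by exact_mod_cast hn.ne'
  field_simp

/-- The square of the left side is n E(N) a⁶ times b/a. This is the scale at which the squared
bandwidth survives as a bias. -/
theorem BandwidthConditions.tendsto_sqrt_mul (hb : BandwidthConditions EN ht hz h) (hτ : 0 < τ)
    (hratio : Tendsto (fun n => hz n / ht n) atTop (𝓝 ρ))
    (hrate : Tendsto (fun n : ℕ => n * EN n * ht n ^ 6) atTop (𝓝 (τ ^ 2))) :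
    Tendsto (fun n : ℕ => √(n * EN n * (ht n * hz n)) * ht n ^ 2) atTop (𝓝 (τ * √ρ)) := by
  have h1 := (hrate.mul hratio).sqrt
  rw [Real.sqrt_mul (sq_nonneg τ), Real.sqrt_sq hτ.le] at h1
  refine h1.congr fun n => ?_
  have e2 := hb.ht_pos n
  rw [← Real.sqrt_sq (sq_nonneg (ht n)), ← Real.sqrt_mul' _ (sq_nonneg _)]
  congr 1
  field_simp

end Bandwidth

theorem Filter.IsBoundedUnder.mul_tendsto_zero {u w : ℕ → ℝ}
    (hu : IsBoundedUnder (· ≤ ·) atTop u) (hu0 : ∀ n, 0 ≤ u n) (hw : Tendsto w atTop (𝓝 0)) :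
    Tendsto (fun n => u n * w n) atTop (𝓝 0) := by
  obtain ⟨C, hC⟩ := hu
  rw [eventually_map] at hC
  refine squeeze_zero_norm' ?_ (by simpa using hw.norm.const_mul C)
  filter_upwards [hC] with n hn
  rw [norm_mul, Real.norm_of_nonneg (hu0 n)]
  exact mul_le_mul_of_nonneg_right hn (norm_nonneg _)

/-! ### Moments of the counts and the law of large numbers for their average. -/

section Counts

variable {Ω : Type*} [MeasurableSpace Ω] {P : Measure Ω}
  {T Y : ℕ → ℕ → Ω → ℝ} {Z : ℕ → Ω → ℝ} {N : (n : ℕ) → Fin n → Ω → ℕ} {N₀ : ℕ → Ω → ℕ}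

theorem RandomCounts.integrable_pow₀ (hC : RandomCounts P T Y Z N N₀) (n : ℕ) {p : ℕ}
    (hp : p ≤ 4) : Integrable (fun ω => (N₀ n ω : ℝ) ^ p) P := by
  refine (hC.integrable_fourth n).mono' (((measurable_of_countable (fun k : ℕ => (k : ℝ) ^ p)).comp
    (hC.measurable_N₀ n)).aestronglyMeasurable) (.of_forall fun ω => ?_)
  rw [Real.norm_of_nonneg (by positivity)]
  -- Counts are at least one, so the fourth power dominates the lower ones.
  exact pow_le_pow_right₀ (by exact_mod_cast hC.N₀_pos n ω) hp

theorem RandomCounts.identDistrib_pow (hC : RandomCounts P T Y Z N N₀) (n : ℕ) (i : Fin n) (p : ℕ) :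
    IdentDistrib (fun ω => (N n i ω : ℝ) ^ p) (fun ω => (N₀ n ω : ℝ) ^ p) P P :=
  (hC.identDistrib n i).comp (measurable_of_countable fun k : ℕ => (k : ℝ) ^ p)

theorem RandomCounts.integrable_pow (hC : RandomCounts P T Y Z N N₀) (n : ℕ) (i : Fin n) {p : ℕ}
    (hp : p ≤ 4) : Integrable (fun ω => (N n i ω : ℝ) ^ p) P :=
  (hC.identDistrib_pow n i p).integrable_iff.2 (hC.integrable_pow₀ n hp)

theorem RandomCounts.integral_pow (hC : RandomCounts P T Y Z N N₀) (n : ℕ) (i : Fin n) (p : ℕ) :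
    ∫ ω, (N n i ω : ℝ) ^ p ∂P = countMoment P p (N₀ n) :=
  (hC.identDistrib_pow n i p).integral_eq

theorem countMoment_nonneg (p : ℕ) (M : Ω → ℕ) : 0 ≤ countMoment P p M :=
  integral_nonneg fun _ => by positivity

variable [IsProbabilityMeasure P]

theorem RandomCounts.countMoment_one_pos (hC : RandomCounts P T Y Z N N₀) (n : ℕ) :
    0 < countMoment P 1 (N₀ n) := by
  have h : ∫ _ω : Ω, (1 : ℝ) ∂P ≤ ∫ ω, (N₀ n ω : ℝ) ^ 1 ∂P :=
    integral_mono (integrable_const 1) (hC.integrable_pow₀ n (by norm_num)) fun ω => by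
      simpa using Nat.one_le_iff_ne_zero.2 (hC.N₀_pos n ω).ne'
  simp only [integral_const, probReal_univ, one_smul] at h
  exact zero_lt_one.trans_le h

/-- The second moments of the normalized terms sum to (E N² / (E N)²) / n, which vanishes because
the moment ratio is bounded. -/
theorem RandomCounts.tendstoInMeasure_averageCount (hC : RandomCounts P T Y Z N N₀) :
    TendstoInMeasure P (fun n ω => averageCount n (N n) ω / countMoment P 1 (N₀ n)) atTop
      (fun _ => 1) := by
  have hpos := hC.countMoment_one_pos
  have h := tendstoInMeasure_sum_of_second_moment (P := P)
    (X := fun n i ω => (N n i ω : ℝ) / (n * countMoment P 1 (N₀ n)))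
    (m := fun n => countMoment P 1 (N₀ n) / (n * countMoment P 1 (N₀ n)))
    (v := fun n => countMoment P 2 (N₀ n) / (n * countMoment P 1 (N₀ n)) ^ 2) (c := 1)
    (.of_forall fun n i => ?_) (fun n => ?_) (.of_forall fun n i => ?_) (.of_forall fun n i => ?_)
    ?_ ?_
  · refine h.congr_left fun n => .of_forall fun ω => ?_
    dsimp only
    rw [← Finset.sum_div, averageCount, div_div]
  · have hm : Measurable fun ω => (N n i ω : ℝ) / (n * countMoment P 1 (N₀ n)) :=
      (measurable_of_countable fun k : ℕ => (k : ℝ) / (n * countMoment P 1 (N₀ n))).comp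
        (hC.measurable_N n i)
    refine (memLp_two_iff_integrable_sq hm.aestronglyMeasurable).2 ?_
    simp_rw [div_pow]
    exact (hC.integrable_pow n i (by norm_num)).div_const _
  · exact (hC.indep n).comp (fun _ k => (k : ℝ) / (n * countMoment P 1 (N₀ n)))
      fun _ => measurable_of_countable _
  · rw [integral_div, ← hC.integral_pow n i 1]
    simp
  · simp_rw [div_pow]
    rw [integral_div, hC.integral_pow n i 2]
  · refine tendsto_const_nhds.congr' ?_
    filter_upwards [eventually_gt_atTop 0] with n hn
    have e4 : (n : ℝ) ≠ 0 := by exact_mod_cast hn.ne'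
    have := (hpos n).ne'
    field_simp
  · refine (hC.bounded_second.mul_tendsto_zero
      (fun n => div_nonneg (countMoment_nonneg _ _) (sq_nonneg _))
      tendsto_one_div_atTop_nhds_zero_nat).congr' ?_
    filter_upwards [eventually_gt_atTop 0] with n hn
    have e4 : (n : ℝ) ≠ 0 := by exact_mod_cast hn.ne'
    have := (hpos n).ne'
    field_simp

end Counts

/-! ### Kernel sums over a subject -/

/-- The contribution of the `j`-th observation of a subject to a kernel sum with weight `γ`. -/
noncomputable def kernelTerm (K : ℝ × ℝ → ℝ) (γ : ℝ → ℝ) (a b t z : ℝ) (j : ℕ)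
    (d : ℝ × (ℕ → ℝ × ℝ)) : ℝ :=
  K ((t - (d.2 j).1) / a, (z - d.1) / b) * γ (d.2 j).2

/-- The contribution of the first `k` observations of a subject to a kernel sum. -/
noncomputable def kernelSum (K : ℝ × ℝ → ℝ) (γ : ℝ → ℝ) (a b t z : ℝ) (k : ℕ)
    (d : ℝ × (ℕ → ℝ × ℝ)) : ℝ :=
  ∑ j ∈ Finset.range k, kernelTerm K γ a b t z j d

section KernelSum

variable {K : ℝ × ℝ → ℝ} {γ : ℝ → ℝ} {a b t z : ℝ}

theorem measurable_kernelTerm (hK : Measurable K) (hγ : Measurable γ) (j : ℕ) :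
    Measurable (kernelTerm K γ a b t z j) := by
  unfold kernelTerm
  exact (hK.comp (by fun_prop)).mul (hγ.comp (by fun_prop))

theorem measurable_kernelSum (hK : Measurable K) (hγ : Measurable γ) :
    Measurable fun p : ℕ × (ℝ × (ℕ → ℝ × ℝ)) => kernelSum K γ a b t z p.1 p.2 :=
  measurable_uncurry_of_nat fun _ =>
    Finset.measurable_fun_sum _ fun j _ => measurable_kernelTerm hK hγ j

variable {Ω : Type*} {T Y : ℕ → ℕ → Ω → ℝ} {Z : ℕ → Ω → ℝ}

theorem kernelTerm_subjectData (i j : ℕ) (ω : Ω) :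
    kernelTerm K γ a b t z j (subjectData T Y Z i ω) =
      K ((t - T i j ω) / a, (z - Z i ω) / b) * γ (Y i j ω) := rfl

theorem nadarayaWatson_eq (n : ℕ) (M : Fin n → Ω → ℕ) (ω : Ω) :
    nadarayaWatson K T Y Z n M a b t z ω =
      (∑ i, kernelSum K id a b t z (M i ω) (subjectData T Y Z i ω)) /
        ∑ i, kernelSum K (fun _ => 1) a b t z (M i ω) (subjectData T Y Z i ω) := by
  simp [nadarayaWatson, kernelSum, kernelTerm_subjectData]

variable [MeasurableSpace Ω] {P : Measure Ω} {f₃ : ℝ → ℝ → ℝ → ℝ}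
  {f₅ : ℝ → ℝ → ℝ → ℝ → ℝ → ℝ} {N : (n : ℕ) → Fin n → Ω → ℕ} {N₀ : ℕ → Ω → ℕ}

theorem RandomDesign.measurable_subjectData (hD : RandomDesign P T Y Z f₃ f₅) (i : ℕ) :
    Measurable (subjectData T Y Z i) :=
  (hD.measurable_Z i).prodMk
    (measurable_pi_lambda _ fun j => (hD.measurable_T i j).prodMk (hD.measurable_Y i j))

theorem RandomDesign.measurable_kernelSum_subject (hD : RandomDesign P T Y Z f₃ f₅)
    (hC : RandomCounts P T Y Z N N₀) (hK : Measurable K) (hγ : Measurable γ) (n : ℕ) (i : Fin n) :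
    Measurable fun ω => kernelSum K γ a b t z (N n i ω) (subjectData T Y Z i ω) :=
  Measurable.comp (g := fun p : ℕ × (ℝ × (ℕ → ℝ × ℝ)) => kernelSum K γ a b t z p.1 p.2)
    (f := fun ω => (N n i ω, subjectData T Y Z i ω)) (measurable_kernelSum hK hγ)
    ((hC.measurable_N n i).prodMk (hD.measurable_subjectData i))

theorem RandomCounts.indepFun_subject (hC : RandomCounts P T Y Z N N₀) (n : ℕ) (i : Fin n) :
    IndepFun (N n i) (subjectData T Y Z i) P :=
  (hC.indep_data n).comp (φ := fun k : Fin n → ℕ => k i)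
    (ψ := fun d : ℕ → ℝ × (ℕ → ℝ × ℝ) => d i) (measurable_pi_apply i) (measurable_pi_apply _)

variable [IsProbabilityMeasure P]

/-- Counts are independent across subjects, and so are the data; since the two families are
independent, so are the pairs, and hence any statistic of one subject. -/
theorem RandomDesign.iIndepFun_subjects (hD : RandomDesign P T Y Z f₃ f₅)
    (hC : RandomCounts P T Y Z N N₀) (n : ℕ) {Ψ : ℕ × (ℝ × (ℕ → ℝ × ℝ)) → ℝ} (hΨ : Measurable Ψ) :
    iIndepFun (fun (i : Fin n) ω => Ψ (N n i ω, subjectData T Y Z i ω)) P := by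
  have h := iIndepFun.prodMk_of_indepFun (P := P) (A := N n)
    (B := fun i : Fin n => subjectData T Y Z i) (hC.measurable_N n)
    (fun i => hD.measurable_subjectData i) (hC.indep n)
    (hD.indep_subjects.precomp Fin.val_injective)
    ((hC.indep_data n).comp (φ := id)
      (ψ := fun (d : ℕ → ℝ × (ℕ → ℝ × ℝ)) (i : Fin n) => d i) measurable_id
      (measurable_pi_lambda _ fun i => measurable_pi_apply _))
  exact h.comp (fun _ => Ψ) fun _ => hΨ

end KernelSum

/-! ### Moments of kernel sums -/

section

variable {Ω : Type*} [MeasurableSpace Ω] {P : Measure Ω}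
  {T Y : ℕ → ℕ → Ω → ℝ} {Z : ℕ → Ω → ℝ} {f₃ : ℝ → ℝ → ℝ → ℝ} {f₅ : ℝ → ℝ → ℝ → ℝ → ℝ → ℝ}
  {N : (n : ℕ) → Fin n → Ω → ℕ} {N₀ : ℕ → Ω → ℕ} {K : ℝ × ℝ → ℝ} {γ : ℝ → ℝ} {t z : ℝ}

theorem RandomDesign.integral_comp_kernelTerm_eq (hD : RandomDesign P T Y Z f₃ f₅)
    (hK : Measurable K) (hγ : Measurable γ) {F : ℝ → ℝ} (hF : Measurable F) (a b : ℝ) (i j : ℕ) :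
    ∫ ω, F (kernelTerm K γ a b t z j (subjectData T Y Z i ω)) ∂P =
      ∫ ω, F (kernelTerm K γ a b t z 0 (subjectData T Y Z 0 ω)) ∂P :=
  hD.integral_observation_eq i j 0 0
    (F := fun q => F (K ((t - q.1.1) / a, (z - q.1.2) / b) * γ q.2))
    (hF.comp ((hK.comp (by fun_prop)).mul (hγ.comp (by fun_prop))))

/-- Only eventual, because second moments of Y are controlled only near (t, z) and the bandwidths
must first be small. -/
theorem RandomDesign.eventually_memLp_kernelTerm (hD : RandomDesign P T Y Z f₃ f₅)
    (hreg : LocalRegularity f₃ f₅ t z) (hK : IsSecondOrderKernel K) (hγ : Measurable γ) {c : ℝ}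
    (hc : ∀ y, γ y ^ 2 ≤ c * (1 + y ^ 2)) {a b : ℕ → ℝ}
    (ha : ∀ n, 0 < a n) (hb : ∀ n, 0 < b n) (ha0 : Tendsto a atTop (𝓝 0))
    (hb0 : Tendsto b atTop (𝓝 0)) :
    ∀ᶠ n in atTop, ∀ i j,
      MemLp (fun ω => kernelTerm K γ (a n) (b n) t z j (subjectData T Y Z i ω)) 2 P := by
  obtain ⟨R, hR, hKR⟩ := hK.hasCompactSupport.exists_pos_forall_norm_le
  -- The growth bound at y = 0 reads γ(0)² ≤ c.
  have hc0 : 0 ≤ c := by nlinarith [hc 0, sq_nonneg (γ 0)]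
  obtain ⟨δ, hδ, C, h⟩ := hD.exists_ball_integrable_mul hreg (hγ.pow_const 2) hc0 fun y => by
    rw [abs_of_nonneg (sq_nonneg _)]; exact hc y
  have haR : Tendsto (fun n => a n * R) atTop (𝓝 0) := by simpa using ha0.mul_const R
  have hbR : Tendsto (fun n => b n * R) atTop (𝓝 0) := by simpa using hb0.mul_const R
  filter_upwards [haR.eventually_lt_const hδ, hbR.eventually_lt_const hδ] with n h1 h2 i j
  have hm : Measurable fun ω => kernelTerm K γ (a n) (b n) t z j (subjectData T Y Z i ω) :=
    (measurable_kernelTerm hK.measurable hγ j).comp (hD.measurable_subjectData i)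
  rw [memLp_two_iff_integrable_sq hm.aestronglyMeasurable]
  simp_rw [kernelTerm_subjectData, mul_pow]
  exact (hD.integral_localized (φ := fun s => K s ^ 2) (hK.measurable.pow_const 2)
    hK.memLp_two.integrable_sq
    (fun s hs => hKR s (pow_ne_zero_iff two_ne_zero |>.1 hs)) (hγ.pow_const 2) h (ha n) (hb n)
    h1 h2 i j).1

theorem RandomDesign.tendsto_integral_kernelTerm_sq (hD : RandomDesign P T Y Z f₃ f₅)
    (hreg : LocalRegularity f₃ f₅ t z) (hK : IsSecondOrderKernel K) (hγ : Measurable γ) {c : ℝ}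
    (hc : ∀ y, γ y ^ 2 ≤ c * (1 + y ^ 2))
    (hcont : ContinuousAt (fun x : ℝ × ℝ => ∫ y, γ y ^ 2 * f₃ x.1 x.2 y) (t, z)) {a b : ℕ → ℝ}
    (ha : ∀ n, 0 < a n) (hb : ∀ n, 0 < b n) (ha0 : Tendsto a atTop (𝓝 0))
    (hb0 : Tendsto b atTop (𝓝 0)) :
    Tendsto (fun n => (∫ ω, kernelTerm K γ (a n) (b n) t z 0 (subjectData T Y Z 0 ω) ^ 2 ∂P) /
      (a n * b n)) atTop (𝓝 ((∫ s, K s ^ 2) * ∫ y, γ y ^ 2 * f₃ t z y)) := by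
  obtain ⟨R, hR, hKR⟩ := hK.hasCompactSupport.exists_pos_forall_norm_le
  have hc0 : 0 ≤ c := by nlinarith [hc 0, sq_nonneg (γ 0)]
  obtain ⟨δ, hδ, C, h⟩ := hD.exists_ball_integrable_mul hreg (hγ.pow_const 2) hc0 fun y => by
    rw [abs_of_nonneg (sq_nonneg _)]; exact hc y
  simp_rw [kernelTerm_subjectData, mul_pow]
  exact hD.tendsto_integral_localized (φ := fun s => K s ^ 2) (hK.measurable.pow_const 2)
    hK.memLp_two.integrable_sq
    (fun s hs => hKR s (pow_ne_zero_iff two_ne_zero |>.1 hs)) (hγ.pow_const 2) hδ h hcont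
    ha hb ha0 hb0 0 0

theorem LocalRegularity.contDiffAt_excess (hreg : LocalRegularity f₃ f₅ t z) (m : ℝ) :
    ContDiffAt ℝ 2 (fun x : ℝ × ℝ => (condMean f₃ x.1 x.2 - m) * marginalDensity f₃ x.1 x.2)
      (t, z) :=
  (hreg.mean_smooth.sub contDiffAt_const).mul hreg.f₂_smooth

theorem RandomDesign.measurable_marginalDensity (hD : RandomDesign P T Y Z f₃ f₅) :
    Measurable fun x : ℝ × ℝ => marginalDensity f₃ x.1 x.2 := by
  simpa [marginalDensity] using hD.measurable_integral_density (γ := fun _ => 1) measurable_const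

theorem RandomDesign.measurable_condMean (hD : RandomDesign P T Y Z f₃ f₅) :
    Measurable fun x : ℝ × ℝ => condMean f₃ x.1 x.2 :=
  (hD.measurable_integral_density measurable_id).div hD.measurable_marginalDensity

theorem RandomDesign.eventually_integral_sub_eq (hD : RandomDesign P T Y Z f₃ f₅)
    (hreg : LocalRegularity f₃ f₅ t z) (m : ℝ) :
    (fun x : ℝ × ℝ => ∫ y, (y - m) * f₃ x.1 x.2 y) =ᶠ[𝓝 (t, z)]
      fun x => (condMean f₃ x.1 x.2 - m) * marginalDensity f₃ x.1 x.2 := by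
  filter_upwards [hreg.eventually_integrable, hreg.integral_mul_eventuallyEq,
    hD.eventually_integrable_mul hreg measurable_id abs_le_one_add_sq] with x h0 he h1
  have h1' : Integrable fun y => y * f₃ x.1 x.2 y := h1.1
  rw [sub_mul, ← he, marginalDensity, ← integral_const_mul, ← integral_sub h1' (h0.const_mul m)]
  congr 1 with y
  ring

theorem RandomDesign.eventually_integral_kernelTerm_sub (hD : RandomDesign P T Y Z f₃ f₅)
    (hreg : LocalRegularity f₃ f₅ t z) (hK : IsSecondOrderKernel K) (m : ℝ) {a b : ℕ → ℝ}
    (ha : ∀ n, 0 < a n) (hb : ∀ n, 0 < b n) (ha0 : Tendsto a atTop (𝓝 0))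
    (hb0 : Tendsto b atTop (𝓝 0)) :
    ∀ᶠ n in atTop, ∫ ω, kernelTerm K (fun y => y - m) (a n) (b n) t z 0 (subjectData T Y Z 0 ω) ∂P =
      a n * b n * ∫ s : ℝ × ℝ, K s * ((condMean f₃ (t - a n * s.1) (z - b n * s.2) - m) *
        marginalDensity f₃ (t - a n * s.1) (z - b n * s.2)) := by
  obtain ⟨R, hR, hKR⟩ := hK.hasCompactSupport.exists_pos_forall_norm_le
  obtain ⟨δ, hδ, C, h⟩ := hD.exists_ball_integrable_mul hreg (γ := fun y => y - m) (by fun_prop)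
    (by positivity) fun y => abs_sub_le_mul_one_add_sq y m
  obtain ⟨η, hη, heq⟩ := Metric.eventually_nhds_iff.1 (hD.eventually_integral_sub_eq hreg m)
  have haR : Tendsto (fun n => a n * R) atTop (𝓝 0) := by simpa using ha0.mul_const R
  have hbR : Tendsto (fun n => b n * R) atTop (𝓝 0) := by simpa using hb0.mul_const R
  filter_upwards [haR.eventually_lt_const hδ, hbR.eventually_lt_const hδ,
    haR.eventually_lt_const hη, hbR.eventually_lt_const hη] with n h1 h2 h3 h4
  simp_rw [kernelTerm_subjectData]
  rw [(hD.integral_localized hK.measurable hK.integrable hKR (by fun_prop) h (ha n) (hb n)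
    h1 h2 0 0).2]
  congr 2 with s
  by_cases hs : K s = 0
  · simp [hs]
  congr 1
  have h := hKR s hs
  rw [Prod.norm_def, max_le_iff] at h
  refine heq (y := (t - a n * s.1, z - b n * s.2)) ?_
  rw [Prod.dist_eq, max_lt_iff, Real.dist_eq, Real.dist_eq]
  simp only [sub_sub_cancel_left, abs_neg, abs_mul, abs_of_pos (ha n), abs_of_pos (hb n)]
  exact ⟨(mul_le_mul_of_nonneg_left h.1 (ha n).le).trans_lt h3,
    (mul_le_mul_of_nonneg_left h.2 (hb n).le).trans_lt h4⟩

/-- The leading term of the bias before normalization. -/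
theorem RandomDesign.tendsto_integral_kernelTerm_sub (hD : RandomDesign P T Y Z f₃ f₅)
    (hreg : LocalRegularity f₃ f₅ t z) (hK : IsSecondOrderKernel K) {a b : ℕ → ℝ} {ρ : ℝ}
    (ha : ∀ n, 0 < a n) (hb : ∀ n, 0 < b n) (ha0 : Tendsto a atTop (𝓝 0))
    (hb0 : Tendsto b atTop (𝓝 0)) (hρ : Tendsto (fun n => b n / a n) atTop (𝓝 ρ)) :
    Tendsto (fun n => (∫ ω, kernelTerm K (fun y => y - condMean f₃ t z) (a n) (b n) t z 0
        (subjectData T Y Z 0 ω) ∂P) / (a n * b n) / a n ^ 2) atTop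
      (𝓝 (∑ k ∈ Finset.HasAntidiagonal.antidiagonal (2 : ℕ),
        1 / ((k.1.factorial : ℝ) * (k.2.factorial : ℝ)) *
        (∫ s : ℝ × ℝ, s.1 ^ k.1 * s.2 ^ k.2 * K s) *
        mixedPartial k.1 k.2 (fun t' z' => (condMean f₃ t' z' - condMean f₃ t z) *
          marginalDensity f₃ t' z') t z * ρ ^ k.2)) := by
  refine (hK.tendsto_smoothing (hreg.contDiffAt_excess _)
    ((hD.measurable_condMean.sub_const _).mul hD.measurable_marginalDensity) ha hb ha0 hρ).congr' ?_
  filter_upwards [hD.eventually_integral_kernelTerm_sub hreg hK (condMean f₃ t z) ha hb ha0 hb0]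
    with n hn
  rw [hn, mul_div_cancel_left₀ _ (mul_pos (ha n) (hb n)).ne', sub_self, zero_mul, sub_zero]

/-- Linearity passes through the second Fréchet derivative. Applied to μ(·) f₂ and f₂, it turns the
derivatives of (μ(·) - m) f₂ into the difference in the bias formula. -/
theorem mixedPartial_sub_mul {g₁ g₂ : ℝ → ℝ → ℝ} {m : ℝ}
    (h₁ : ContDiffAt ℝ 2 (fun x : ℝ × ℝ => g₁ x.1 x.2) (t, z))
    (h₂ : ContDiffAt ℝ 2 (fun x : ℝ × ℝ => g₂ x.1 x.2) (t, z)) {k : ℕ × ℕ}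
    (hk : k ∈ Finset.HasAntidiagonal.antidiagonal (2 : ℕ)) :
    mixedPartial k.1 k.2 (fun t' z' => g₁ t' z' - m * g₂ t' z') t z =
      mixedPartial k.1 k.2 g₁ t z - m * mixedPartial k.1 k.2 g₂ t z := by
  have h₂' : ContDiffAt ℝ 2 (fun x : ℝ × ℝ => m * g₂ x.1 x.2) (t, z) := contDiffAt_const.mul h₂
  obtain ⟨a1, a2, a3⟩ := mixedPartial_eq_fderiv_fderiv h₁
  obtain ⟨b1, b2, b3⟩ := mixedPartial_eq_fderiv_fderiv h₂
  obtain ⟨c1, c2, c3⟩ := mixedPartial_eq_fderiv_fderiv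
    (g := fun t' z' => g₁ t' z' - m * g₂ t' z') (h₁.sub h₂')
  have hd : fderiv ℝ (fun x : ℝ × ℝ => g₁ x.1 x.2 - m * g₂ x.1 x.2) =ᶠ[𝓝 (t, z)]
      fun x => fderiv ℝ (fun x : ℝ × ℝ => g₁ x.1 x.2) x -
        m • fderiv ℝ (fun x : ℝ × ℝ => g₂ x.1 x.2) x := by
    filter_upwards [h₁.eventually (by simp), h₂.eventually (by simp)] with x hx₁ hx₂
    have d₁ := hx₁.differentiableAt (by norm_num)
    have d₂ := hx₂.differentiableAt (by norm_num)
    rw [fderiv_fun_sub d₁ (d₂.const_mul m), fderiv_const_mul d₂]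
  have e₁ : DifferentiableAt ℝ (fderiv ℝ fun x : ℝ × ℝ => g₁ x.1 x.2) (t, z) :=
    (h₁.fderiv_right (m := 1) (by norm_num)).differentiableAt (by norm_num)
  have e₂ : DifferentiableAt ℝ (fderiv ℝ fun x : ℝ × ℝ => g₂ x.1 x.2) (t, z) :=
    (h₂.fderiv_right (m := 1) (by norm_num)).differentiableAt (by norm_num)
  have e₂' : DifferentiableAt ℝ (fun x => m • fderiv ℝ (fun x : ℝ × ℝ => g₂ x.1 x.2) x) (t, z) :=
    e₂.const_smul m
  have hdd := hd.fderiv_eq (𝕜 := ℝ)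
  rw [fderiv_fun_sub e₁ e₂', fderiv_fun_const_smul e₂ m] at hdd
  have hk' : k = (2, 0) ∨ k = (1, 1) ∨ k = (0, 2) := by
    rw [Finset.HasAntidiagonal.mem_antidiagonal] at hk
    obtain ⟨p, q⟩ := k
    simp only [Prod.mk.injEq] at hk ⊢
    omega
  rcases hk' with rfl | rfl | rfl
  · simp only [a1, b1, c1, hdd]; simp
  · simp only [a2, b2, c2, hdd]; simp
  · simp only [a3, b3, c3, hdd]; simp

/-- Since √(ρ^(2k+1)) = ρ^k √ρ, the factor τ √ρ comes out of the sum and the smoothing limit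
remains. -/
theorem LocalRegularity.biasNW_eq (hreg : LocalRegularity f₃ f₅ t z) {ρ : ℝ} (hρ : 0 < ρ) (τ : ℝ) :
    biasNW K f₃ ρ τ t z = τ * √ρ * (∑ k ∈ Finset.HasAntidiagonal.antidiagonal (2 : ℕ),
        1 / ((k.1.factorial : ℝ) * (k.2.factorial : ℝ)) *
        (∫ s : ℝ × ℝ, s.1 ^ k.1 * s.2 ^ k.2 * K s) *
        mixedPartial k.1 k.2 (fun t' z' => (condMean f₃ t' z' - condMean f₃ t z) *
          marginalDensity f₃ t' z') t z * ρ ^ k.2) / marginalDensity f₃ t z := by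
  rw [biasNW, Finset.mul_sum, Finset.sum_div]
  refine Finset.sum_congr rfl fun k hk => ?_
  simp_rw [sub_mul]
  rw [mixedPartial_sub_mul (g₁ := fun t' z' => condMean f₃ t' z' * marginalDensity f₃ t' z')
    (g₂ := marginalDensity f₃) (hreg.mean_smooth.mul hreg.f₂_smooth) hreg.f₂_smooth hk,
    pow_succ, pow_mul', Real.sqrt_mul (sq_nonneg _), Real.sqrt_sq (pow_nonneg hρ.le _)]
  ring

theorem RandomDesign.varianceNW_nonneg (hD : RandomDesign P T Y Z f₃ f₅)
    (hreg : LocalRegularity f₃ f₅ t z) : 0 ≤ varianceNW K f₃ t z :=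
  div_nonneg (mul_nonneg (div_nonneg (integral_nonneg fun _ =>
    mul_nonneg (sq_nonneg _) (hD.f₃_nonneg _ _ _)) hreg.f₂_pos.le)
    (integral_nonneg fun _ => sq_nonneg _)) hreg.f₂_pos.le

end

/-! ### Limits of the two kernel sums -/

section

variable {Ω : Type*} [MeasurableSpace Ω] {P : Measure Ω} [IsProbabilityMeasure P]
  {T Y : ℕ → ℕ → Ω → ℝ} {Z : ℕ → Ω → ℝ} {f₃ : ℝ → ℝ → ℝ → ℝ} {f₅ : ℝ → ℝ → ℝ → ℝ → ℝ → ℝ}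
  {N : (n : ℕ) → Fin n → Ω → ℕ} {N₀ : ℕ → Ω → ℕ} {K : ℝ × ℝ → ℝ} {γ : ℝ → ℝ} {t z : ℝ}
  {a b : ℕ → ℝ}

theorem RandomDesign.memLp_kernelSum (hD : RandomDesign P T Y Z f₃ f₅)
    (hC : RandomCounts P T Y Z N N₀) (hK : Measurable K) (hγ : Measurable γ) {a b : ℝ} {n : ℕ}
    (i : Fin n)
    (hL2 : ∀ j, MemLp (fun ω => kernelTerm K γ a b t z j (subjectData T Y Z i ω)) 2 P) :
    MemLp (fun ω => kernelSum K γ a b t z (N n i ω) (subjectData T Y Z i ω)) 2 P ∧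
      ∫ ω, kernelSum K γ a b t z (N n i ω) (subjectData T Y Z i ω) ^ 2 ∂P ≤
        countMoment P 2 (N₀ n) *
          ∫ ω, kernelTerm K γ a b t z 0 (subjectData T Y Z 0 ω) ^ 2 ∂P := by
  rw [← hC.integral_pow n i 2]
  exact integral_randomSum_le (hC.measurable_N n i) (hD.measurable_subjectData i)
    (hC.indepFun_subject n i) (fun j => measurable_kernelTerm hK hγ j) hL2
    (fun j => hD.integral_comp_kernelTerm_eq hK hγ (F := fun x => x ^ 2) (by fun_prop) a b i j)
    (hC.integrable_pow n i (by norm_num))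

theorem RandomDesign.integral_kernelSum (hD : RandomDesign P T Y Z f₃ f₅)
    (hC : RandomCounts P T Y Z N N₀) (hK : Measurable K) (hγ : Measurable γ) {a b : ℝ} {n : ℕ}
    (i : Fin n)
    (hL2 : ∀ j, MemLp (fun ω => kernelTerm K γ a b t z j (subjectData T Y Z i ω)) 2 P) :
    ∫ ω, kernelSum K γ a b t z (N n i ω) (subjectData T Y Z i ω) ∂P =
      countMoment P 1 (N₀ n) *
        ∫ ω, kernelTerm K γ a b t z 0 (subjectData T Y Z 0 ω) ∂P := by
  have h1 := hC.integral_pow n i 1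
  simp only [pow_one] at h1
  rw [← h1]
  exact integral_randomSum_eq (hC.measurable_N n i) (hD.measurable_subjectData i)
    (hC.indepFun_subject n i) (fun j => measurable_kernelTerm hK hγ j) hL2
    (fun j => hD.integral_comp_kernelTerm_eq hK hγ (F := fun x => x ^ 2) (by fun_prop) a b i j)
    (by simpa using hC.integrable_pow n i (p := 1) (by norm_num))
    (fun j => hD.integral_comp_kernelTerm_eq hK hγ (F := fun x => x) measurable_id a b i j)

/-- The mean is asymptotically one because K integrates to one. The sum of second moments is at most
the moment ratio of the counts times a bounded factor over n a b. -/
theorem RandomDesign.tendstoInMeasure_sum_kernelSum (hD : RandomDesign P T Y Z f₃ f₅)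
    (hC : RandomCounts P T Y Z N N₀) (hreg : LocalRegularity f₃ f₅ t z)
    (hK : IsSecondOrderKernel K) (ha : ∀ n, 0 < a n) (hb : ∀ n, 0 < b n)
    (ha0 : Tendsto a atTop (𝓝 0)) (hb0 : Tendsto b atTop (𝓝 0))
    (hab : Tendsto (fun n : ℕ => 1 / (n * (a n * b n))) atTop (𝓝 0)) :
    TendstoInMeasure P (fun n ω => (∑ i, kernelSum K (fun _ => 1) (a n) (b n) t z (N n i ω)
        (subjectData T Y Z i ω)) /
          (n * countMoment P 1 (N₀ n) * (a n * b n) * marginalDensity f₃ t z))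
      atTop (fun _ => 1) := by
  have hpos := hC.countMoment_one_pos
  have hf := hreg.f₂_pos
  have hγ : Measurable fun _ : ℝ => (1 : ℝ) := measurable_const
  have hc : ∀ y : ℝ, (1 : ℝ) ^ 2 ≤ 1 * (1 + y ^ 2) := fun y => by nlinarith [sq_nonneg y]
  have hcont : ContinuousAt (fun x : ℝ × ℝ => ∫ y, 1 * f₃ x.1 x.2 y) (t, z) := by
    simpa [marginalDensity] using hreg.f₂_smooth.continuousAt
  have hL2 := hD.eventually_memLp_kernelTerm hreg hK hγ hc ha hb ha0 hb0
  have hsq := hD.tendsto_integral_kernelTerm_sq hreg hK hγ hc (by simpa using hcont) ha hb ha0 hb0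
  have hmean : Tendsto (fun n => (∫ ω, kernelTerm K (fun _ => 1) (a n) (b n) t z 0
      (subjectData T Y Z 0 ω) ∂P) / (a n * b n)) atTop (𝓝 (marginalDensity f₃ t z)) := by
    obtain ⟨R, hR, hKR⟩ := hK.hasCompactSupport.exists_pos_forall_norm_le
    obtain ⟨δ, hδ, C, h⟩ := hD.exists_ball_integrable_mul hreg hγ zero_le_one fun y => by
      simp; positivity
    have := hD.tendsto_integral_localized hK.measurable hK.integrable hKR hγ hδ h hcont
      ha hb ha0 hb0 0 0
    simpa [hK.integral_eq_one, marginalDensity, kernelTerm_subjectData] using this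
  set m := fun n => ∫ ω, kernelTerm K (fun _ => 1) (a n) (b n) t z 0 (subjectData T Y Z 0 ω) ∂P
  set v := fun n =>
    ∫ ω, kernelTerm K (fun _ => 1) (a n) (b n) t z 0 (subjectData T Y Z 0 ω) ^ 2 ∂P
  change Tendsto (fun n => m n / (a n * b n)) atTop _ at hmean
  change Tendsto (fun n => v n / (a n * b n)) atTop _ at hsq
  set d := fun n : ℕ => n * countMoment P 1 (N₀ n) * (a n * b n) * marginalDensity f₃ t z with hd
  have h := tendstoInMeasure_sum_of_second_moment (P := P)
    (X := fun n i ω => kernelSum K (fun _ => 1) (a n) (b n) t z (N n i ω)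
      (subjectData T Y Z i ω) / d n)
    (m := fun n => countMoment P 1 (N₀ n) * m n / d n)
    (v := fun n => countMoment P 2 (N₀ n) * v n / d n ^ 2) (c := 1)
    ?_ (fun n => ?_) ?_ ?_ ?_ ?_
  · refine h.congr_left fun n => .of_forall fun ω => ?_
    dsimp only
    rw [← Finset.sum_div]
  · filter_upwards [hL2] with n hn i
    simp_rw [div_eq_mul_inv]
    exact (hD.memLp_kernelSum hC hK.measurable hγ i (hn i)).1.mul_const _
  · exact hD.iIndepFun_subjects hC n
      (Ψ := fun p => kernelSum K (fun _ => 1) (a n) (b n) t z p.1 p.2 / d n)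
      ((measurable_kernelSum hK.measurable hγ).div_const _)
  · filter_upwards [hL2] with n hn i
    rw [integral_div, hD.integral_kernelSum hC hK.measurable hγ i (hn i)]
  · filter_upwards [hL2] with n hn i
    simp_rw [div_pow]
    rw [integral_div]
    exact div_le_div_of_nonneg_right (hD.memLp_kernelSum hC hK.measurable hγ i (hn i)).2
      (sq_nonneg _)
  · have h1 := hmean.div_const (marginalDensity f₃ t z)
    rw [div_self hf.ne'] at h1
    refine h1.congr' ?_
    filter_upwards [eventually_gt_atTop 0] with n hn
    have e1 := (hpos n).ne'
    have e2 := (ha n).ne'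
    have e3 := (hb n).ne'
    have e4 : (n : ℝ) ≠ 0 := by exact_mod_cast hn.ne'
    have e5 := hf.ne'
    simp only [hd]
    field_simp
  · have h1 := (hsq.mul hab).div_const (marginalDensity f₃ t z ^ 2)
    rw [mul_zero, zero_div] at h1
    refine (hC.bounded_second.mul_tendsto_zero
      (fun n => div_nonneg (countMoment_nonneg _ _) (sq_nonneg _)) h1).congr' ?_
    filter_upwards [eventually_gt_atTop 0] with n hn
    have e1 := (hpos n).ne'
    have e2 := (ha n).ne'
    have e3 := (hb n).ne'
    have e4 : (n : ℝ) ≠ 0 := by exact_mod_cast hn.ne'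
    have e5 := hf.ne'
    simp only [hd]
    field_simp

/-- Cross moments within a subject are negligible. -/
theorem RandomDesign.exists_eventually_integral_abs_mul_kernelTerm_le
    (hD : RandomDesign P T Y Z f₃ f₅) (hreg : LocalRegularity f₃ f₅ t z)
    (hK : IsSecondOrderKernel K) (m : ℝ) (ha : ∀ n, 0 < a n) (hb : ∀ n, 0 < b n)
    (ha0 : Tendsto a atTop (𝓝 0)) (hb0 : Tendsto b atTop (𝓝 0)) :
    ∃ C, 0 ≤ C ∧ ∀ᶠ n in atTop, ∀ i j k, j ≠ k →
      ∫ ω, |kernelTerm K (fun y => y - m) (a n) (b n) t z j (subjectData T Y Z i ω) *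
        kernelTerm K (fun y => y - m) (a n) (b n) t z k (subjectData T Y Z i ω)| ∂P ≤
      (∫ ω, kernelTerm K (fun y => y - m) (a n) (b n) t z 0 (subjectData T Y Z 0 ω) ^ 2 ∂P) *
        (C * a n) := by
  obtain ⟨R, hR, hKR⟩ := hK.hasCompactSupport.exists_pos_forall_norm_le
  obtain ⟨δ, hδ, C, hC0, hC⟩ := hD.exists_measureReal_time_le hreg
  have haR : Tendsto (fun n => R * a n) atTop (𝓝 0) := by simpa using ha0.const_mul R
  refine ⟨C * R, by positivity, ?_⟩
  filter_upwards [hD.eventually_memLp_kernelTerm hreg hK (γ := fun y => y - m) (by fun_prop)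
    (fun y => sub_sq_le_mul_one_add_sq y m) ha hb ha0 hb0, haR.eventually_lt_const hδ]
    with n hL2 hn i j k hjk
  exact hD.integral_abs_mul_le hK.measurable hKR (ha n) i (hL2 i)
    (fun j => hD.integral_comp_kernelTerm_eq hK.measurable (γ := fun y => y - m) (by fun_prop)
      (F := fun x => x ^ 2) (by fun_prop) (a n) (b n) i j)
    (fun j => (hC i j _ (mul_pos hR (ha n)) hn).trans_eq (mul_assoc _ _ _).symm) hjk

end

/-! ### Central limit theorem for the centred numerator. -/

section

variable {Ω : Type*} [MeasurableSpace Ω] {P : Measure Ω} [IsProbabilityMeasure P]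
  {T Y : ℕ → ℕ → Ω → ℝ} {Z : ℕ → Ω → ℝ} {f₃ : ℝ → ℝ → ℝ → ℝ} {f₅ : ℝ → ℝ → ℝ → ℝ → ℝ → ℝ}
  {N : (n : ℕ) → Fin n → Ω → ℕ} {N₀ : ℕ → Ω → ℕ} {K : ℝ × ℝ → ℝ} {t z ρ τ : ℝ}
  {ht hz h : ℕ → ℝ}

theorem indicator_sq_div {δ c : ℝ} (hc : 0 < c) (x : ℝ) :
    {y : ℝ | δ < |y|}.indicator (fun y => y ^ 2) (x / c) =
      {y : ℝ | δ * c < |y|}.indicator (fun y => y ^ 2) x / c ^ 2 := by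
  have h : δ < |x / c| ↔ δ * c < |x| := by rw [abs_div, abs_of_pos hc, lt_div_iff₀ hc]
  by_cases hx : δ * c < |x|
  · rw [Set.indicator_of_mem (by simpa using h.2 hx), Set.indicator_of_mem (by simpa using hx),
      div_pow]
  · rw [Set.indicator_of_notMem (by simpa using fun h' => hx (h.1 h')),
      Set.indicator_of_notMem (by simpa using hx), zero_div]

/-- Central limit theorem for the centred numerator of the estimator. -/
theorem RandomDesign.tendstoInDistribution_sum_kernelSum (hD : RandomDesign P T Y Z f₃ f₅)
    (hC : RandomCounts P T Y Z N N₀) (hK : IsSecondOrderKernel K)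
    (hband : BandwidthConditions (fun n => countMoment P 1 (N₀ n)) ht hz h)
    (hreg : LocalRegularity f₃ f₅ t z) (hρ : 0 < ρ) (hτ : 0 < τ)
    (hratio : Tendsto (fun n => hz n / ht n) atTop (𝓝 ρ))
    (hrate : Tendsto (fun n : ℕ => n * countMoment P 1 (N₀ n) * ht n ^ 6) atTop (𝓝 (τ ^ 2))) :
    TendstoInDistribution (fun (n : ℕ) ω => ∑ i,
      kernelSum K (fun y => y - condMean f₃ t z) (ht n) (hz n) t z (N n i ω)
        (subjectData T Y Z i ω) /
        (marginalDensity f₃ t z * √(n * countMoment P 1 (N₀ n) * (ht n * hz n))))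
      atTop (id : ℝ → ℝ) (fun _ => P)
      (gaussianReal (biasNW K f₃ ρ τ t z) (varianceNW K f₃ t z).toNNReal) := by
  have hpos := hC.countMoment_one_pos
  have ha := hband.ht_pos
  have hb := hband.hz_pos
  have ha0 := hband.tendsto_ht
  have hb0 := hband.tendsto_hz
  have hEa := hband.tendsto_mul_ht
  have hab := hband.tendsto_one_div hpos hρ hτ hratio hrate
  have hrt := hband.tendsto_sqrt_mul hτ hratio hrate
  have hf := hreg.f₂_pos
  set f := marginalDensity f₃ t z with hf_def
  set μ := condMean f₃ t z with hμ
  have hγ : Measurable fun y : ℝ => y - μ := by fun_prop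
  have hKm := hK.measurable
  have hL2 := hD.eventually_memLp_kernelTerm hreg hK hγ (fun y => sub_sq_le_mul_one_add_sq y μ)
    ha hb ha0 hb0
  have hsq := hD.tendsto_integral_kernelTerm_sq hreg hK hγ
    (fun y => sub_sq_le_mul_one_add_sq y μ) (hD.continuousAt_integral_sub_sq hreg μ) ha hb ha0 hb0
  have hmean := hD.tendsto_integral_kernelTerm_sub hreg hK ha hb ha0 hb0 hratio
  obtain ⟨C, hC0, hcross⟩ := hD.exists_eventually_integral_abs_mul_kernelTerm_le hreg hK μ ha hb
    ha0 hb0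
  rw [hμ, hreg.integral_sub_condMean_sq, ← hμ, ← hf_def] at hsq
  rw [← hμ] at hmean
  set B := ∑ k ∈ Finset.HasAntidiagonal.antidiagonal (2 : ℕ),
    1 / ((k.1.factorial : ℝ) * (k.2.factorial : ℝ)) *
      (∫ s : ℝ × ℝ, s.1 ^ k.1 * s.2 ^ k.2 * K s) *
      mixedPartial k.1 k.2 (fun t' z' => (condMean f₃ t' z' - μ) *
        marginalDensity f₃ t' z') t z * ρ ^ k.2 with hB
  set EN : ℕ → ℝ := fun n => countMoment P 1 (N₀ n) with hEN
  set E2 : ℕ → ℝ := fun n => countMoment P 2 (N₀ n) with hE2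
  set ξ : ℕ → ℕ → ℕ → Ω → ℝ := fun n i j ω =>
    kernelTerm K (fun y => y - μ) (ht n) (hz n) t z j (subjectData T Y Z i ω) with hξ
  set S : ∀ n : ℕ, Fin n → Ω → ℝ := fun n i ω =>
    kernelSum K (fun y => y - μ) (ht n) (hz n) t z (N n i ω) (subjectData T Y Z i ω) with hS
  set m : ℕ → ℝ := fun n => ∫ ω, ξ n 0 0 ω ∂P with hm
  set v : ℕ → ℝ := fun n => ∫ ω, ξ n 0 0 ω ^ 2 ∂P with hv
  set d : ℕ → ℝ := fun n => √(n * EN n * (ht n * hz n)) with hd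
  change Tendsto (fun n => m n / (ht n * hz n) / ht n ^ 2) atTop (𝓝 B) at hmean
  change Tendsto (fun n => v n / (ht n * hz n)) atTop _ at hsq
  have hv0 : ∀ n, 0 ≤ v n := fun n => integral_nonneg fun _ => sq_nonneg _
  -- Size of the within-subject cross terms relative to the diagonal.
  have hratio2 : Tendsto (fun n => E2 n / EN n ^ 2 * (EN n * ht n * (v n / (ht n * hz n)))) atTop
      (𝓝 0) := by
    refine hC.bounded_second.mul_tendsto_zero
      (fun n => div_nonneg (countMoment_nonneg _ _) (sq_nonneg _)) ?_
    simpa using hEa.mul hsq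
  -- Size, up to constants, of the Lindeberg contribution of the terms below the truncation level.
  have hratio3 : Tendsto (fun n : ℕ => E2 n / EN n ^ 2 * (1 / (n * (ht n * hz n)) *
      (v n / (ht n * hz n)))) atTop (𝓝 0) := by
    refine hC.bounded_second.mul_tendsto_zero
      (fun n => div_nonneg (countMoment_nonneg _ _) (sq_nonneg _)) ?_
    simpa using hab.mul hsq
  have hdsq : ∀ n, d n ^ 2 = n * EN n * (ht n * hz n) := fun n =>
    Real.sq_sqrt (mul_nonneg (mul_nonneg (Nat.cast_nonneg _) (hpos n).le)
      (mul_pos (ha n) (hb n)).le)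
  have hdpos : ∀ n : ℕ, 0 < n → 0 < d n := fun n hn =>
    Real.sqrt_pos.2 (mul_pos (mul_pos (by exact_mod_cast hn) (hpos n)) (mul_pos (ha n) (hb n)))
  have hξ_sq : ∀ n i j, ∫ ω, ξ n i j ω ^ 2 ∂P = v n := fun n i j =>
    hD.integral_comp_kernelTerm_eq hKm hγ (F := fun x => x ^ 2) (by fun_prop) _ _ i j
  have hN1 : ∀ n i, Integrable (fun ω => (N n i ω : ℝ)) P := fun n i => by
    simpa using hC.integrable_pow n i (p := 1) (by norm_num)
  have hN1' : ∀ n i, ∫ ω, (N n i ω : ℝ) ∂P = EN n := fun n i => by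
    simpa using hC.integral_pow n i 1
  have hSsq : ∀ᶠ n in atTop, ∀ i, |∫ ω, S n i ω ^ 2 ∂P - EN n * v n| ≤
      E2 n * (v n * (C * ht n)) := by
    filter_upwards [hL2, hcross] with n hL2 hcross i
    have := abs_integral_sq_randomSum_sub_le (hC.measurable_N n i) (hD.measurable_subjectData i)
      (hC.indepFun_subject n i) (fun j => measurable_kernelTerm hKm hγ j) (hL2 i)
      (hξ_sq n i) (hN1 n i) (hC.integrable_pow n i (by norm_num))
      (mul_nonneg (hv0 n) (mul_nonneg hC0 (ha n).le)) (hcross i)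
    rwa [hN1', hC.integral_pow n i 2] at this
  refine tendstoInDistribution_sum_of_lindeberg (P := P) (fun n i => ?_) ?_ (fun n => ?_)
    (hD.varianceNW_nonneg hreg) (fun ε hε => ?_) (fun ε hε => ?_) fun δ hδ ε hε => ?_
  · exact ((hD.measurable_kernelSum_subject hC hKm hγ n i).div_const _).aemeasurable
  · filter_upwards [hL2] with n hn i
    simp_rw [div_eq_mul_inv]
    exact (hD.memLp_kernelSum hC hKm hγ i (hn i)).1.mul_const _
  · exact hD.iIndepFun_subjects hC n
      (Ψ := fun p => kernelSum K (fun y => y - μ) (ht n) (hz n) t z p.1 p.2 / (f * d n))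
      ((measurable_kernelSum hKm hγ).div_const _)
  -- With d² = n E(N) a b, the mean n E(N) m / (f d) equals d m / (a b f); a factor a² is exchanged
  -- between d and m.
  · have hlim : Tendsto (fun n : ℕ => d n * ht n ^ 2 * (m n / (ht n * hz n) / ht n ^ 2) / f) atTop
        (𝓝 (biasNW K f₃ ρ τ t z)) := by
      rw [hreg.biasNW_eq hρ]
      exact (hrt.mul hmean).div_const f
    filter_upwards [hL2, Metric.tendsto_nhds.1 hlim ε hε, eventually_gt_atTop 0] with n hn hl hn0 i
    rw [integral_div, hD.integral_kernelSum hC hKm hγ i (hn i)]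
    refine le_of_eq_of_le ?_ hl.le
    rw [Real.dist_eq]
    congr 2
    change n * (EN n * m n / (f * d n)) = _
    have e1 : EN n ≠ 0 := (hpos n).ne'
    have e2 := (ha n).ne'
    have e3 := (hb n).ne'
    have e4 := (hdpos n hn0).ne'
    have e5 := hdsq n
    field_simp
    rw [e5]
    ring
  · have hlim : Tendsto (fun n : ℕ => v n / (ht n * hz n) / f ^ 2) atTop
        (𝓝 (varianceNW K f₃ t z)) := by
      have := hsq.div_const (f ^ 2)
      convert this using 2
      rw [varianceNW, ← hf_def]
      field_simp
    have herr := (hratio2.mul_const C).div_const (f ^ 2)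
    rw [zero_mul, zero_div] at herr
    filter_upwards [hSsq, Metric.tendsto_nhds.1 hlim (ε / 2) (half_pos hε),
      herr.eventually_lt_const (half_pos hε), eventually_gt_atTop 0] with n hn hl he hn0 i
    have e1 : 0 < EN n := hpos n
    have e2 := ha n
    have e3 := hb n
    have e4 := hdpos n hn0
    have e5 := hdsq n
    have e6 : (0 : ℝ) < n := by exact_mod_cast hn0
    rw [Real.dist_eq] at hl
    simp_rw [div_pow]
    rw [integral_div]
    change |n * ((∫ ω, S n i ω ^ 2 ∂P) / (f * d n) ^ 2) - _| ≤ ε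
    rw [mul_pow, e5]
    have key : |n * ((∫ ω, S n i ω ^ 2 ∂P) / (f ^ 2 * (n * EN n * (ht n * hz n)))) -
        v n / (ht n * hz n) / f ^ 2| ≤
        E2 n / EN n ^ 2 * (EN n * ht n * (v n / (ht n * hz n))) * C / f ^ 2 := by
      have e7 : (n : ℝ) * ((∫ ω, S n i ω ^ 2 ∂P) / (f ^ 2 * (n * EN n * (ht n * hz n)))) -
          v n / (ht n * hz n) / f ^ 2 =
          (∫ ω, S n i ω ^ 2 ∂P - EN n * v n) / (f ^ 2 * EN n * (ht n * hz n)) := by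
        field_simp
      rw [e7, abs_div, abs_of_pos (a := f ^ 2 * EN n * (ht n * hz n)) (by positivity),
        div_le_iff₀ (by positivity)]
      refine (hn i).trans_eq ?_
      field_simp
    rw [abs_le] at key
    rw [abs_lt] at hl
    rw [abs_le]
    constructor <;> linarith [key.1, key.2, hl.1, hl.2]
  -- With this share of ε the large terms contribute exactly ε/2 after multiplication by 2 n E(N)
  -- and division by (f d)².
  · obtain ⟨M, hM, htr⟩ := hD.exists_truncation_level hreg hK μ ha hb ha0 hb0
      (ε := ε / 4 * f ^ 2) (by positivity)
    have herr := ((hratio3.mul_const (4 * M / (δ ^ 2 * f ^ 4))).add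
      ((hratio2.mul_const (2 * C)).div_const (f ^ 2)))
    rw [zero_mul, zero_mul, zero_div, zero_add] at herr
    filter_upwards [hL2, hcross, htr, herr.eventually_lt_const (half_pos hε),
      eventually_gt_atTop 0] with n hL2 hcross htr he hn0 i
    have e1 : 0 < EN n := hpos n
    have e2 := ha n
    have e3 := hb n
    have e4 := hdpos n hn0
    have e5 := hdsq n
    have e6 : (0 : ℝ) < n := by exact_mod_cast hn0
    have hle := integral_indicator_sq_randomSum_le (hC.measurable_N n i)
      (hD.measurable_subjectData i)
      (hC.indepFun_subject n i) (fun j => measurable_kernelTerm hKm hγ j) (hL2 i)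
      (hξ_sq n i) (hN1 n i) (hC.integrable_pow n i (by norm_num))
      (mul_nonneg (hv0 n) (mul_nonneg hC0 (ha n).le)) (hcross i)
      (δ := δ * (f * d n)) (by positivity) hM (htr i)
    rw [hN1', hC.integral_pow n i 2] at hle
    have hscale := fun ω => indicator_sq_div (δ := δ) (mul_pos hf e4) (S n i ω)
    change n * ∫ ω, {y : ℝ | δ < |y|}.indicator (fun y => y ^ 2) (S n i ω / (f * d n)) ∂P ≤ ε
    simp_rw [hscale]
    rw [integral_div]
    change _ ≤ E2 n * (4 * M * v n / (δ * (f * d n)) ^ 2) +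
      EN n * (2 * (ε / 4 * f ^ 2 * (ht n * hz n))) + E2 n * (2 * (v n * (C * ht n))) at hle
    calc _ ≤ n * ((E2 n * (4 * M * v n / (δ * (f * d n)) ^ 2) +
          EN n * (2 * (ε / 4 * f ^ 2 * (ht n * hz n))) + E2 n * (2 * (v n * (C * ht n)))) /
          (f * d n) ^ 2) := by gcongr; exact hle
      _ = E2 n / EN n ^ 2 * (1 / (n * (ht n * hz n)) * (v n / (ht n * hz n))) *
            (4 * M / (δ ^ 2 * f ^ 4)) +
          E2 n / EN n ^ 2 * (EN n * ht n * (v n / (ht n * hz n))) * (2 * C) / f ^ 2 + ε / 2 := by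
        simp only [mul_pow, e5]
        field_simp
        ring
      _ ≤ ε := by linarith

end

/-! ### Slutsky's lemma and the conclusion. -/

theorem RandomCounts.measurable_averageCount {Ω : Type*} [MeasurableSpace Ω] {P : Measure Ω}
    {T Y : ℕ → ℕ → Ω → ℝ} {Z : ℕ → Ω → ℝ} {N : (n : ℕ) → Fin n → Ω → ℕ} {N₀ : ℕ → Ω → ℕ}
    (hC : RandomCounts P T Y Z N N₀) (n : ℕ) : Measurable (averageCount n (N n)) :=
  (Finset.measurable_fun_sum _ fun i _ =>
    (measurable_of_countable fun k : ℕ => (k : ℝ)).comp (hC.measurable_N n i)).div_const _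

theorem kernelSum_sub (K : ℝ × ℝ → ℝ) (a b t z m : ℝ) (k : ℕ) (d : ℝ × (ℕ → ℝ × ℝ)) :
    kernelSum K (fun y => y - m) a b t z k d =
      kernelSum K id a b t z k d - m * kernelSum K (fun _ => 1) a b t z k d := by
  simp only [kernelSum, kernelTerm, Finset.mul_sum, ← Finset.sum_sub_distrib, id]
  exact Finset.sum_congr rfl fun j _ => by ring

/-- If `Q` and `A` tend to one in measure, a statistic that equals `U √A / Q` where `Q > 1 / 2` has
the limit law of `U`. -/
theorem MeasureTheory.TendstoInDistribution.mul_sqrt_div_of_tendstoInMeasure_one {Ω Ω' : Type*}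
    [MeasurableSpace Ω] [MeasurableSpace Ω'] {P : Measure Ω} [IsProbabilityMeasure P]
    {P' : Measure Ω'} [IsProbabilityMeasure P'] {U A Q V : ℕ → Ω → ℝ} {G : Ω' → ℝ}
    (hU : TendstoInDistribution U atTop G (fun _ => P) P')
    (hA : TendstoInMeasure P A atTop fun _ => 1) (hQ : TendstoInMeasure P Q atTop fun _ => 1)
    (hAm : ∀ n, AEMeasurable (A n) P) (hQm : ∀ n, AEMeasurable (Q n) P)
    (hVm : ∀ n, AEMeasurable (V n) P)
    (hV : ∀ᶠ n in atTop, ∀ ω, 1 / 2 < Q n ω → V n ω = U n ω * √(A n ω) / Q n ω) :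
    TendstoInDistribution V atTop G (fun _ => P) P' := by
  have h1 := hU.continuous_comp_prodMk_of_tendstoInMeasure_const
    (g := fun p : ℝ × ℝ => p.1 * √p.2) (by fun_prop) hA hAm
  -- Replacing Q by max(Q, 1/2) makes the quotient continuous on the whole plane and changes nothing
  -- in the limit, where Q is one.
  have h2 := h1.continuous_comp_prodMk_of_tendstoInMeasure_const
    (g := fun p : ℝ × ℝ => p.1 / max p.2 (1 / 2))
    (by
      refine Continuous.div (by fun_prop) (by fun_prop) fun p => ?_
      have : (0 : ℝ) < max p.2 (1 / 2) := lt_max_of_lt_right (by norm_num)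
      exact this.ne') hQ hQm
  have hG : (fun ω => G ω * √1 / max (1 : ℝ) (1 / 2)) = G := by
    ext ω
    rw [max_eq_left (by norm_num)]
    simp
  dsimp only at h2
  rw [hG] at h2
  -- The statistic can differ from its truncated version only where Q ≤ 1/2, an event contained in
  -- {|Q - 1| ≥ 1/2}, whose probability tends to zero.
  refine tendstoInDistribution_of_tendstoInMeasure_sub V G h2 ?_ hVm
  rw [tendstoInMeasure_iff_dist] at hQ ⊢
  intro ε hε
  refine tendsto_of_tendsto_of_tendsto_of_le_of_le' tendsto_const_nhds
    (hQ (1 / 2) (by norm_num)) (.of_forall fun _ => zero_le) ?_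
  filter_upwards [hV] with n hn
  refine measure_mono fun ω hω => ?_
  rw [Set.mem_ofPred_eq] at hω ⊢
  by_contra! hlt
  rw [Real.dist_eq, abs_lt] at hlt
  have hq : 1 / 2 < Q n ω := by linarith [hlt.1]
  refine absurd hω (not_le.2 ?_)
  simp only [Pi.sub_apply, Pi.zero_apply]
  rw [hn ω hq, max_eq_left hq.le, sub_self, dist_self]
  exact hε

theorem theorem3p1 {Ω : Type*} [MeasurableSpace Ω] (P : Measure Ω) [IsProbabilityMeasure P]
    (T Y : ℕ → ℕ → Ω → ℝ) (Z : ℕ → Ω → ℝ)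
    (N : (n : ℕ) → Fin n → Ω → ℕ) (N₀ : ℕ → Ω → ℕ)
    (f₃ : ℝ → ℝ → ℝ → ℝ) (f₅ : ℝ → ℝ → ℝ → ℝ → ℝ → ℝ)
    (K : ℝ × ℝ → ℝ) (ht hz h : ℕ → ℝ) (t z ρ τ : ℝ)
    (hdesign : RandomDesign P T Y Z f₃ f₅)
    (hcounts : RandomCounts P T Y Z N N₀)
    (hK : IsSecondOrderKernel K)
    (hband : BandwidthConditions (fun n => countMoment P 1 (N₀ n)) ht hz h)
    (hreg : LocalRegularity f₃ f₅ t z)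
    (hρ : 0 < ρ) (hτ : 0 < τ)
    (hratio : Tendsto (fun n => hz n / ht n) atTop (𝓝 ρ))
    (hrate : Tendsto (fun n : ℕ => n * countMoment P 1 (N₀ n) * ht n ^ 6) atTop (𝓝 (τ ^ 2))) :
    0 ≤ varianceNW K f₃ t z ∧
    TendstoInDistribution
      (fun (n : ℕ) ω => Real.sqrt (n * averageCount n (N n) ω * ht n * hz n) *
        (nadarayaWatson K T Y Z n (N n) (ht n) (hz n) t z ω - condMean f₃ t z))
      atTop (id : ℝ → ℝ) (fun _ => P)
      (gaussianReal (biasNW K f₃ ρ τ t z) (varianceNW K f₃ t z).toNNReal) := by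
  refine ⟨hdesign.varianceNW_nonneg hreg, ?_⟩
  have hpos := hcounts.countMoment_one_pos
  have hab := hband.tendsto_one_div hpos hρ hτ hratio hrate
  have hsum : ∀ γ : ℝ → ℝ, Measurable γ → ∀ n, Measurable fun ω => ∑ i,
      kernelSum K γ (ht n) (hz n) t z (N n i ω) (subjectData T Y Z i ω) := fun γ hγ n =>
    Finset.measurable_fun_sum _ fun i _ =>
      hdesign.measurable_kernelSum_subject hcounts hK.measurable hγ n i
  refine (hdesign.tendstoInDistribution_sum_kernelSum hcounts hK hband hreg hρ hτ hratio
    hrate).mul_sqrt_div_of_tendstoInMeasure_one hcounts.tendstoInMeasure_averageCount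
    (hdesign.tendstoInMeasure_sum_kernelSum hcounts hreg hK hband.ht_pos hband.hz_pos
      hband.tendsto_ht hband.tendsto_hz hab)
    (fun n => ((hcounts.measurable_averageCount n).div_const _).aemeasurable)
    (fun n => ((hsum _ measurable_const n).div_const _).aemeasurable) (fun n => ?_) ?_
  · simp_rw [nadarayaWatson_eq]
    have h1 := hcounts.measurable_averageCount n
    exact ((((h1.const_mul _).mul_const _).mul_const _).sqrt.mul
      (((hsum _ measurable_id n).div (hsum _ measurable_const n)).sub_const _)).aemeasurable
  filter_upwards [eventually_gt_atTop 0] with n hn ω hq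
  have e1 := hpos n
  have e2 := hband.ht_pos n
  have e3 := hband.hz_pos n
  have e4 : (0 : ℝ) < n := by exact_mod_cast hn
  have e5 := hreg.f₂_pos
  rw [nadarayaWatson_eq, ← Finset.sum_div]
  simp_rw [kernelSum_sub, Finset.sum_sub_distrib, ← Finset.mul_sum]
  set D := ∑ i, kernelSum K (fun _ => 1) (ht n) (hz n) t z (N n i ω) (subjectData T Y Z i ω)
  set U := ∑ i, kernelSum K id (ht n) (hz n) t z (N n i ω) (subjectData T Y Z i ω)
  set EN := countMoment P 1 (N₀ n)
  set f := marginalDensity f₃ t z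
  set μ := condMean f₃ t z
  -- The kernel may take negative values, so positivity of the denominator is available only where Q
  -- > 1/2. Elsewhere the value assigned to the quotient is immaterial.
  have hD : 0 < D := by
    have := (one_half_pos (α := ℝ)).trans hq
    exact (div_pos_iff_of_pos_right (by positivity)).1 this
  have hpos' : 0 < n * EN * (ht n * hz n) := by positivity
  -- The random normalization is the deterministic one times √(N̄ / E(N)), the factor that Slutsky's
  -- lemma removes.
  have hroot : √(n * averageCount n (N n) ω * ht n * hz n) =
      √(averageCount n (N n) ω / EN) * √(n * EN * (ht n * hz n)) := by
    rw [← Real.sqrt_mul' _ hpos'.le]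
    congr 1
    field_simp
  have hd := Real.sqrt_pos.2 hpos'
  have hd2 := Real.sq_sqrt hpos'.le
  rw [hroot]
  set d := √(n * EN * (ht n * hz n))
  rw [← hd2]
  field_simp
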